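/- Let $K$ be a field and let $(V,\omega)$ be a symplectic $K$-vector space of genus $n\ge 1$ (i.e. $\dim V=2n$ and $\omega$ is bilinear, alternating and non-degenerate), and let $\mathrm{Sp}(V)$ be the group of form-preserving linear automorphisms of $V$. Notation. For a subspace $W\neq 0$ let $\mathrm{St}(W)=\widetilde{\mathrm H}_{\dim W-2}$ of the complex of flags of non-zero proper subspaces of $W$; for a symplectic space $W$ of genus $m$ let $\mathrm{St}^\omega(W)=\widetilde{\mathrm H}_{m-1}$ of the complex of flags of non-zero isotropic subspaces of $W$. A basis $v=(v_1,\dots,v_m)$ of $W$ gives the apartment class $[v]\in \mathrm{St}(W)$ of $\sum_{\sigma}\mathrm{sgn}(\sigma)\,[\langle v_{\sigma(1)}\rangle,\dots,\langle v_{\sigma(1)},\dots,v_{\sigma(m-1)}\rangle]$ (sum over permutations), and a symplectic basis $u=(e_1,f_1,\dots,e_m,f_m)$ of $W$, up to rescaling of its vectors, gives the symplectic apartment class $[u]^\omega\in\mathrm{St}^\omega(W)$ of the analogous signed sum over signed permutations, whose flags have length $m$. The genus of a subspace $U$ is half the rank of $\omega|_U$; for $0\le p\le n$ let $\mathcal I^p(V)$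 be the simplicial complex whose simplices are the finite sets of lines of $V$ whose span has genus $\le p$, and let $\mathcal I^{-1}(V)$ be void. Put $T_0=\mathrm{St}^\omega(V)$ and, for $1\le p\le n$, $T_p=\bigoplus_{g(W)=p}\mathrm{St}(W)\otimes_{\mathbb Z}\mathrm{St}^\omega(W^\perp)$, the sum over symplectic subspaces $W\subseteq V$ of genus $p$, with the natural action of $\mathrm{Sp}(V)$. For $v$ a basis of a symplectic subspace $W$ of genus $p$ and $u$ a symplectic basis of $W^\perp$ up to rescaling, let $\langle v\,|\,u\rangle\in T_p$ be $[v]\otimes[u]^\omega$ (and $[u]^\omega$ if $p=0$). Then there are $\mathrm{Sp}(V)$-equivariant homomorphisms $d_p\colon T_{p+1}\to T_p$ and an $\mathrm{Sp}(V)$-equivariant isomorphism $\mathrm{St}(V)\cong T_n$, $[v]\mapsto\langle v\,|\,\emptyset\rangle$, such that the following hold. 1. The sequence of $\mathbb Z[\mathrm{Sp}(V)]$-modules $$0\to \mathrm{St}(V)\to\bigoplus_{g(W)=n-1}\mathrm{St}(W)\otimes\mathrm{St}^\omega(W^\perp)\to\cdots\to\bigoplus_{g(W)=1}\mathrm{St}(W)\otimes\mathrm{St}^\omega(W^\perp)\to\mathrm{St}^\omega(V)\to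 0$$ (with first term identified with $T_n$, and differentials $d_{n-1},\dots,d_0$) is exact. 2. If $v=(v_0,\dots,v_{2p+1})$ is a basis of a symplectic subspace $W$ of genus $p+1$ and $u$ is a symplectic basis of $W^\perp$ up to rescaling, then $$d_p\langle v\,|\,u\rangle=\sum_{i<j,\ i\sim j}(-1)^{i+j-1}\langle v_0,\dots,\widehat{v_i},\dots,\widehat{v_j},\dots,v_{2p+1}\,|\,w_i,w_j,u\rangle ,$$ where $i\sim j$ means that the span $W_{ij}$ of the vectors $v_k$, $k\ne i,j$, is a symplectic subspace, and $w_i,w_j$ are the projections of $v_i,v_j$ onto $W_{ij}^\perp$. 3. The resolution is, up to the sign of the differential, the row $E^1_{\bullet,n-1}$ of the spectral sequence of the filtration $\mathcal I^0(V)\subset\cdots\subset\mathcal I^n(V)$: there are $\mathrm{Sp}(V)$-equivariant isomorphisms $\varphi_p\colon T_p\cong \mathrm H_{n+p-1}(\mathcal I^p(V),\mathcal I^{p-1}(V))$ (reduced homology $\widetilde{\mathrm H}_{n-1}(\mathcal I^0(V))$ for $p=0$) that take $\langle v\,|\,u\rangle$, $u=(e_1,f_1,\dots,e_m,f_m)$,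 to the class of the chain $[\langle v_0\rangle,\dots,\langle v_{2p-1}\rangle]*([\langle e_1\rangle]-[\langle f_1\rangle])*\cdots*([\langle e_m\rangle]-[\langle f_m\rangle])$, and $\varphi_p\circ d_p=-\partial\circ\varphi_{p+1}$, where $\partial$ is the connecting homomorphism of the triple $(\mathcal I^{p+1}(V),\mathcal I^p(V),\mathcal I^{p-1}(V))$. -/

import Mathlib

open scoped TensorProduct DirectSum

noncomputable section

namespace SymplecticResolution

/-! ### Augmented simplicial complexes, oriented chains, relative homology -/

/-- A simplicial complex on a vertex set `S`: its simplices are the finite sets `σ` of vertices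
with `IsFace σ`.  The empty simplex is allowed (it gives the augmentation, so that the homology
below is reduced homology), and so is the void complex, which does not even have the empty
simplex. -/
structure AugComplex (S : Type*) where
  IsFace : Set S → Prop
  down_closed : ∀ σ τ : Set S, τ ⊆ σ → IsFace σ → IsFace τ

/-- The complex with no simplices at all (not even the empty one). -/
def AugComplex.void (S : Type*) : AugComplex S where
  IsFace _ := False
  down_closed _ _ _ h := h

/-- Oriented chains on the vertex set `S` (of the full simplex on `S`): the exterior algebra of
the free abelian group on `S`.  Its degree `k` part is the free abelian group on `k`-tuples of
vertices modulo the usual sign rule (tuples with a repeated vertex being zero).  The product is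
the join of chains. -/
abbrev Chains (S : Type*) : Type _ := ExteriorAlgebra ℤ (S →₀ ℤ)

/-- The oriented simplex `[s₀, …, s_k]`. -/
def simplex {S : Type*} (l : List S) : Chains S :=
  (l.map fun s => ExteriorAlgebra.ι ℤ (Finsupp.single s (1 : ℤ))).prod

/-- The augmented simplicial boundary, `∂[s₀, …, s_k] = ∑ᵢ (-1)ⁱ [s₀, …, ŝᵢ, …, s_k]`
(see `boundary_simplex`), given by contraction with the augmentation `S →₀ ℤ → ℤ`. -/
def boundary {S : Type*} : Chains S →ₗ[ℤ] Chains S :=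
  CliffordAlgebra.contractLeft (Finsupp.linearCombination ℤ fun _ : S => (1 : ℤ))

theorem simplex_cons {S : Type*} (s : S) (l : List S) :
    simplex (s :: l) = ExteriorAlgebra.ι ℤ (Finsupp.single s (1 : ℤ)) * simplex l := by
  simp [simplex]

theorem boundary_simplex_cons {S : Type*} (s : S) (l : List S) :
    boundary (simplex (s :: l)) =
      simplex l - ExteriorAlgebra.ι ℤ (Finsupp.single s (1 : ℤ)) * boundary (simplex l) := by
  rw [simplex_cons, boundary, ExteriorAlgebra.ι, CliffordAlgebra.contractLeft_ι_mul]
  simp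

theorem boundary_simplex {S : Type*} (l : List S) :
    boundary (simplex l) =
      ∑ i ∈ Finset.range l.length, (-1 : ℤ) ^ i • simplex (l.eraseIdx i) := by
  induction l with
  | nil => simp [simplex, boundary]
  | cons s l ih =>
    rw [boundary_simplex_cons, ih]
    simp only [List.length_cons, Finset.sum_range_succ']
    simp only [pow_zero, one_smul, List.eraseIdx_zero, List.tail_cons,
      List.eraseIdx_cons_succ, simplex_cons, pow_succ, mul_neg, mul_one, neg_smul,
      Finset.mul_sum, mul_smul_comm, Finset.sum_neg_distrib, sub_eq_add_neg, add_comm]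

theorem boundary_boundary {S : Type*} (c : Chains S) : boundary (boundary c) = 0 :=
  CliffordAlgebra.contractLeft_contractLeft _ _

/-- The augmented oriented chains of `X` spanned by the simplices with `k` vertices, that is, of
dimension `k - 1`. -/
def AugComplex.chains {S : Type*} (X : AugComplex S) (k : ℕ) : Submodule ℤ (Chains S) :=
  Submodule.span ℤ {c | ∃ l : List S, l.length = k ∧ X.IsFace {s | s ∈ l} ∧ c = simplex l}

/-- Relative cycles of the pair `(X, Y)` in dimension `k - 1`. -/
def relCycles {S : Type*} (X Y : AugComplex S) (k : ℕ) : Submodule ℤ (Chains S) :=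
  X.chains k ⊓ (Y.chains (k - 1)).comap boundary

/-- Relative boundaries of the pair `(X, Y)` in dimension `k - 1`. -/
def relBoundaries {S : Type*} (X Y : AugComplex S) (k : ℕ) : Submodule ℤ (Chains S) :=
  (X.chains (k + 1)).map boundary ⊔ Y.chains k

/-- The relative homology `H_{k-1}(X, Y)`, computed from augmented chains; the index `k` counts
vertices.  If `Y` is void this is the reduced homology of `X`. -/
def RelHomology {S : Type*} (X Y : AugComplex S) (k : ℕ) : Type _ :=
  ↥(relCycles X Y k) ⧸ (relBoundaries X Y k).comap (relCycles X Y k).subtype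

instance {S : Type*} (X Y : AugComplex S) (k : ℕ) : AddCommGroup (RelHomology X Y k) :=
  inferInstanceAs (AddCommGroup
    (↥(relCycles X Y k) ⧸ (relBoundaries X Y k).comap (relCycles X Y k).subtype))

instance {S : Type*} (X Y : AugComplex S) (k : ℕ) : Module ℤ (RelHomology X Y k) :=
  inferInstanceAs (Module ℤ
    (↥(relCycles X Y k) ⧸ (relBoundaries X Y k).comap (relCycles X Y k).subtype))

/-- The reduced homology `H̃_{k-1}(X)`. -/
abbrev RedHomology {S : Type*} (X : AugComplex S) (k : ℕ) : Type _ :=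
  RelHomology X (AugComplex.void S) k

/-- The homology class of a relative cycle. -/
def relClass {S : Type*} {X Y : AugComplex S} {k : ℕ} (c : Chains S)
    (hc : c ∈ relCycles X Y k) : RelHomology X Y k :=
  Submodule.Quotient.mk ⟨c, hc⟩

/-- The connecting homomorphism `H_k(X, Y) → H_{k-1}(Y, Z)` of a triple. -/
def connecting {S : Type*} (X Y Z : AugComplex S) (k : ℕ) :
    RelHomology X Y (k + 1) →ₗ[ℤ] RelHomology Y Z k :=
  Submodule.mapQ _ _
    (boundary.restrict (p := relCycles X Y (k + 1)) (q := relCycles Y Z k) (by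
      intro c hc
      refine ⟨hc.2, ?_⟩
      simp [boundary_boundary]))
    (by
      rintro ⟨c, hc⟩ h
      simp only [Submodule.mem_comap, Submodule.subtype_apply] at h
      obtain ⟨_, ⟨e, -, rfl⟩, y, hy, hyc⟩ := Submodule.mem_sup.1 h
      simp only [Submodule.mem_comap, Submodule.subtype_apply]
      change boundary c ∈ _
      rw [← hyc, map_add, boundary_boundary, zero_add]
      exact Submodule.mem_sup_left ⟨y, hy, rfl⟩)

/-! ### Functoriality -/

/-- The chain map induced by a map of vertices. -/
def chainMap {S S' : Type*} (f : S → S') : Chains S →ₗ[ℤ] Chains S' :=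
  (ExteriorAlgebra.map (Finsupp.lmapDomain ℤ ℤ f)).toLinearMap

theorem chainMap_simplex {S S' : Type*} (f : S → S') (l : List S) :
    chainMap f (simplex l) = simplex (l.map f) := by
  simp [chainMap, simplex, map_list_prod, Function.comp_def, Finsupp.mapDomain_single]

theorem chainMap_boundary {S S' : Type*} (f : S → S') (c : Chains S) :
    chainMap f (boundary c) = boundary (chainMap f c) := by
  have key : ∀ m : S →₀ ℤ, Finsupp.linearCombination ℤ (fun _ : S' => (1 : ℤ))
      (Finsupp.lmapDomain ℤ ℤ f m) = Finsupp.linearCombination ℤ (fun _ : S => (1 : ℤ)) m := by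
    intro m
    rw [Finsupp.lmapDomain_apply, Finsupp.linearCombination_mapDomain]
    rfl
  induction c using CliffordAlgebra.left_induction with
  | algebraMap r =>
    have h : chainMap f (algebraMap ℤ _ r) = algebraMap ℤ (Chains S') r :=
      AlgHom.commutes (ExteriorAlgebra.map (Finsupp.lmapDomain ℤ ℤ f)) r
    rw [h, boundary, boundary, CliffordAlgebra.contractLeft_algebraMap,
      CliffordAlgebra.contractLeft_algebraMap, map_zero]
  | add x y hx hy => simp only [map_add, hx, hy]
  | ι_mul x m hx =>
    have h : ∀ y : Chains S, chainMap f (ExteriorAlgebra.ι ℤ m * y) =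
        ExteriorAlgebra.ι ℤ (Finsupp.lmapDomain ℤ ℤ f m) * chainMap f y := by
      intro y
      simp only [chainMap, AlgHom.toLinearMap_apply, map_mul, ExteriorAlgebra.map_apply_ι]
    have h1 : ∀ y : Chains S, boundary (ExteriorAlgebra.ι ℤ m * y) =
        Finsupp.linearCombination ℤ (fun _ : S => (1 : ℤ)) m • y
          - ExteriorAlgebra.ι ℤ m * boundary y :=
      fun y => CliffordAlgebra.contractLeft_ι_mul _ _ _
    have h2 : ∀ (m : S' →₀ ℤ) (y : Chains S'), boundary (ExteriorAlgebra.ι ℤ m * y) =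
        Finsupp.linearCombination ℤ (fun _ : S' => (1 : ℤ)) m • y
          - ExteriorAlgebra.ι ℤ m * boundary y :=
      fun m y => CliffordAlgebra.contractLeft_ι_mul _ _ _
    change chainMap f (boundary (ExteriorAlgebra.ι ℤ m * x)) =
      boundary (chainMap f (ExteriorAlgebra.ι ℤ m * x))
    rw [h, h1, h2, key, map_sub, map_smul, h, hx]

theorem chainMap_id {S : Type*} (c : Chains S) : chainMap id c = c := by
  simp [chainMap, Finsupp.lmapDomain_id, ExteriorAlgebra.map_id]

theorem chainMap_comp {S S' S'' : Type*} (f : S → S') (g : S' → S'') (c : Chains S) :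
    chainMap (g ∘ f) c = chainMap g (chainMap f c) := by
  rw [chainMap, Finsupp.lmapDomain_comp, ← ExteriorAlgebra.map_comp_map]
  rfl

theorem chainMap_one_smul {G S : Type*} [Group G] [MulAction G S] (c : Chains S) :
    chainMap ((1 : G) • · : S → S) c = c := by
  simp only [one_smul]
  exact chainMap_id c

theorem chainMap_mul_smul {G S : Type*} [Group G] [MulAction G S] (g h : G) (c : Chains S) :
    chainMap ((g * h) • · : S → S) c = chainMap (g • ·) (chainMap (h • ·) c) := by
  rw [← chainMap_comp]
  simp only [Function.comp_def, mul_smul]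

/-- A map of vertices is simplicial from `X` to `X'` if it takes simplices to simplices. -/
def IsSimplicial {S S' : Type*} (f : S → S') (X : AugComplex S) (X' : AugComplex S') : Prop :=
  ∀ σ, X.IsFace σ → X'.IsFace (f '' σ)

theorem isSimplicial_void {S S' : Type*} (f : S → S') :
    IsSimplicial f (AugComplex.void S) (AugComplex.void S') := fun _ h => h

theorem chainMap_mem_chains {S S' : Type*} {f : S → S'} {X : AugComplex S} {X' : AugComplex S'}
    (hf : IsSimplicial f X X') {k : ℕ} {c : Chains S} (hc : c ∈ X.chains k) :
    chainMap f c ∈ X'.chains k := by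
  suffices X.chains k ≤ (X'.chains k).comap (chainMap f) from this hc
  refine Submodule.span_le.2 ?_
  rintro _ ⟨l, hl, hX, rfl⟩
  refine Submodule.subset_span ⟨l.map f, by simpa using hl, ?_, chainMap_simplex f l⟩
  have := hf _ hX
  convert this using 1
  ext x
  simp

theorem chainMap_mem_relCycles {S S' : Type*} {f : S → S'} {X Y : AugComplex S}
    {X' Y' : AugComplex S'} (hX : IsSimplicial f X X') (hY : IsSimplicial f Y Y') {k k' : ℕ}
    (hk : k = k') {c : Chains S} (hc : c ∈ relCycles X Y k) :
    chainMap f c ∈ relCycles X' Y' k' := by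
  subst hk
  refine ⟨chainMap_mem_chains hX hc.1, ?_⟩
  have := chainMap_mem_chains hY hc.2
  rwa [chainMap_boundary] at this

/-- The map induced on relative homology by a simplicial map of pairs. -/
def homologyMap {S S' : Type*} {X Y : AugComplex S} {X' Y' : AugComplex S'} {k k' : ℕ}
    (f : S → S') (hX : IsSimplicial f X X') (hY : IsSimplicial f Y Y') (hk : k = k') :
    RelHomology X Y k →ₗ[ℤ] RelHomology X' Y' k' :=
  Submodule.mapQ _ _
    ((chainMap f).restrict (p := relCycles X Y k) (q := relCycles X' Y' k')
      fun _ hc => chainMap_mem_relCycles hX hY hk hc)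
    (by
      subst hk
      rintro ⟨c, hc⟩ h
      simp only [Submodule.mem_comap, Submodule.subtype_apply] at h
      obtain ⟨_, ⟨e, he, rfl⟩, y, hy, hyc⟩ := Submodule.mem_sup.1 h
      simp only [Submodule.mem_comap, Submodule.subtype_apply]
      change chainMap f c ∈ _
      rw [← hyc, map_add, chainMap_boundary]
      exact Submodule.add_mem_sup ⟨_, chainMap_mem_chains hX he, rfl⟩
        (chainMap_mem_chains hY hy))

theorem homologyMap_relClass {S S' : Type*} {X Y : AugComplex S} {X' Y' : AugComplex S'}
    {k k' : ℕ} (f : S → S') (hX : IsSimplicial f X X') (hY : IsSimplicial f Y Y') (hk : k = k')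
    (c : Chains S) (hc : c ∈ relCycles X Y k) :
    homologyMap f hX hY hk (relClass c hc) =
      relClass (chainMap f c) (chainMap_mem_relCycles hX hY hk hc) :=
  rfl

theorem relClass_surjective {S : Type*} {X Y : AugComplex S} {k : ℕ} (x : RelHomology X Y k) :
    ∃ c hc, x = relClass c hc := by
  obtain ⟨⟨c, hc⟩, rfl⟩ := Submodule.Quotient.mk_surjective _ x
  exact ⟨c, hc, rfl⟩

theorem relClass_congr {S : Type*} {X Y : AugComplex S} {k : ℕ} {c c' : Chains S} (h : c = c')
    (hc : c ∈ relCycles X Y k) (hc' : c' ∈ relCycles X Y k) : relClass c hc = relClass c' hc' := by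
  subst h
  rfl

/-- The representation on relative homology given by an action on vertices preserving `X` and
`Y`. -/
def homologyRep {G S : Type*} [Group G] [MulAction G S] (X Y : AugComplex S) (k : ℕ)
    (hX : ∀ g : G, IsSimplicial (g • · : S → S) X X)
    (hY : ∀ g : G, IsSimplicial (g • · : S → S) Y Y) :
    Representation ℤ G (RelHomology X Y k) where
  toFun g := homologyMap (g • ·) (hX g) (hY g) rfl
  map_one' := by
    refine LinearMap.ext fun x => ?_
    obtain ⟨c, hc, rfl⟩ := relClass_surjective x
    rw [homologyMap_relClass]
    refine relClass_congr ?_ _ _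
    exact chainMap_one_smul c
  map_mul' g h := by
    refine LinearMap.ext fun x => ?_
    obtain ⟨c, hc, rfl⟩ := relClass_surjective x
    rw [Module.End.mul_apply, homologyMap_relClass, homologyMap_relClass, homologyMap_relClass]
    exact relClass_congr (chainMap_mul_smul g h c) _ _

/-! ### Symplectic geometry -/

section Symplectic

variable {K V : Type*} [Field K] [AddCommGroup V] [Module K V] (ω : LinearMap.BilinForm K V)

/-- The group `Sp(V)` of form-preserving linear automorphisms of `(V, ω)`. -/
def Sp : Subgroup (V ≃ₗ[K] V) where
  carrier := {g | ∀ x y, ω (g x) (g y) = ω x y}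
  one_mem' _ _ := rfl
  mul_mem' {g h} hg hh x y := by
    rw [LinearEquiv.mul_apply, LinearEquiv.mul_apply, hg, hh]
  inv_mem' {g} hg x y := by
    have := hg (g⁻¹ x) (g⁻¹ y)
    rw [← LinearEquiv.mul_apply, ← LinearEquiv.mul_apply, mul_inv_cancel] at this
    exact this.symm

variable {ω}

theorem Sp.form_smul (g : Sp ω) (x y : V) : ω (g • x) (g • y) = ω x y := g.2 x y

variable (ω)

/-- Half the rank of the restriction of `ω` to `U`. -/
def genus (U : Submodule K V) : ℕ :=
  Module.finrank K (LinearMap.range (ω.restrict U)) / 2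

open scoped Pointwise in
theorem finrank_smul (g : Sp ω) (U : Submodule K V) :
    Module.finrank K ↥(g • U) = Module.finrank K U :=
  LinearEquiv.finrank_map_eq g.1 U

theorem genus_le_of_map [FiniteDimensional K V] {U U' : Submodule K V} (f : U →ₗ[K] U')
    (hf : ∀ x y : U, ω (f x) (f y) = ω x y) : genus ω U ≤ genus ω U' := by
  have h : ω.restrict U = f.dualMap ∘ₗ (ω.restrict U') ∘ₗ f := by
    ext x y
    exact (hf x y).symm
  refine Nat.div_le_div_right ?_
  calc Module.finrank K (LinearMap.range (ω.restrict U))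
      ≤ Module.finrank K ((LinearMap.range (ω.restrict U')).map f.dualMap) := by
        refine Submodule.finrank_mono ?_
        rw [h]
        rintro _ ⟨x, rfl⟩
        exact ⟨_, ⟨f x, rfl⟩, rfl⟩
    _ ≤ _ := Submodule.finrank_map_le _ _

theorem genus_mono [FiniteDimensional K V] {U U' : Submodule K V} (h : U ≤ U') :
    genus ω U ≤ genus ω U' :=
  genus_le_of_map ω (Submodule.inclusion h) fun _ _ => rfl

open scoped Pointwise in
theorem genus_smul_le [FiniteDimensional K V] (g : Sp ω) (U : Submodule K V) :
    genus ω (g • U) ≤ genus ω U := by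
  have h : ∀ x : ↥(g • U), g⁻¹ • (x : V) ∈ U := by
    rintro ⟨_, x, hx, rfl⟩
    change g⁻¹ • g • x ∈ U
    rwa [inv_smul_smul]
  refine genus_le_of_map ω
    (LinearMap.codRestrict U ((g⁻¹ : Sp ω).1.toLinearMap ∘ₗ (g • U).subtype) h) fun x y => ?_
  exact Sp.form_smul g⁻¹ (x : V) (y : V)

/-! ### The complexes -/

/-- The Tits building of `W`: flags of nonzero proper subspaces of `W`. -/
def titsBuilding (W : Submodule K V) : AugComplex (Submodule K V) where
  IsFace σ := (∀ U ∈ σ, U ≠ ⊥ ∧ U < W) ∧ IsChain (· ≤ ·) σ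
  down_closed _ _ hτ h := ⟨fun U hU => h.1 U (hτ hU), h.2.mono hτ⟩

/-- The symplectic Tits building of `W`: flags of nonzero isotropic subspaces of `W`. -/
def sympTitsBuilding (W : Submodule K V) : AugComplex (Submodule K V) where
  IsFace σ := (∀ U ∈ σ, U ≠ ⊥ ∧ U ≤ W ∧ ∀ x ∈ U, ∀ y ∈ U, ω x y = 0) ∧ IsChain (· ≤ ·) σ
  down_closed _ _ hτ h := ⟨fun U hU => h.1 U (hτ hU), h.2.mono hτ⟩

/-- The genus filtration of the complex of lines: finite sets of lines of `V` whose span has genus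
`< p`.  Thus it is void for `p = 0`, and it is the complex `𝓘^{p-1}(V)` for `p ≥ 1`. -/
def genusFiltration [FiniteDimensional K V] (p : ℕ) : AugComplex (Submodule K V) where
  IsFace σ := (∀ L ∈ σ, Module.finrank K L = 1) ∧ genus ω (sSup σ) < p
  down_closed _ _ hτ h :=
    ⟨fun L hL => h.1 L (hτ hL), (genus_mono ω (sSup_le_sSup hτ)).trans_lt h.2⟩

/-- The Steinberg module `St(W) = H̃_{m-2}` of the Tits building, `m = dim W ≥ 1`.
(Homology is indexed by the number of vertices.) -/
abbrev Steinberg (W : Submodule K V) : Type _ :=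
  RedHomology (titsBuilding W) (Module.finrank K W - 1)

/-- The symplectic Steinberg module `St^ω(W) = H̃_{m-1}` of the symplectic Tits building of a
symplectic space `W` of dimension `2 m`. -/
abbrev SympSteinberg (W : Submodule K V) : Type _ :=
  RedHomology (sympTitsBuilding ω W) (Module.finrank K W / 2)

section Action

open scoped Pointwise

theorem smul_ne_bot (g : Sp ω) {U : Submodule K V} (h : U ≠ ⊥) : g • U ≠ ⊥ := by
  intro h'
  exact h ((Submodule.map_eq_bot_iff (e := g.1)).1 h')

theorem smul_le_smul (g : Sp ω) {U U' : Submodule K V} (h : U ≤ U') : g • U ≤ g • U' :=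
  Submodule.map_mono h

theorem smul_lt_smul (g : Sp ω) {U U' : Submodule K V} (h : U < U') : g • U < g • U' := by
  refine lt_of_le_of_ne (smul_le_smul ω g h.le) fun h' => h.ne ?_
  exact smul_left_cancel g h'

theorem isChain_smul (g : Sp ω) {σ : Set (Submodule K V)} (h : IsChain (· ≤ ·) σ) :
    IsChain (· ≤ ·) ((g • ·) '' σ) := by
  rintro _ ⟨U, hU, rfl⟩ _ ⟨U', hU', rfl⟩ -
  rcases h.total hU hU' with h | h
  · exact Or.inl (smul_le_smul ω g h)
  · exact Or.inr (smul_le_smul ω g h)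

theorem titsBuilding_smul (g : Sp ω) (W : Submodule K V) :
    IsSimplicial (g • ·) (titsBuilding W) (titsBuilding (g • W)) := by
  rintro σ ⟨h1, h2⟩
  refine ⟨?_, isChain_smul ω g h2⟩
  rintro _ ⟨U, hU, rfl⟩
  exact ⟨smul_ne_bot ω g (h1 U hU).1, smul_lt_smul ω g (h1 U hU).2⟩

theorem sympTitsBuilding_smul (g : Sp ω) {W W' : Submodule K V} (hW : g • W ≤ W') :
    IsSimplicial (g • ·) (sympTitsBuilding ω W) (sympTitsBuilding ω W') := by
  rintro σ ⟨h1, h2⟩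
  refine ⟨?_, isChain_smul ω g h2⟩
  rintro _ ⟨U, hU, rfl⟩
  refine ⟨smul_ne_bot ω g (h1 U hU).1, (smul_le_smul ω g (h1 U hU).2.1).trans hW, ?_⟩
  rintro _ ⟨x, hx, rfl⟩ _ ⟨y, hy, rfl⟩
  exact (Sp.form_smul g x y).trans ((h1 U hU).2.2 x hx y hy)

theorem genusFiltration_smul [FiniteDimensional K V] (g : Sp ω) (p : ℕ) :
    IsSimplicial (g • ·) (genusFiltration ω p) (genusFiltration ω p) := by
  rintro σ ⟨h1, h2⟩
  refine ⟨?_, ?_⟩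
  · rintro _ ⟨L, hL, rfl⟩
    exact (finrank_smul ω g L).trans (h1 L hL)
  · have : sSup ((g • ·) '' σ) ≤ g • sSup σ := by
      refine sSup_le ?_
      rintro _ ⟨L, hL, rfl⟩
      exact smul_le_smul ω g (le_sSup hL)
    exact ((genus_mono ω this).trans (genus_smul_le ω g _)).trans_lt h2

theorem smul_top_eq (g : Sp ω) : g • (⊤ : Submodule K V) = ⊤ :=
  top_le_iff.1 fun x _ => ⟨g⁻¹ • x, trivial, smul_inv_smul g x⟩

theorem smul_orthogonal (g : Sp ω) (W : Submodule K V) :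
    g • ω.orthogonal W = ω.orthogonal (g • W) := by
  ext x
  constructor
  · rintro ⟨y, hy, rfl⟩
    rintro _ ⟨w, hw, rfl⟩
    exact (Sp.form_smul g w y).trans (hy w hw)
  · intro hx
    refine ⟨g⁻¹ • x, ?_, smul_inv_smul g x⟩
    intro w hw
    have := hx (g • w) ⟨w, hw, rfl⟩
    rw [← Sp.form_smul g]
    change ω (g • w) (g • g⁻¹ • x) = 0
    rwa [smul_inv_smul]

/-- Symplectic subspaces of genus `p`, i.e. those on which `ω` is non-degenerate and whose
dimension is `2 p`. -/
@[ext]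
structure SympSubspace (p : ℕ) where
  toSubmodule : Submodule K V
  nondegenerate : (ω.restrict toSubmodule).Nondegenerate
  finrank_eq : Module.finrank K toSubmodule = 2 * p

theorem restrict_smul_nondegenerate (g : Sp ω) {W : Submodule K V}
    (h : (ω.restrict W).Nondegenerate) : (ω.restrict (g • W)).Nondegenerate := by
  refine ⟨?_, ?_⟩
  · rintro ⟨_, x, hx, rfl⟩ hz
    have : (⟨x, hx⟩ : W) = 0 := h.1 _ fun y =>
      (Sp.form_smul g x y).symm.trans (hz ⟨g • (y : V), ⟨y, y.2, rfl⟩⟩)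
    have hx0 : x = 0 := congrArg Subtype.val this
    subst hx0
    exact Subtype.ext (smul_zero g)
  · rintro ⟨_, x, hx, rfl⟩ hz
    have : (⟨x, hx⟩ : W) = 0 := h.2 _ fun y =>
      (Sp.form_smul g y x).symm.trans (hz ⟨g • (y : V), ⟨y, y.2, rfl⟩⟩)
    have hx0 : x = 0 := congrArg Subtype.val this
    subst hx0
    exact Subtype.ext (smul_zero g)

instance (p : ℕ) : MulAction (Sp ω) (SympSubspace ω p) where
  smul g W := ⟨g • W.1, restrict_smul_nondegenerate ω g W.2, (finrank_smul ω g W.1).trans W.3⟩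
  one_smul W := SympSubspace.ext (one_smul _ W.1)
  mul_smul g h W := SympSubspace.ext (mul_smul g h W.1)

/-- The isomorphism `St(W) → St(g W)` induced by `g ∈ Sp(V)`. -/
def Steinberg.map (g : Sp ω) (W : Submodule K V) : Steinberg W →ₗ[ℤ] Steinberg (g • W) :=
  homologyMap (g • ·) (titsBuilding_smul ω g W) (isSimplicial_void _)
    (by rw [finrank_smul])

/-- The isomorphism `St^ω(W^⊥) → St^ω((g W)^⊥)` induced by `g ∈ Sp(V)`. -/
def SympSteinberg.mapPerp (g : Sp ω) (W : Submodule K V) :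
    SympSteinberg ω (ω.orthogonal W) →ₗ[ℤ] SympSteinberg ω (ω.orthogonal (g • W)) :=
  homologyMap (g • ·) (sympTitsBuilding_smul ω g (smul_orthogonal ω g W).le) (isSimplicial_void _)
    (by rw [← smul_orthogonal, finrank_smul])

/-- The action of `Sp(V)` on `St(V)`. -/
def steinbergRep : Representation ℤ (Sp ω) (Steinberg (⊤ : Submodule K V)) :=
  homologyRep _ _ _
    (fun g => by simpa only [smul_top_eq] using titsBuilding_smul ω g ⊤)
    (fun _ => isSimplicial_void _)

/-- The action of `Sp(V)` on `St^ω(V)`. -/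
def sympSteinbergRep : Representation ℤ (Sp ω) (SympSteinberg ω (⊤ : Submodule K V)) :=
  homologyRep _ _ _ (fun g => sympTitsBuilding_smul ω g le_top) (fun _ => isSimplicial_void _)

/-! ### The terms of the resolution -/

/-- The summand `St(W) ⊗ St^ω(W^⊥)`. -/
def Summand (W : Submodule K V) : Type _ :=
  Steinberg W ⊗[ℤ] SympSteinberg ω (ω.orthogonal W)

instance (W : Submodule K V) : AddCommGroup (Summand ω W) :=
  inferInstanceAs (AddCommGroup (Steinberg W ⊗[ℤ] SympSteinberg ω (ω.orthogonal W)))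

instance (W : Submodule K V) : Module ℤ (Summand ω W) :=
  inferInstanceAs (Module ℤ (Steinberg W ⊗[ℤ] SympSteinberg ω (ω.orthogonal W)))

/-- `⨁_{g(W) = p} St(W) ⊗ St^ω(W^⊥)`, the sum over symplectic subspaces `W ⊆ V` of genus `p`. -/
abbrev SteinbergSum (p : ℕ) : Type _ :=
  ⨁ W : SympSubspace ω p, Summand ω W.1

open scoped Classical in
/-- The inclusion of the summand indexed by `W`. -/
def SteinbergSum.of {p : ℕ} (W : SympSubspace ω p) :
    Steinberg W.1 ⊗[ℤ] SympSteinberg ω (ω.orthogonal W.1) →ₗ[ℤ] SteinbergSum ω p :=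
  DirectSum.lof ℤ (SympSubspace ω p) (fun W => Summand ω W.1) W

theorem SteinbergSum.of_congr {p : ℕ} {W W' : SympSubspace ω p} (hW : W = W') {c c' d d'}
    (hc : c ∈ relCycles (titsBuilding W.1) (AugComplex.void _) (Module.finrank K W.1 - 1))
    (hc' : c' ∈ relCycles (titsBuilding W'.1) (AugComplex.void _) (Module.finrank K W'.1 - 1))
    (hd : d ∈ relCycles (sympTitsBuilding ω (ω.orthogonal W.1)) (AugComplex.void _)
      (Module.finrank K (ω.orthogonal W.1) / 2))
    (hd' : d' ∈ relCycles (sympTitsBuilding ω (ω.orthogonal W'.1)) (AugComplex.void _)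
      (Module.finrank K (ω.orthogonal W'.1) / 2))
    (h : c = c') (h' : d = d') :
    SteinbergSum.of ω W (relClass c hc ⊗ₜ relClass d hd) =
      SteinbergSum.of ω W' (relClass c' hc' ⊗ₜ relClass d' hd') := by
  subst hW h h'
  rfl

open scoped Classical in
theorem SteinbergSum.hom_ext {p : ℕ} {M : Type*} [AddCommGroup M]
    {f f' : SteinbergSum ω p →ₗ[ℤ] M}
    (h : ∀ (W : SympSubspace ω p) c hc d hd,
      f (SteinbergSum.of ω W (relClass c hc ⊗ₜ relClass d hd)) =
        f' (SteinbergSum.of ω W (relClass c hc ⊗ₜ relClass d hd))) : f = f' := by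
  refine DirectSum.linearMap_ext ℤ fun W => TensorProduct.ext' fun x y => ?_
  obtain ⟨c, hc, rfl⟩ := relClass_surjective x
  obtain ⟨d, hd, rfl⟩ := relClass_surjective y
  exact h W c hc d hd

open scoped Classical in
/-- The action of `g ∈ Sp(V)` on `⨁ St(W) ⊗ St^ω(W^⊥)`, taking the summand of `W` to that of
`g W`. -/
def SteinbergSum.map (p : ℕ) (g : Sp ω) : SteinbergSum ω p →ₗ[ℤ] SteinbergSum ω p :=
  DirectSum.toModule ℤ _ _ fun W =>
    SteinbergSum.of ω (g • W) ∘ₗ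
      TensorProduct.map (Steinberg.map ω g W.1) (SympSteinberg.mapPerp ω g W.1)

theorem SteinbergSum.map_of (p : ℕ) (g : Sp ω) (W : SympSubspace ω p) (x) (y) :
    SteinbergSum.map ω p g (SteinbergSum.of ω W (x ⊗ₜ y)) =
      SteinbergSum.of ω (g • W) (Steinberg.map ω g W.1 x ⊗ₜ SympSteinberg.mapPerp ω g W.1 y) := by
  classical
  exact DirectSum.toModule_lof ℤ (M := fun W : SympSubspace ω p => Summand ω W.1) W _

/-- The representation of `Sp(V)` on `⨁ St(W) ⊗ St^ω(W^⊥)`. -/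
def steinbergSumRep (p : ℕ) : Representation ℤ (Sp ω) (SteinbergSum ω p) where
  toFun := SteinbergSum.map ω p
  map_one' := by
    refine SteinbergSum.hom_ext ω fun W c hc d hd => ?_
    rw [SteinbergSum.map_of]
    refine SteinbergSum.of_congr ω (one_smul _ W) _ _ _ _ ?_ ?_
    · exact chainMap_one_smul (G := Sp ω) c
    · exact chainMap_one_smul (G := Sp ω) d
  map_mul' g h := by
    refine SteinbergSum.hom_ext ω fun W c hc d hd => ?_
    rw [Module.End.mul_apply, SteinbergSum.map_of, SteinbergSum.map_of, SteinbergSum.map_of]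
    refine SteinbergSum.of_congr ω (mul_smul g h W) _ _ _ _ ?_ ?_
    · exact chainMap_mul_smul g h c
    · exact chainMap_mul_smul g h d

/-- The terms of the resolution: `St^ω(V)` in degree `0`, and `⨁_{g(W) = p} St(W) ⊗ St^ω(W^⊥)`
in degree `p ≥ 1`. -/
def Term : ℕ → Type _
  | 0 => SympSteinberg ω (⊤ : Submodule K V)
  | p + 1 => SteinbergSum ω (p + 1)

instance : ∀ p, AddCommGroup (Term ω p)
  | 0 => inferInstanceAs (AddCommGroup (SympSteinberg ω (⊤ : Submodule K V)))
  | p + 1 => inferInstanceAs (AddCommGroup (SteinbergSum ω (p + 1)))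

instance : ∀ p, Module ℤ (Term ω p)
  | 0 => inferInstanceAs (Module ℤ (SympSteinberg ω (⊤ : Submodule K V)))
  | p + 1 => inferInstanceAs (Module ℤ (SteinbergSum ω (p + 1)))

/-- The action of `Sp(V)` on the terms of the resolution. -/
def termRep : ∀ p, Representation ℤ (Sp ω) (Term ω p)
  | 0 => sympSteinbergRep ω
  | p + 1 => steinbergSumRep ω (p + 1)

end Action

/-! ### Apartment classes -/

open scoped Classical in
/-- The apartment chain
`∑_σ sgn(σ) [⟨v_{σ(1)}⟩, ⟨v_{σ(1)}, v_{σ(2)}⟩, …, ⟨v_{σ(1)}, …, v_{σ(m-1)}⟩]` of a list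
`v = (v₁, …, v_m)` of vectors. -/
def apartmentChain (v : List V) : Chains (Submodule K V) :=
  ∑ σ : Equiv.Perm (Fin v.length), (Equiv.Perm.sign σ : ℤ) •
    simplex (List.ofFn fun i : Fin (v.length - 1) =>
      Submodule.span K ((fun j => v.get (σ j)) '' {j | (j : ℕ) ≤ i}))

/-- The vector `e_i` or `f_i` of a list of pairs `(e_i, f_i)`, according to `ε i`. -/
def pick (u : List (V × V)) (ε : Fin u.length → Bool) (i : Fin u.length) : V :=
  if ε i then (u.get i).2 else (u.get i).1

open scoped Classical in
/-- The symplectic apartment chain of a list `u` of pairs `(e_i, f_i)`, `1 ≤ i ≤ m`: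
`∑_σ sgn(σ) [⟨u_{σ(1)}⟩, ⟨u_{σ(1)}, u_{σ(2)}⟩, …, ⟨u_{σ(1)}, …, u_{σ(m)}⟩]`, the sum over signed
permutations of `{1, 1̄, …, m, m̄}`, where `u_i = e_i`, `u_{ī} = f_i`.  A signed permutation is given
by a permutation `σ` of the indices and a choice `ε` of bars; its sign is `sgn(σ)` times
`(-1)` to the number of bars. -/
def sympApartmentChain (u : List (V × V)) : Chains (Submodule K V) :=
  ∑ σ : Equiv.Perm (Fin u.length), ∑ ε : Fin u.length → Bool,
    ((Equiv.Perm.sign σ : ℤ) * ∏ i, if ε i then (-1 : ℤ) else 1) •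
      simplex (List.ofFn fun i : Fin u.length =>
        Submodule.span K ((fun j => pick u ε (σ j)) '' {j | (j : ℕ) ≤ i}))

/-- `v` is an (ordered) basis of the subspace `W`. -/
def IsBasisOf (v : List V) (W : Submodule K V) : Prop :=
  LinearIndependent K v.get ∧ Submodule.span K {x | x ∈ v} = W

/-- The pairs `(e_i, f_i)` in the list `u` form a symplectic basis of `W`, up to rescaling: they
span `W`, `ω(e_i, f_i) ≠ 0`, and all other values of `ω` between these vectors vanish. (Only the
lines spanned by the vectors matter below.) -/
def IsSympBasisOf (u : List (V × V)) (W : Submodule K V) : Prop :=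
  (∀ a ∈ u, ω a.1 a.2 ≠ 0) ∧
  u.Pairwise (fun a b => ω a.1 b.1 = 0 ∧ ω a.1 b.2 = 0 ∧ ω a.2 b.1 = 0 ∧ ω a.2 b.2 = 0) ∧
  Submodule.span K {x | ∃ a ∈ u, x = a.1 ∨ x = a.2} = W

theorem sum_eq_zero_of_involution {α M : Type*} [Fintype α] [AddCommGroup M] (F : α → M)
    (τ : α → α) (hτ : ∀ a, τ (τ a) = a) (hne : ∀ a, τ a ≠ a) (hF : ∀ a, F (τ a) = - F a) :
    ∑ a, F a = 0 :=
  Finset.sum_involution (fun a _ => τ a) (fun a _ => by rw [hF]; exact add_neg_cancel _)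
    (fun a _ _ => hne a) (fun _ _ => Finset.mem_univ _) (fun a _ => hτ a)

theorem eraseIdx_ofFn_congr {S : Type*} {m : ℕ} {f g : Fin m → S} {i : ℕ}
    (h : ∀ j : Fin m, (j : ℕ) ≠ i → f j = g j) :
    (List.ofFn f).eraseIdx i = (List.ofFn g).eraseIdx i := by
  apply List.ext_getElem
  · simp [List.length_eraseIdx]
  · intro n h1 h2
    rw [List.getElem_eraseIdx, List.getElem_eraseIdx]
    split_ifs with h3
    · simp only [List.getElem_ofFn]
      exact h _ (by simpa using (by omega : n ≠ i))
    · simp only [List.getElem_ofFn]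
      exact h _ (by simpa using (by omega : n + 1 ≠ i))

theorem swap_image {m : ℕ} (i : ℕ) (hi : i + 1 < m) (k : ℕ) (hk : k ≠ i) :
    (Equiv.swap (⟨i, by omega⟩ : Fin m) ⟨i + 1, hi⟩) '' {j : Fin m | (j : ℕ) ≤ k} =
      {j : Fin m | (j : ℕ) ≤ k} := by
  have h : ∀ j : Fin m, (j : ℕ) ≤ k →
      ((Equiv.swap (⟨i, by omega⟩ : Fin m) ⟨i + 1, hi⟩ j : Fin m) : ℕ) ≤ k := by
    intro j hj
    rcases eq_or_ne j ⟨i, by omega⟩ with h1 | h1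
    · rw [h1] at hj ⊢
      rw [Equiv.swap_apply_left]
      simp only at hj ⊢
      omega
    · rcases eq_or_ne j ⟨i + 1, hi⟩ with h2 | h2
      · rw [h2] at hj ⊢
        rw [Equiv.swap_apply_right]
        simp only at hj ⊢
        omega
      · rwa [Equiv.swap_apply_of_ne_of_ne h1 h2]
  ext j
  constructor
  · rintro ⟨j, hj, rfl⟩
    exact h j hj
  · intro hj
    exact ⟨_, h j hj, Equiv.swap_apply_self _ _ _⟩

theorem swap_flag {V : Type*} {m : ℕ} (i : ℕ) (hi : i + 1 < m) (k : ℕ) (hk : k ≠ i) (w : Fin m → V)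
    (σ : Equiv.Perm (Fin m)) :
    (fun j => w ((σ * Equiv.swap (⟨i, by omega⟩ : Fin m) ⟨i + 1, hi⟩) j)) '' {j | (j : ℕ) ≤ k} =
      (fun j => w (σ j)) '' {j | (j : ℕ) ≤ k} := by
  have h : (fun j => w (σ j)) ''
      (Equiv.swap (⟨i, by omega⟩ : Fin m) ⟨i + 1, hi⟩ '' {j : Fin m | (j : ℕ) ≤ k}) =
      (fun j => w ((σ * Equiv.swap (⟨i, by omega⟩ : Fin m) ⟨i + 1, hi⟩) j)) ''
        {j : Fin m | (j : ℕ) ≤ k} := by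
    rw [Set.image_image]
    rfl
  rw [← h, swap_image i hi k hk]

theorem mul_swap_ne {m : ℕ} (i : ℕ) (hi : i + 1 < m) (σ : Equiv.Perm (Fin m)) :
    σ * Equiv.swap (⟨i, by omega⟩ : Fin m) ⟨i + 1, hi⟩ ≠ σ := by
  intro h
  rw [mul_eq_left, Equiv.swap_eq_one_iff, Fin.mk.injEq] at h
  omega

theorem boundary_apartmentChain (v : List V) :
    boundary (apartmentChain (K := K) v) = 0 := by
  classical
  rw [apartmentChain, map_sum]
  simp only [map_zsmul, boundary_simplex, List.length_ofFn, Finset.smul_sum]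
  rw [Finset.sum_comm]
  refine Finset.sum_eq_zero fun i hi => ?_
  have hi' : i + 1 < v.length := by
    have := Finset.mem_range.1 hi
    omega
  refine sum_eq_zero_of_involution _
    (fun σ => σ * Equiv.swap (⟨i, by omega⟩ : Fin v.length) ⟨i + 1, hi'⟩)
    (fun σ => by simp [mul_assoc]) (mul_swap_ne i hi') fun σ => ?_
  rw [eraseIdx_ofFn_congr (fun j hj => by rw [swap_flag i hi' j hj (fun k => v.get k) σ])]
  rw [Equiv.Perm.sign_mul, Equiv.Perm.sign_swap (by simp)]
  simp

theorem boundary_sympApartmentChain (u : List (V × V)) :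
    boundary (sympApartmentChain (K := K) u) = 0 := by
  classical
  rw [sympApartmentChain, ← Fintype.sum_prod_type', map_sum]
  simp only [map_zsmul, boundary_simplex, List.length_ofFn, Finset.smul_sum]
  rw [Finset.sum_comm]
  refine Finset.sum_eq_zero fun i hi => ?_
  have hi0 : i < u.length := Finset.mem_range.1 hi
  by_cases hi' : i + 1 < u.length
  · refine sum_eq_zero_of_involution _
      (fun a => (a.1 * Equiv.swap (⟨i, by omega⟩ : Fin u.length) ⟨i + 1, hi'⟩, a.2))
      (fun a => by simp [mul_assoc])
      (fun a h => mul_swap_ne i hi' a.1 (congrArg Prod.fst h)) fun a => ?_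
    rw [eraseIdx_ofFn_congr (fun j hj => by rw [swap_flag i hi' j hj (pick u a.2) a.1])]
    rw [Equiv.Perm.sign_mul, Equiv.Perm.sign_swap (by simp)]
    simp
  · have flip : ∀ (ε : Fin u.length → Bool) (j : Fin u.length),
        (∏ k, if Function.update ε j (!ε j) k then (-1 : ℤ) else 1) =
          - ∏ k, if ε k then (-1 : ℤ) else 1 := by
      intro ε j
      rw [← Finset.mul_prod_erase _ _ (Finset.mem_univ j),
        ← Finset.mul_prod_erase _ (fun k => if ε k then (-1 : ℤ) else 1) (Finset.mem_univ j)]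
      rw [Finset.prod_congr rfl (g := fun k => if ε k then (-1 : ℤ) else 1) (fun k hk => by
        rw [Function.update_of_ne (Finset.ne_of_mem_erase hk)])]
      cases h : ε j <;> simp
    refine sum_eq_zero_of_involution _
      (fun a => (a.1, Function.update a.2 (a.1 ⟨i, hi0⟩) (!a.2 (a.1 ⟨i, hi0⟩))))
      (fun a => by simp) (fun a h => ?_) fun a => ?_
    · have := congrFun (congrArg Prod.snd h) (a.1 ⟨i, hi0⟩)
      simp at this
    · simp only [flip]
      rw [eraseIdx_ofFn_congr (g := fun k : Fin u.length =>
        Submodule.span K ((fun j => pick u a.2 (a.1 j)) '' {j | (j : ℕ) ≤ k})) (fun j hj => by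
          congr 1
          refine Set.image_congr fun k hk => ?_
          have hne : a.1 k ≠ a.1 ⟨i, hi0⟩ := by
            intro h
            have := congrArg Fin.val (a.1.injective h)
            change (k : ℕ) ≤ j at hk
            simp only at this
            omega
          rw [pick, pick, Function.update_of_ne hne])]
      simp

theorem isChain_flag {m n : ℕ} (w : Fin m → V) :
    IsChain (· ≤ ·) {U | U ∈ List.ofFn fun i : Fin n =>
      Submodule.span K (w '' {j | (j : ℕ) ≤ i})} := by
  have h : ∀ i i' : Fin n, i ≤ i' → Submodule.span K (w '' {j | (j : ℕ) ≤ i}) ≤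
      Submodule.span K (w '' {j | (j : ℕ) ≤ i'}) := fun i i' hi =>
    Submodule.span_mono (Set.image_mono fun j (hj : (j : ℕ) ≤ i) => hj.trans hi)
  intro U hU U' hU' _
  obtain ⟨i, rfl⟩ := (List.mem_ofFn' _ _).1 hU
  obtain ⟨i', rfl⟩ := (List.mem_ofFn' _ _).1 hU'
  exact (le_total i i').imp (h i i') (h i' i)

theorem apartmentChain_mem {v : List V} {W : Submodule K V} (h : IsBasisOf v W) :
    apartmentChain v ∈
      relCycles (titsBuilding W) (AugComplex.void _) (Module.finrank K W - 1) := by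
  classical
  obtain ⟨h, rfl⟩ := h
  have hfin : Module.finrank K ↥(Submodule.span K {x | x ∈ v}) = v.length := by
    have := finrank_span_eq_card h
    rwa [Set.range_list_get, Fintype.card_fin] at this
  refine ⟨?_, ?_⟩
  · refine Submodule.sum_mem _ fun σ _ => Submodule.smul_mem _ _ (Submodule.subset_span
      ⟨_, by rw [List.length_ofFn, hfin], ⟨?_, isChain_flag (fun j => v.get (σ j))⟩, rfl⟩)
    intro U hU
    obtain ⟨i, rfl⟩ := (List.mem_ofFn' _ _).1 hU
    have hi : (i : ℕ) + 1 < v.length := by omega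
    have hσ : LinearIndependent K fun j => v.get (σ j) := h.comp σ σ.injective
    refine ⟨?_, ?_⟩
    · intro hbot
      have hmem : v.get (σ ⟨i, by omega⟩) ∈
          Submodule.span K ((fun j => v.get (σ j)) '' {j | (j : ℕ) ≤ i}) :=
        Submodule.subset_span ⟨_, le_refl (i : ℕ), rfl⟩
      exact hσ.ne_zero ⟨i, by omega⟩ ((Submodule.mem_bot K).1 (hbot.le hmem))
    · refine lt_of_le_of_ne (Submodule.span_mono ?_) fun heq => ?_
      · rintro _ ⟨j, -, rfl⟩
        exact List.get_mem _ _
      · refine hσ.notMem_span_image (s := {j | (j : ℕ) ≤ i}) (x := ⟨i + 1, hi⟩) ?_ ?_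
        · intro (hle : (i : ℕ) + 1 ≤ i)
          omega
        · exact heq.ge (Submodule.subset_span (List.get_mem _ _))
  · refine Submodule.mem_comap.2 ?_
    rw [boundary_apartmentChain]
    exact Submodule.zero_mem _

/-- The apartment class in `St(W)` of a basis of `W`. -/
def apartmentClass {v : List V} {W : Submodule K V} (h : IsBasisOf v W) : Steinberg W :=
  relClass (apartmentChain v) (apartmentChain_mem h)

theorem IsSympBasisOf.form_eq_zero {ω} (hω : ω.IsAlt) {u : List (V × V)} {W : Submodule K V}
    (h : IsSympBasisOf ω u W) {i j : Fin u.length} (hij : i ≠ j) (ε δ : Fin u.length → Bool) :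
    ω (pick u ε i) (pick u δ j) = 0 := by
  have key : ∀ (i j : Fin u.length), i < j → ∀ (ε δ : Fin u.length → Bool),
      ω (pick u ε i) (pick u δ j) = 0 := by
    intro i j hij ε δ
    obtain ⟨h1, h2, h3, h4⟩ := List.pairwise_iff_get.1 h.2.1 i j hij
    unfold pick
    split_ifs <;> assumption
  rcases lt_or_gt_of_ne hij with hij | hij
  · exact key i j hij ε δ
  · rw [← hω.neg_eq, key j i hij δ ε, neg_zero]

theorem IsSympBasisOf.finrank_eq {ω} (hω : ω.IsAlt) {u : List (V × V)} {W : Submodule K V}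
    (h : IsSympBasisOf ω u W) : Module.finrank K W = u.length * 2 := by
  let b : Fin u.length × Bool → V := fun x => pick u (fun _ => x.2) x.1
  have hb : LinearIndependent K b := by
    rw [Fintype.linearIndependent_iff]
    rintro g hg ⟨i, t⟩
    have h0 := congrArg (ω (b (i, !t))) hg
    rw [map_sum, map_zero, Finset.sum_eq_single (i, t)] at h0
    · rw [map_smul, smul_eq_mul] at h0
      refine (mul_eq_zero.1 h0).resolve_right ?_
      have hne := h.1 (u.get i) (List.get_mem _ _)
      cases t
      · change ω (u.get i).2 (u.get i).1 ≠ 0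
        rw [← hω.neg_eq]
        exact neg_ne_zero.2 hne
      · exact hne
    · rintro ⟨j, s⟩ - hne
      rw [map_smul, smul_eq_mul]
      by_cases hij : i = j
      · subst hij
        have hs : s = !t := by
          cases s <;> cases t <;> simp_all
        subst hs
        rw [hω.self_eq_zero, mul_zero]
      · exact mul_eq_zero_of_right _ (h.form_eq_zero hω hij _ _)
    · simp
  have hr : Set.range b = {x | ∃ a ∈ u, x = a.1 ∨ x = a.2} := by
    ext x
    constructor
    · rintro ⟨⟨i, t⟩, rfl⟩
      refine ⟨u.get i, List.get_mem _ _, ?_⟩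
      cases t
      · exact Or.inl rfl
      · exact Or.inr rfl
    · rintro ⟨a, ha, hx⟩
      obtain ⟨i, rfl⟩ := List.get_of_mem ha
      rcases hx with rfl | rfl
      · exact ⟨(i, false), rfl⟩
      · exact ⟨(i, true), rfl⟩
  have := finrank_span_eq_card hb
  rw [hr, h.2.2] at this
  simpa using this

theorem sympApartmentChain_mem {ω} (hω : ω.IsAlt) {u : List (V × V)} {W : Submodule K V}
    (h : IsSympBasisOf ω u W) :
    sympApartmentChain u ∈
      relCycles (sympTitsBuilding ω W) (AugComplex.void _) (Module.finrank K W / 2) := by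
  classical
  refine ⟨?_, ?_⟩
  · refine Submodule.sum_mem _ fun σ _ => Submodule.sum_mem _ fun ε _ =>
      Submodule.smul_mem _ _ (Submodule.subset_span
      ⟨_, by rw [List.length_ofFn, h.finrank_eq hω, Nat.mul_div_cancel _ two_pos],
        ⟨?_, isChain_flag (fun j => pick u ε (σ j))⟩, rfl⟩)
    intro U hU
    obtain ⟨i, rfl⟩ := (List.mem_ofFn' _ _).1 hU
    refine ⟨?_, ?_, ?_⟩
    · intro hbot
      have hne := h.1 (u.get (σ i)) (List.get_mem _ _)
      have h0 : pick u ε (σ i) = 0 :=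
        (Submodule.mem_bot K).1 (hbot.le (Submodule.subset_span ⟨i, le_refl (i : ℕ), rfl⟩))
      unfold pick at h0
      split_ifs at h0
      · exact hne (by rw [h0, map_zero])
      · exact hne (by rw [h0, map_zero, LinearMap.zero_apply])
    · rw [Submodule.span_le]
      rintro _ ⟨j, -, rfl⟩
      rw [← h.2.2]
      refine Submodule.subset_span ⟨u.get (σ j), List.get_mem _ _, ?_⟩
      change pick u ε (σ j) = _ ∨ pick u ε (σ j) = _
      unfold pick
      split_ifs
      · exact Or.inr rfl
      · exact Or.inl rfl
    · intro x hx y hy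
      induction hx, hy using Submodule.span_induction₂ with
      | mem_mem x y hx hy =>
        obtain ⟨j, -, rfl⟩ := hx
        obtain ⟨k, -, rfl⟩ := hy
        by_cases hjk : σ j = σ k
        · simp only [hjk]
          exact hω.self_eq_zero _
        · exact h.form_eq_zero hω hjk _ _
      | zero_left y hy => simp
      | zero_right x hx => simp
      | add_left x y z _ _ _ h1 h2 => simp [h1, h2]
      | add_right x y z _ _ _ h1 h2 => simp [h1, h2]
      | smul_left r x y _ _ h1 => simp [h1]
      | smul_right r x y _ _ h1 => simp [h1]
  · refine Submodule.mem_comap.2 ?_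
    rw [boundary_sympApartmentChain]
    exact Submodule.zero_mem _

/-- The symplectic apartment class in `St^ω(W)` of a symplectic basis of `W`. -/
def sympApartmentClass {ω} (hω : ω.IsAlt) {u : List (V × V)} {W : Submodule K V}
    (h : IsSympBasisOf ω u W) : SympSteinberg ω W :=
  relClass (sympApartmentChain u) (sympApartmentChain_mem hω h)

/-! ### Generators of the terms -/

/-- `v` is a basis of a symplectic subspace `W` of genus `p`, and `u` is (up to rescaling) a
symplectic basis of `W^⊥`. -/
def IsAdapted (p : ℕ) (v : List V) (u : List (V × V)) : Prop :=
  ∃ W : SympSubspace ω p, IsBasisOf v W.toSubmodule ∧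
    IsSympBasisOf ω u (ω.orthogonal W.toSubmodule)

theorem IsAdapted.sympBasis_top {ω : LinearMap.BilinForm K V} {v : List V} {u : List (V × V)}
    [FiniteDimensional K V] (h : IsAdapted ω 0 v u) : IsSympBasisOf ω u ⊤ := by
  obtain ⟨W, -, h⟩ := h
  rwa [Submodule.finrank_eq_zero.1 W.finrank_eq, LinearMap.BilinForm.orthogonal_bot] at h

open scoped Classical in
/-- The product of apartment classes `[v] ⊗ [u]^ω` in the summand `St(W) ⊗ St^ω(W^⊥)` of the
`p`-th term, where `v` is a basis of the genus `p` symplectic subspace `W` and `u` is a symplectic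
basis of `W^⊥`; for `p = 0` (so that `W = 0` and `v` is empty), it is `[u]^ω ∈ St^ω(V)`.
For `(v, u)` not of this form the value is irrelevant and set to `0`. -/
def generator [FiniteDimensional K V] {ω : LinearMap.BilinForm K V} (hω : ω.IsAlt) :
    ∀ (p : ℕ) (_ : List V) (_ : List (V × V)), Term ω p
  | 0, v, u =>
    if h : IsAdapted ω 0 v u then sympApartmentClass hω h.sympBasis_top else (0 : Term ω 0)
  | p + 1, v, u =>
    if h : IsAdapted ω (p + 1) v u then
      SteinbergSum.of ω h.choose
        (apartmentClass h.choose_spec.1 ⊗ₜ sympApartmentClass hω h.choose_spec.2)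
    else (0 : Term ω (p + 1))

open scoped Classical in
/-- The projection of `V = U^⊥ ⊕ U` onto `U^⊥`, for a symplectic subspace `U`. (It is only used for
such `U`; otherwise it is set to `0`.) -/
def perpProj (U : Submodule K V) (x : V) : V :=
  if h : IsCompl (ω.orthogonal U) U then (ω.orthogonal U).projection U h x else 0

/-- The list `v` with the entries at positions `i < j` removed. -/
def removePair (v : List V) (i j : ℕ) : List V := (v.eraseIdx j).eraseIdx i

variable (K) in
/-- `⟨v₀, …, v̂ᵢ, …, v̂ⱼ, …⟩`, the span of the remaining vectors. -/
def spanRemovePair (v : List V) (i j : ℕ) : Submodule K V :=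
  Submodule.span K {x | x ∈ removePair v i j}

/-! ### The `E¹` page of the genus filtration -/

/-- `E¹_{p,n-1} = H_{n+p-1}(𝓘^p(V), 𝓘^{p-1}(V))`, where `n` is the genus of `V`
(for `p = 0`: the reduced homology `H̃_{n-1}(𝓘^0(V))`). -/
abbrev EOne [FiniteDimensional K V] (n p : ℕ) : Type _ :=
  RelHomology (genusFiltration ω (p + 1)) (genusFiltration ω p) (n + p)

/-- The `d¹` differential, i.e. the connecting homomorphism
`H_{n+p}(𝓘^{p+1}(V), 𝓘^p(V)) → H_{n+p-1}(𝓘^p(V), 𝓘^{p-1}(V))`. -/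
def dOne [FiniteDimensional K V] (n p : ℕ) : EOne ω n (p + 1) →ₗ[ℤ] EOne ω n p :=
  connecting (genusFiltration ω (p + 2)) (genusFiltration ω (p + 1)) (genusFiltration ω p) (n + p)

open scoped Pointwise in
/-- The action of `Sp(V)` on the `E¹` page. -/
def eOneRep [FiniteDimensional K V] (n p : ℕ) : Representation ℤ (Sp ω) (EOne ω n p) :=
  homologyRep _ _ _ (fun g => genusFiltration_smul ω g (p + 1))
    (fun g => genusFiltration_smul ω g p)

variable (K) in
/-- The chain `[⟨v₀⟩, …, ⟨v_k⟩] * ([⟨e₁⟩] - [⟨f₁⟩]) * ⋯ * ([⟨e_m⟩] - [⟨f_m⟩])` of the complex of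
lines, for `v = (v₀, …, v_k)` and `u = ((e₁, f₁), …, (e_m, f_m))`. -/
def lineChain (v : List V) (u : List (V × V)) : Chains (Submodule K V) :=
  simplex (v.map fun x => Submodule.span K {x}) *
    (u.map fun a => simplex [Submodule.span K {a.1}] - simplex [Submodule.span K {a.2}]).prod

end Symplectic

end SymplecticResolution

end

/-!
The proof identifies the terms `T_p` with the groups `E¹_{p,n-1}` of the genus filtration
`𝓘^0(V) ⊂ ⋯ ⊂ 𝓘^n(V)` of the complex of sets of lines of `V`, and reads off everything else there.
Chains are elements of the exterior algebra on the vertices, graded by the number of vertices; the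
join of chains is the product.

*Lines and flags.* For a set `P` of subspaces closed under passage to smaller ones, the complex of
sets of lines with span in `P` and the complex of flags of non-zero members of `P` have the same
homology. The map `beta` (subdivide, and replace every set of lines by its span) and the map choosing
a line in every subspace are inverse to each other up to homotopy, by acyclic carriers
(`betaHom_bijective`). This describes `St(W)` as the homology of all sets of lines of `W` relative to
those not spanning `W` (`steinbergIso`), and `St^ω(W)` as the homology of the sets of lines with
isotropic span (`sympSteinbergIso`). In these terms the apartment class of a basis is a simplex, and
the apartment class of a symplectic basis is the boundary of a cross-polytope.

*Vanishing.* A simplex of genus `p` is the join of the set `N` of its lines outside the radical of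
its span, called its core, with a set of isotropic lines orthogonal to `N`. Adding the simplices of
genus `p` in the order of the cardinality of their cores (`stage`) reduces the homology of
`(𝓘^p, 𝓘^{p-1})` to that of the links of the cores. The link of `N` is contractible if the span of
`N` is degenerate, and otherwise it is the complex of isotropic sets of lines of the orthogonal
complement. So `H̃_i(𝓘^p(V)) = 0` for `i < n + p - 1`, by induction on the genus of `V` and by
downward induction on `p`, starting from the cone `𝓘^n(V)` (`genusIn_exists_boundary_eq`). Above
degree `n + p - 1` the homology vanishes as well, since a subspace of genus `p` has dimension at most
`n + p`.

*Comparison.* The join of chains gives a map from `⨁ St(W) ⊗ St^ω(W^⊥)` to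
`H_{n+p-1}(𝓘^p, 𝓘^{p-1})`. It is surjective because relative cycles can be moved to those stages
where the cores have the minimal number `2p` of lines and hence span symplectic subspaces `W`
(`comparisonSum_surjective`). It is injective because the flags through `W` in the subdivision of the
image determine the component in the summand of `W` (`removeLast_beta_mul`,
`comparisonSum_injective`).

*The resolution.* For `p < n` the complex `𝓘^p(V)` has reduced homology in degree `n + p - 1` only,
and `𝓘^n(V)` has none, so that the row `E¹_{•,n-1}` with the connecting homomorphisms as differentials is
exact (`dOne_exact`). For the formula on generators, each face `[…, v̂ᵢ, …]` of a basis of a symplectic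
space spans a subspace with one-dimensional radical. Coning it off from this line expresses the
boundary of the simplex by the faces with two vertices removed (`boundary_cone_faces`). If the
vectors other than `v_i` and `v_j` span a symplectic subspace, then the two radicals involved are
spanned by the projections of `v_i` and `v_j` to its complement, and otherwise the face contributes
only chains of lower genus (`neg_boundary_lineChain_sub_mem`).
-/

open scoped TensorProduct DirectSum

noncomputable section

namespace SymplecticResolution

/-! ### Oriented chains -/

section ChainAlgebra

variable {S S' M : Type*} [AddCommGroup M] [Module ℤ M]

theorem simplex_nil : simplex ([] : List S) = 1 := rfl

theorem simplex_append (l l' : List S) : simplex (l ++ l') = simplex l * simplex l' := by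
  simp [simplex]

theorem simplex_singleton (s : S) :
    simplex [s] = ExteriorAlgebra.ι ℤ (Finsupp.single s (1 : ℤ)) := by
  simp [simplex]

theorem simplex_cons' (s : S) (l : List S) : simplex (s :: l) = simplex [s] * simplex l := by
  rw [simplex_cons, simplex_singleton]

theorem simplex_singleton_mul_self (s : S) : simplex [s] * simplex [s] = 0 := by
  rw [simplex_singleton]
  exact ExteriorAlgebra.ι_sq_zero _

theorem simplex_singleton_mul_comm (s t : S) :
    simplex [s] * simplex [t] = -(simplex [t] * simplex [s]) := by
  simp only [simplex_singleton]
  exact eq_neg_of_add_eq_zero_left (ExteriorAlgebra.ι_add_mul_swap _ _)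

theorem simplex_perm {l l' : List S} (h : l.Perm l') :
    simplex l = simplex l' ∨ simplex l = -simplex l' := by
  induction h with
  | nil => exact Or.inl rfl
  | cons x _ ih =>
    rw [simplex_cons, simplex_cons]
    rcases ih with ih | ih
    · exact Or.inl (by rw [ih])
    · exact Or.inr (by rw [ih, mul_neg])
  | swap x y l =>
    right
    rw [simplex_cons' y (x :: l), simplex_cons' x l, simplex_cons' x (y :: l), simplex_cons' y l,
      ← mul_assoc, ← mul_assoc, simplex_singleton_mul_comm, neg_mul]
  | trans _ _ h1 h2 =>
    rcases h1 with h1 | h1 <;> rcases h2 with h2 | h2 <;> simp [h1, h2]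

theorem simplex_of_not_nodup {l : List S} (h : ¬ l.Nodup) : simplex l = 0 := by
  classical
  induction l with
  | nil => simp at h
  | cons s l ih =>
    by_cases hs : s ∈ l
    · have key : simplex [s] * simplex (s :: l.erase s) = 0 := by
        rw [simplex_cons' s (l.erase s), ← mul_assoc, simplex_singleton_mul_self, zero_mul]
      rw [simplex_cons']
      rcases simplex_perm (List.perm_cons_erase hs) with h' | h'
      · rw [h', key]
      · rw [h', mul_neg, key, neg_zero]
    · rw [simplex_cons, ih (fun hl => h (List.nodup_cons.2 ⟨hs, hl⟩)), mul_zero]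

/-- The simplex with vertex set `s`, oriented by an arbitrary but fixed enumeration of `s`. -/
def stdSimplex (s : Finset S) : Chains S := simplex s.toList

theorem stdSimplex_empty : stdSimplex (∅ : Finset S) = 1 := by
  simp [stdSimplex, simplex_nil]

open scoped Classical in
theorem simplex_eq_stdSimplex {l : List S} (h : l.Nodup) :
    simplex l = stdSimplex l.toFinset ∨ simplex l = -stdSimplex l.toFinset :=
  simplex_perm ((List.perm_ext_iff_of_nodup h (Finset.nodup_toList _)).2 (by simp))

/-- Up to signs, the simplices in their standard orientation form a basis of the chains. -/
theorem exists_basis_stdSimplex (S : Type*) : ∃ b : Module.Basis (Finset S) ℤ (Chains S),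
    ∀ s, b s = stdSimplex s ∨ b s = -stdSimplex s := by
  classical
  let _ : LinearOrder S := linearOrderOfSTO WellOrderingRel
  refine ⟨(Finsupp.basisSingleOne (R := ℤ) (ι := S)).ExteriorAlgebra, fun s => ?_⟩
  have h : (Finsupp.basisSingleOne (R := ℤ) (ι := S)).ExteriorAlgebra s =
      simplex (List.ofFn (s.orderEmbOfFin rfl)) := by
    rw [ExteriorAlgebra.basis_apply_ofCard (s_card := rfl), ExteriorAlgebra.ιMulti_family,
      ExteriorAlgebra.ιMulti_apply, simplex, List.map_ofFn]
    congr 2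
  rw [h]
  refine simplex_perm ((List.perm_ext_iff_of_nodup ?_ (Finset.nodup_toList _)).2 ?_)
  · exact List.nodup_ofFn.2 (s.orderEmbOfFin rfl).injective
  · intro a
    rw [List.mem_ofFn, Finset.mem_toList, ← Finset.mem_coe, ← Finset.range_orderEmbOfFin s rfl]
    rfl

/-- A linear map on chains may be prescribed on the simplices with their standard orientation. -/
theorem exists_linear (F : Finset S → M) : ∃ L : Chains S →ₗ[ℤ] M, ∀ s, L (stdSimplex s) = F s := by
  classical
  obtain ⟨b, hb⟩ := exists_basis_stdSimplex S
  refine ⟨b.constr ℕ fun s => if b s = stdSimplex s then F s else -F s, fun s => ?_⟩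
  have h := b.constr_basis ℕ (fun s => if b s = stdSimplex s then F s else -F s) s
  split_ifs at h with h1
  · rwa [h1] at h
  · have h2 := (hb s).resolve_left h1
    rw [h2, map_neg] at h
    exact neg_injective h

theorem span_stdSimplex : Submodule.span ℤ (Set.range (stdSimplex : Finset S → Chains S)) = ⊤ := by
  obtain ⟨b, hb⟩ := exists_basis_stdSimplex S
  rw [eq_top_iff, ← b.span_eq, Submodule.span_le]
  rintro _ ⟨s, rfl⟩
  rcases hb s with h | h
  · rw [h]
    exact Submodule.subset_span ⟨s, rfl⟩
  · rw [h]
    exact Submodule.neg_mem _ (Submodule.subset_span ⟨s, rfl⟩)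

theorem chains_hom_ext {f g : Chains S →ₗ[ℤ] M} (h : ∀ l, f (simplex l) = g (simplex l)) :
    f = g :=
  LinearMap.ext_on_range span_stdSimplex fun s => h s.toList

instance : Module.Free ℤ (Chains S) := by
  obtain ⟨b, -⟩ := exists_basis_stdSimplex S
  exact Module.Free.of_basis b

namespace AugComplex

/-- The full simplex on the vertex set `S`. -/
def full (S : Type*) : AugComplex S where
  IsFace _ := True
  down_closed _ _ _ h := h

theorem simplex_mem_chains {X : AugComplex S} {l : List S} {k : ℕ} (hk : l.length = k)
    (h : X.IsFace {s | s ∈ l}) : simplex l ∈ X.chains k :=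
  Submodule.subset_span ⟨l, hk, h, rfl⟩

/-- To bound the chains of a complex, it is enough to treat simplices without repeated vertices. -/
theorem chains_le {X : AugComplex S} {k : ℕ} {N : Submodule ℤ (Chains S)}
    (h : ∀ l : List S, l.Nodup → l.length = k → X.IsFace {s | s ∈ l} → simplex l ∈ N) :
    X.chains k ≤ N := by
  refine Submodule.span_le.2 ?_
  rintro _ ⟨l, hl, hX, rfl⟩
  by_cases hn : l.Nodup
  · exact h l hn hl hX
  · rw [simplex_of_not_nodup hn]
    exact N.zero_mem

theorem chains_mono {X Y : AugComplex S} (h : ∀ σ, X.IsFace σ → Y.IsFace σ) (k : ℕ) :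
    X.chains k ≤ Y.chains k :=
  chains_le fun _ _ hk hX => simplex_mem_chains hk (h _ hX)

theorem chains_eq_bot {X : AugComplex S} {k : ℕ}
    (h : ∀ l : List S, l.Nodup → l.length = k → ¬ X.IsFace {s | s ∈ l}) : X.chains k = ⊥ :=
  eq_bot_iff.2 (chains_le fun l h1 h2 h3 => (h l h1 h2 h3).elim)

theorem void_chains (k : ℕ) : (void S).chains k = ⊥ := chains_eq_bot fun _ _ _ h => h

theorem boundary_mem_chains {X : AugComplex S} {k : ℕ} {c : Chains S} (hc : c ∈ X.chains (k + 1)) :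
    boundary c ∈ X.chains k := by
  suffices X.chains (k + 1) ≤ (X.chains k).comap boundary from this hc
  refine chains_le fun l _ hk hX => ?_
  rw [Submodule.mem_comap, boundary_simplex]
  refine Submodule.sum_mem _ fun i hi => Submodule.smul_mem _ _ (simplex_mem_chains ?_ ?_)
  · rw [List.length_eraseIdx_of_lt (Finset.mem_range.1 hi), hk, Nat.add_sub_cancel]
  · exact X.down_closed _ _ (fun s hs => List.mem_of_mem_eraseIdx hs) hX

theorem boundary_mem_chains' {X : AugComplex S} {k : ℕ} {c : Chains S} (hc : c ∈ X.chains k) :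
    boundary c ∈ X.chains (k - 1) := by
  cases k with
  | zero =>
    suffices X.chains 0 ≤ (X.chains 0).comap boundary from this hc
    refine chains_le fun l _ hk _ => ?_
    rw [List.length_eq_zero_iff.1 hk, Submodule.mem_comap, boundary_simplex]
    simp
  | succ k => exact boundary_mem_chains hc

theorem mul_mem_chains {X Y Z : AugComplex S} {i j : ℕ}
    (h : ∀ σ τ, X.IsFace σ → Y.IsFace τ → Z.IsFace (σ ∪ τ)) {c d : Chains S}
    (hc : c ∈ X.chains i) (hd : d ∈ Y.chains j) : c * d ∈ Z.chains (i + j) := by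
  have h1 : ∀ l : List S, l.length = i → X.IsFace {s | s ∈ l} →
      Y.chains j ≤ (Z.chains (i + j)).comap (LinearMap.mulLeft ℤ (simplex l)) := by
    intro l hl hX
    refine chains_le fun l' _ hl' hY => ?_
    rw [Submodule.mem_comap, LinearMap.mulLeft_apply, ← simplex_append]
    refine simplex_mem_chains (by simp [hl, hl']) ?_
    convert h _ _ hX hY using 1
    ext s
    simp
  suffices X.chains i ≤ (Z.chains (i + j)).comap (LinearMap.mulRight ℤ d) from this hc
  exact chains_le fun l _ hl hX => h1 l hl hX hd

end AugComplex

/-- The Leibniz rule for the join with a simplex. -/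
theorem boundary_simplex_mul (l : List S) (d : Chains S) :
    boundary (simplex l * d) =
      boundary (simplex l) * d + (-1 : ℤ) ^ l.length • (simplex l * boundary d) := by
  induction l with
  | nil =>
    have : boundary (1 : Chains S) = 0 := by simp [boundary]
    simp [simplex_nil, this]
  | cons s l ih =>
    have h : boundary (ExteriorAlgebra.ι ℤ (Finsupp.single s (1 : ℤ)) * (simplex l * d)) =
        simplex l * d -
          ExteriorAlgebra.ι ℤ (Finsupp.single s (1 : ℤ)) * boundary (simplex l * d) := by
      rw [boundary, ExteriorAlgebra.ι, CliffordAlgebra.contractLeft_ι_mul]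
      simp
    rw [boundary_simplex_cons, simplex_cons, mul_assoc, h, ih, List.length_cons, pow_succ]
    simp only [mul_add, sub_mul, mul_assoc, mul_neg, mul_one, neg_smul, mul_smul_comm]
    abel

/-- The Leibniz rule. -/
theorem boundary_mul {X : AugComplex S} {k : ℕ} {c : Chains S} (hc : c ∈ X.chains k)
    (d : Chains S) :
    boundary (c * d) = boundary c * d + (-1 : ℤ) ^ k • (c * boundary d) := by
  suffices X.chains k ≤ LinearMap.ker (boundary ∘ₗ LinearMap.mulRight ℤ d -
      LinearMap.mulRight ℤ d ∘ₗ boundary - (-1 : ℤ) ^ k • LinearMap.mulRight ℤ (boundary d)) by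
    have h := LinearMap.mem_ker.1 (this hc)
    simp only [LinearMap.sub_apply, LinearMap.comp_apply, LinearMap.smul_apply,
      LinearMap.mulRight_apply, sub_eq_zero] at h
    rw [← h]
    abel
  refine AugComplex.chains_le fun l _ hl _ => ?_
  simp only [LinearMap.mem_ker, LinearMap.sub_apply, LinearMap.comp_apply, LinearMap.smul_apply,
      LinearMap.mulRight_apply, boundary_simplex_mul, hl]
  abel

theorem boundary_singleton_mul (s : S) (d : Chains S) :
    boundary (simplex [s] * d) = d - simplex [s] * boundary d := by
  rw [boundary_simplex_mul, boundary_simplex]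
  simp [simplex_nil, sub_eq_add_neg]

theorem boundary_mul_singleton {X : AugComplex S} {k : ℕ} {c : Chains S} (hc : c ∈ X.chains k)
    (s : S) : boundary (c * simplex [s]) = boundary c * simplex [s] + (-1 : ℤ) ^ k • c := by
  rw [boundary_mul hc, boundary_simplex [s]]
  simp [simplex_nil]

theorem simplex_mul_comm (l l' : List S) :
    simplex l * simplex l' = (-1 : ℤ) ^ (l.length * l'.length) • (simplex l' * simplex l) := by
  have h : ∀ (s : S) (l' : List S),
      simplex [s] * simplex l' = (-1 : ℤ) ^ l'.length • (simplex l' * simplex [s]) := by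
    intro s l'
    induction l' with
    | nil => simp [simplex_nil]
    | cons t l' ih =>
      rw [simplex_cons' t l', ← mul_assoc, simplex_singleton_mul_comm, neg_mul, mul_assoc, ih,
        List.length_cons, pow_succ]
      simp only [mul_neg, mul_one, neg_smul, mul_smul_comm, mul_assoc]
  induction l with
  | nil => simp [simplex_nil]
  | cons s l ih =>
    rw [simplex_cons' s l, mul_assoc, ih, mul_smul_comm, ← mul_assoc, h, List.length_cons, add_mul,
      one_mul, pow_add]
    simp [mul_assoc]

/-- `X` is a cone with apex `x`. (The void complex counts as a cone.) -/
def AugComplex.IsCone (X : AugComplex S) (x : S) : Prop := ∀ σ, X.IsFace σ → X.IsFace (insert x σ)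

theorem AugComplex.IsCone.mul_mem {X : AugComplex S} {x : S} (h : X.IsCone x) {k : ℕ}
    {c : Chains S} (hc : c ∈ X.chains k) : simplex [x] * c ∈ X.chains (k + 1) := by
  suffices X.chains k ≤ (X.chains (k + 1)).comap (LinearMap.mulLeft ℤ (simplex [x])) from this hc
  refine chains_le fun l _ hl hX => ?_
  rw [Submodule.mem_comap, LinearMap.mulLeft_apply, ← simplex_append]
  refine simplex_mem_chains (by simp [hl]) ?_
  convert h _ hX using 1
  ext s
  simp

theorem AugComplex.IsCone.exists_boundary_eq {X : AugComplex S} {x : S} (h : X.IsCone x) {k : ℕ}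
    {c : Chains S} (hc : c ∈ X.chains k) (hb : boundary c = 0) :
    ∃ e ∈ X.chains (k + 1), boundary e = c :=
  ⟨_, h.mul_mem hc, by rw [boundary_singleton_mul, hb, mul_zero, sub_zero]⟩

/-- A linear map on chains may be defined by recursion on the number of vertices, prescribing its
value on a simplex in terms of the value on the boundary. -/
theorem exists_recursive (m : M) (T : Finset S → M → M) : ∃ L : Chains S →ₗ[ℤ] M,
    L 1 = m ∧ ∀ s : Finset S, s.Nonempty → L (stdSimplex s) = T s (L (boundary (stdSimplex s))) := by
  classical
  -- iterate the defining formula; the value on a simplex with `k` vertices is stable from step `k`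
  choose lin hlin using fun F : Finset S → M => exists_linear F
  let step : (Chains S →ₗ[ℤ] M) → (Chains S →ₗ[ℤ] M) := fun L' =>
    lin fun s => if s = ∅ then m else T s (L' (boundary (stdSimplex s)))
  let L' : ℕ → (Chains S →ₗ[ℤ] M) := fun k => step^[k] (lin fun _ => m)
  have hs : ∀ k, L' (k + 1) = step (L' k) := fun k => Function.iterate_succ_apply' _ _ _
  refine ⟨lin fun s => L' s.card (stdSimplex s), ?_, fun s hne => ?_⟩
  · rw [← stdSimplex_empty, hlin]
    exact hlin _ _
  · obtain ⟨k, hk⟩ : ∃ k, s.card = k + 1 := Nat.exists_eq_succ_of_ne_zero (by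
      simpa using hne.ne_empty)
    have hmem : boundary (stdSimplex s) ∈ (AugComplex.full S).chains k :=
      AugComplex.boundary_mem_chains
        (AugComplex.simplex_mem_chains (by rw [Finset.length_toList, hk]) trivial)
    have hagree : (AugComplex.full S).chains k ≤
        LinearMap.eqLocus (lin fun s => L' s.card (stdSimplex s)) (L' k) := by
      refine AugComplex.chains_le fun l hn hl _ => ?_
      have : (lin fun s => L' s.card (stdSimplex s)) (stdSimplex l.toFinset) =
          L' k (stdSimplex l.toFinset) := by
        rw [hlin, List.toFinset_card_of_nodup hn, hl]
      rw [LinearMap.mem_eqLocus]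
      rcases simplex_eq_stdSimplex hn with h | h
      · rw [h, this]
      · rw [h, map_neg, map_neg, this]
    rw [hlin, hk, hs, LinearMap.mem_eqLocus.1 (hagree hmem)]
    change lin _ _ = _
    rw [hlin, if_neg hne.ne_empty]

open scoped Classical in
/-- Acyclic carriers: a chain map `δ` that kills the augmentation and takes every simplex `σ` of
`X` into a cone `C σ`, depending monotonically on `σ`, takes cycles of `X` to boundaries. -/
theorem exists_boundary_eq_of_carrier {X : AugComplex S} {Y : AugComplex S'}
    (δ : Chains S →ₗ[ℤ] Chains S') (hδ : ∀ c, boundary (δ c) = δ (boundary c)) (h1 : δ 1 = 0)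
    (C : Finset S → AugComplex S') (a : Finset S → S') (hmono : ∀ s t, s ⊆ t → ∀ σ,
      (C s).IsFace σ → (C t).IsFace σ)
    (hcone : ∀ s : Finset S, s.Nonempty → X.IsFace s → (C s).IsCone (a s))
    (hC : ∀ l : List S, X.IsFace {s | s ∈ l} → δ (simplex l) ∈ (C l.toFinset).chains l.length)
    (hY : ∀ s : Finset S, X.IsFace s → ∀ σ, (C s).IsFace σ → Y.IsFace σ) {k : ℕ} {c : Chains S}
    (hc : c ∈ X.chains k) (hb : boundary c = 0) : ∃ e ∈ Y.chains (k + 1), boundary e = δ c := by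
  -- `D` is a chain homotopy from `δ` to `0`
  obtain ⟨D, hD0, hD⟩ := exists_recursive (S := S) (0 : Chains S')
    fun s m => simplex [a s] * (δ (stdSimplex s) - m)
  have hface : ∀ l : List S, (l.toFinset : Set S) = {s | s ∈ l} := fun l => by simp
  have key : ∀ k, ∀ l : List S, l.Nodup → l.length = k → X.IsFace {s | s ∈ l} →
      D (simplex l) ∈ (C l.toFinset).chains (k + 1) ∧
        boundary (D (simplex l)) = δ (simplex l) - D (boundary (simplex l)) := by
    intro k
    induction k with
    | zero =>
      intro l _ hl _
      rw [List.length_eq_zero_iff.1 hl, simplex_nil, hD0, h1]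
      refine ⟨Submodule.zero_mem _, ?_⟩
      have : boundary (1 : Chains S) = 0 := by simp [boundary]
      simp [this]
    | succ k ih =>
      intro l hn hl hX
      have hne : l.toFinset.Nonempty := by
        rw [List.toFinset_nonempty_iff]
        rintro rfl
        simp at hl
      have hformula : D (simplex l) =
          simplex [a l.toFinset] * (δ (simplex l) - D (boundary (simplex l))) := by
        rcases simplex_eq_stdSimplex hn with h | h
        · rw [h, hD _ hne]
        · rw [h, map_neg, hD _ hne]
          simp only [map_neg, ← mul_neg]
          congr 1
          abel
      -- the boundary of `l` is a combination of faces, for which the induction hypothesis holds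
      have hfaces : ∀ i ∈ Finset.range l.length, (l.eraseIdx i).Nodup ∧
          (l.eraseIdx i).length = k ∧ X.IsFace {s | s ∈ l.eraseIdx i} ∧
          (l.eraseIdx i).toFinset ⊆ l.toFinset := by
        intro i hi
        refine ⟨hn.sublist (List.eraseIdx_sublist _ _), ?_, ?_, ?_⟩
        · rw [List.length_eraseIdx_of_lt (Finset.mem_range.1 hi), hl, Nat.add_sub_cancel]
        · exact X.down_closed _ _ (fun s hs => List.mem_of_mem_eraseIdx hs) hX
        · intro s hs
          exact List.mem_toFinset.2 (List.mem_of_mem_eraseIdx (List.mem_toFinset.1 hs))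
      have hu : δ (simplex l) - D (boundary (simplex l)) ∈ (C l.toFinset).chains (k + 1) := by
        refine Submodule.sub_mem _ (by simpa only [hl] using hC l hX) ?_
        rw [boundary_simplex, map_sum]
        refine Submodule.sum_mem _ fun i hi => ?_
        obtain ⟨h1, h2, h3, h4⟩ := hfaces i hi
        rw [map_smul]
        exact Submodule.smul_mem _ _ (AugComplex.chains_mono (hmono _ _ h4) _ (ih _ h1 h2 h3).1)
      have hbu : boundary (δ (simplex l) - D (boundary (simplex l))) = 0 := by
        have h5 : boundary (D (boundary (simplex l))) =
            δ (boundary (simplex l)) - D (boundary (boundary (simplex l))) := by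
          rw [boundary_simplex]
          simp only [map_sum, map_smul, ← Finset.sum_sub_distrib, ← smul_sub]
          refine Finset.sum_congr rfl fun i hi => ?_
          obtain ⟨h1, h2, h3, -⟩ := hfaces i hi
          rw [(ih _ h1 h2 h3).2]
        rw [map_sub, h5, boundary_boundary, map_zero, sub_zero, hδ, sub_self]
      rw [hformula]
      refine ⟨(hcone _ hne (by rwa [hface])).mul_mem hu, ?_⟩
      rw [boundary_singleton_mul, hbu, mul_zero, sub_zero]
  refine ⟨D c, ?_, ?_⟩
  · suffices X.chains k ≤ (Y.chains (k + 1)).comap D from this hc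
    refine AugComplex.chains_le fun l hn hl hX => ?_
    exact AugComplex.chains_mono (hY _ (by rwa [hface])) _ (key k l hn hl hX).1
  · have h : boundary (D c) = δ c - D (boundary c) := by
      suffices X.chains k ≤ LinearMap.eqLocus (boundary ∘ₗ D) (δ - D ∘ₗ boundary) from this hc
      exact AugComplex.chains_le fun l hn hl hX => (key k l hn hl hX).2
    rw [h, hb, map_zero, sub_zero]

end ChainAlgebra

/-! ### Barycentric subdivision and spans -/

section Beta

variable {α : Type*} [CompleteLattice α]

theorem exists_beta (α : Type*) [CompleteLattice α] : ∃ L : Chains α →ₗ[ℤ] Chains α, L 1 = 1 ∧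
    ∀ s : Finset α, s.Nonempty → L (stdSimplex s) = (-1 : ℤ) ^ (s.card - 1) •
      (L (boundary (stdSimplex s)) * simplex [sSup (s : Set α)]) := by
  obtain ⟨L, h1, h2⟩ := exists_recursive (S := α) (1 : Chains α)
    fun s m => (-1 : ℤ) ^ (s.card - 1) • (m * simplex [sSup (s : Set α)])
  exact ⟨L, h1, h2⟩

/-- The chain map "barycentric subdivision followed by suprema",
`[s₁, …, s_k] ↦ ∑_σ sgn(σ) [s_{σ(1)}, s_{σ(1)} ⊔ s_{σ(2)}, …, s_{σ(1)} ⊔ ⋯ ⊔ s_{σ(k)}]`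
(see `beta_ofFn`). It is constructed recursively as the cone, with the apex put last, on its value
on the boundary. -/
def beta : Chains α →ₗ[ℤ] Chains α := (exists_beta α).choose

theorem beta_one : beta (1 : Chains α) = 1 := (exists_beta α).choose_spec.1

theorem beta_simplex {l : List α} (hn : l.Nodup) {k : ℕ} (hl : l.length = k + 1) :
    beta (simplex l) =
      (-1 : ℤ) ^ k • (beta (boundary (simplex l)) * simplex [sSup {s | s ∈ l}]) := by
  classical
  have hne : l.toFinset.Nonempty := by
    rw [List.toFinset_nonempty_iff]
    rintro rfl
    simp at hl
  have h := (exists_beta α).choose_spec.2 l.toFinset hne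
  rw [List.toFinset_card_of_nodup hn, hl, Nat.add_sub_cancel, List.coe_toFinset] at h
  change beta _ = (-1 : ℤ) ^ k • (beta _ * _) at h
  rcases simplex_eq_stdSimplex hn with h' | h'
  · rw [h', h]
  · rw [h', map_neg, map_neg, map_neg, h, neg_mul, smul_neg]

/-- The complex of flags of suprema of non-empty subsets of `T`. -/
def supFlags (T : Set α) : AugComplex α where
  IsFace σ := (∀ U ∈ σ, ∃ t ⊆ T, t.Nonempty ∧ U = sSup t) ∧ IsChain (· ≤ ·) σ
  down_closed _ _ hτ h := ⟨fun U hU => h.1 U (hτ hU), h.2.mono hτ⟩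

theorem supFlags_mono {T T' : Set α} (h : T ⊆ T') (σ : Set α) (hσ : (supFlags T).IsFace σ) :
    (supFlags T').IsFace σ := by
  refine ⟨fun U hU => ?_, hσ.2⟩
  obtain ⟨t, ht, hne, rfl⟩ := hσ.1 U hU
  exact ⟨t, ht.trans h, hne, rfl⟩

theorem mul_top_mem_supFlags {T : Set α} (hT : T.Nonempty) {k : ℕ} {c : Chains α}
    (hc : c ∈ (supFlags T).chains k) : c * simplex [sSup T] ∈ (supFlags T).chains (k + 1) := by
  suffices (supFlags T).chains k ≤ ((supFlags T).chains (k + 1)).comap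
    (LinearMap.mulRight ℤ (simplex [sSup T])) from this hc
  refine AugComplex.chains_le fun l _ hl hX => ?_
  rw [Submodule.mem_comap, LinearMap.mulRight_apply, ← simplex_append]
  refine AugComplex.simplex_mem_chains (by simp [hl]) ⟨?_, ?_⟩
  · intro U hU
    rcases List.mem_append.1 hU with h | h
    · exact hX.1 U h
    · rw [List.mem_singleton.1 h]
      exact ⟨T, subset_rfl, hT, rfl⟩
  · have hle : ∀ U ∈ l, U ≤ sSup T := by
      intro U hU
      obtain ⟨t, ht, -, rfl⟩ := hX.1 U hU
      exact sSup_le_sSup ht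
    convert hX.2.insert (a := sSup T) fun b hb _ => Or.inr (hle b hb) using 1
    ext
    simp [or_comm]

theorem beta_simplex_mem (l : List α) :
    beta (simplex l) ∈ (supFlags {s | s ∈ l}).chains l.length := by
  suffices ∀ k, ∀ l : List α, l.length = k →
      beta (simplex l) ∈ (supFlags {s | s ∈ l}).chains k from this _ l rfl
  intro k
  induction k with
  | zero =>
    intro l hl
    rw [List.length_eq_zero_iff.1 hl, simplex_nil, beta_one, ← simplex_nil]
    exact AugComplex.simplex_mem_chains rfl ⟨by simp, by simp⟩
  | succ k ih =>
    intro l hl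
    by_cases hn : l.Nodup
    · rw [beta_simplex hn hl]
      refine Submodule.smul_mem _ _ (mul_top_mem_supFlags ?_ ?_)
      · obtain ⟨a, ha⟩ := List.exists_mem_of_length_pos (l := l) (by omega)
        exact ⟨a, ha⟩
      · rw [boundary_simplex, map_sum]
        refine Submodule.sum_mem _ fun i hi => ?_
        rw [map_smul]
        refine Submodule.smul_mem _ _ (AugComplex.chains_mono (supFlags_mono ?_) _ (ih _ ?_))
        · exact fun s hs => List.mem_of_mem_eraseIdx hs
        · rw [List.length_eraseIdx_of_lt (Finset.mem_range.1 hi), hl, Nat.add_sub_cancel]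
    · rw [simplex_of_not_nodup hn, map_zero]
      exact Submodule.zero_mem _

theorem beta_mem_chains {X Y : AugComplex α}
    (h : ∀ σ, X.IsFace σ → ∀ τ, (supFlags σ).IsFace τ → Y.IsFace τ) {k : ℕ} {c : Chains α}
    (hc : c ∈ X.chains k) : beta c ∈ Y.chains k := by
  suffices X.chains k ≤ (Y.chains k).comap beta from this hc
  refine AugComplex.chains_le fun l _ hl hX => ?_
  rw [← hl]
  exact AugComplex.chains_mono (h _ hX) _ (beta_simplex_mem l)

theorem beta_mem_full {k : ℕ} {c : Chains α} (hc : c ∈ (AugComplex.full α).chains k) :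
    beta c ∈ (AugComplex.full α).chains k :=
  beta_mem_chains (fun _ _ _ _ => trivial) hc

theorem boundary_beta (c : Chains α) : boundary (beta c) = beta (boundary c) := by
  suffices ∀ k, ∀ l : List α, l.length = k →
      boundary (beta (simplex l)) = beta (boundary (simplex l)) by
    have h : boundary ∘ₗ beta = beta ∘ₗ (boundary : Chains α →ₗ[ℤ] Chains α) :=
      chains_hom_ext fun l => this _ l rfl
    exact LinearMap.congr_fun h c
  intro k
  induction k with
  | zero =>
    intro l hl
    have : boundary (1 : Chains α) = 0 := by simp [boundary]
    rw [List.length_eq_zero_iff.1 hl, simplex_nil, beta_one, this, map_zero]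
  | succ k ih =>
    intro l hl
    by_cases hn : l.Nodup
    · have h1 : boundary (beta (boundary (simplex l))) = 0 := by
        have : boundary (beta (boundary (simplex l))) =
            beta (boundary (boundary (simplex l))) := by
          rw [boundary_simplex]
          simp only [map_sum, map_smul]
          refine Finset.sum_congr rfl fun i hi => ?_
          rw [ih]
          rw [List.length_eraseIdx_of_lt (Finset.mem_range.1 hi), hl, Nat.add_sub_cancel]
        rw [this, boundary_boundary, map_zero]
      have h2 : beta (boundary (simplex l)) ∈ (AugComplex.full α).chains k :=
        beta_mem_full (AugComplex.boundary_mem_chains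
          (AugComplex.simplex_mem_chains hl trivial))
      rw [beta_simplex hn hl, map_smul, boundary_mul_singleton h2, h1, zero_mul, zero_add,
        smul_smul, ← mul_pow]
      simp
    · rw [simplex_of_not_nodup hn, map_zero, map_zero, map_zero]

theorem chainMap_mul {S S' : Type*} (f : S → S') (c d : Chains S) :
    chainMap f (c * d) = chainMap f c * chainMap f d := by
  simp [chainMap]

theorem beta_chainMap (f : α ≃o α) (c : Chains α) :
    beta (chainMap f c) = chainMap f (beta c) := by
  suffices ∀ k, ∀ l : List α, l.length = k →
      beta (chainMap f (simplex l)) = chainMap f (beta (simplex l)) by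
    have h : beta ∘ₗ chainMap f = chainMap f ∘ₗ (beta : Chains α →ₗ[ℤ] Chains α) :=
      chains_hom_ext fun l => this _ l rfl
    exact LinearMap.congr_fun h c
  intro k
  induction k with
  | zero =>
    intro l hl
    have : chainMap f (1 : Chains α) = 1 := by
      rw [← simplex_nil, chainMap_simplex, List.map_nil, simplex_nil]
    rw [List.length_eq_zero_iff.1 hl, simplex_nil, beta_one, this, beta_one]
  | succ k ih =>
    intro l hl
    by_cases hn : l.Nodup
    · have h1 : beta (chainMap f (boundary (simplex l))) =
          chainMap f (beta (boundary (simplex l))) := by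
        rw [boundary_simplex]
        simp only [map_sum, map_smul]
        refine Finset.sum_congr rfl fun i hi => ?_
        rw [ih]
        rw [List.length_eraseIdx_of_lt (Finset.mem_range.1 hi), hl, Nat.add_sub_cancel]
      have h2 : sSup {s | s ∈ l.map f} = f (sSup {s | s ∈ l}) := by
        rw [map_sSup]
        congr 1
        ext
        simp
      rw [chainMap_simplex, beta_simplex (hn.map f.injective) (by simpa using hl),
        beta_simplex hn hl, ← chainMap_simplex, ← chainMap_boundary, h1, map_smul, chainMap_mul,
        chainMap_simplex f [_], h2]
      rfl
    · rw [simplex_of_not_nodup hn, map_zero, map_zero, map_zero]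

/-! ### Explicit formulas for the subdivision of a simplex -/

/-- A sum over permutations of `{0, …, k}`, split according to the image of `k`. -/
theorem sum_perm_last {β M : Type*} [AddCommGroup M] {k : ℕ} (w : Fin (k + 1) → β)
    (G : (Fin k → β) → M) :
    ∑ σ : Equiv.Perm (Fin (k + 1)), (Equiv.Perm.sign σ : ℤ) • G (fun j => w (σ j.castSucc)) =
      (-1 : ℤ) ^ k • ∑ i : Fin (k + 1), (-1 : ℤ) ^ (i : ℕ) •
        ∑ σ : Equiv.Perm (Fin k), (Equiv.Perm.sign σ : ℤ) • G (fun j => w (i.succAbove (σ j))) := by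
  -- the permutation `e (i, σ)` takes the last element to `i` and is `σ` on the others
  let e : Fin (k + 1) × Equiv.Perm (Fin k) → Equiv.Perm (Fin (k + 1)) := fun a =>
    a.1.cycleRange.symm * Equiv.Perm.decomposeFin.symm (0, a.2) * finRotate (k + 1)
  have he1 : ∀ a (j : Fin k), e a j.castSucc = a.1.succAbove (a.2 j) := by
    intro a j
    simp only [e, Equiv.Perm.mul_apply]
    rw [finRotate_apply, Fin.coeSucc_eq_succ, Equiv.Perm.decomposeFin_symm_apply_succ,
      Equiv.swap_self, Equiv.refl_apply, Fin.cycleRange_symm_succ]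
  have he2 : ∀ a, e a (Fin.last k) = a.1 := by
    intro a
    simp only [e, Equiv.Perm.mul_apply]
    rw [finRotate_last, Equiv.Perm.decomposeFin_symm_apply_zero, Fin.cycleRange_symm_zero]
  have hsign : ∀ a, (Equiv.Perm.sign (e a) : ℤ) =
      (-1 : ℤ) ^ k * ((-1 : ℤ) ^ (a.1 : ℕ) * Equiv.Perm.sign a.2) := by
    intro a
    simp only [e, Equiv.Perm.sign_mul, Equiv.Perm.sign_symm, Fin.sign_cycleRange,
      Equiv.Perm.decomposeFin.symm_sign, sign_finRotate]
    push_cast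
    simp
    ring
  have hbij : Function.Bijective e := by
    rw [Fintype.bijective_iff_injective_and_card]
    refine ⟨?_, ?_⟩
    · rintro ⟨i, σ⟩ ⟨i', σ'⟩ h
      have h1 : i = i' := by
        have h2 := he2 (i, σ)
        rw [h, he2] at h2
        exact h2.symm
      subst h1
      have h2 : σ = σ' := by
        ext j
        have h3 := he1 (i, σ) j
        rw [h, he1] at h3
        exact congrArg Fin.val (Fin.succAbove_right_injective h3).symm
      rw [h2]
    · rw [Fintype.card_prod, Fintype.card_perm, Fintype.card_perm, Fintype.card_fin,
        Fintype.card_fin, Nat.factorial_succ]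
  rw [← hbij.sum_comp, Fintype.sum_prod_type, Finset.smul_sum]
  refine Finset.sum_congr rfl fun i _ => ?_
  rw [Finset.smul_sum, Finset.smul_sum]
  refine Finset.sum_congr rfl fun σ _ => ?_
  rw [hsign, mul_smul, mul_smul]
  simp only [he1]

theorem simplex_ofFn_succ {S : Type*} {k : ℕ} (f : Fin (k + 1) → S) :
    simplex (List.ofFn f) = simplex (List.ofFn fun i : Fin k => f i.castSucc) *
      simplex [f (Fin.last k)] := by
  rw [List.ofFn_succ', List.concat_eq_append, simplex_append]

theorem eraseIdx_ofFn {β : Type*} {k : ℕ} (w : Fin (k + 1) → β) (i : Fin (k + 1)) :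
    (List.ofFn w).eraseIdx i = List.ofFn fun j => w (i.succAbove j) := by
  apply List.ext_getElem
  · simp [List.length_eraseIdx, Nat.lt_succ_iff.1 i.2]
  · intro n h1 h2
    rw [List.getElem_eraseIdx]
    simp only [List.getElem_ofFn]
    have hn : n < k := by simpa using h2
    split_ifs with h3
    · congr 1
      rw [Fin.succAbove_of_castSucc_lt _ _ (by simpa [Fin.lt_def] using h3)]
      rfl
    · congr 1
      rw [Fin.succAbove_of_le_castSucc _ _ (by simpa [Fin.le_def] using h3)]
      rfl

theorem boundary_simplex_ofFn {β : Type*} {k : ℕ} (w : Fin (k + 1) → β) :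
    boundary (simplex (List.ofFn w)) =
      ∑ i : Fin (k + 1), (-1 : ℤ) ^ (i : ℕ) • simplex (List.ofFn fun j => w (i.succAbove j)) := by
  rw [boundary_simplex, List.length_ofFn, Finset.sum_range]
  simp only [eraseIdx_ofFn]

/-- The flag of partial suprema of `w`. -/
def supFlag {m n : ℕ} (w : Fin m → α) (i : Fin n) : α := sSup (w '' {j | (j : ℕ) ≤ i})

theorem supFlag_castSucc {k n : ℕ} (w : Fin (k + 1) → α) (i : Fin n) (hi : (i : ℕ) < k) :
    supFlag w i = supFlag (fun j : Fin k => w j.castSucc) i := by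
  unfold supFlag
  congr 1
  ext U
  constructor
  · rintro ⟨j, hj, rfl⟩
    have hj' : (j : ℕ) ≤ i := hj
    exact ⟨⟨j, by omega⟩, hj, rfl⟩
  · rintro ⟨j, hj, rfl⟩
    exact ⟨j.castSucc, hj, rfl⟩

theorem beta_ofFn {k : ℕ} (w : Fin k → α) (hw : Function.Injective w) :
    beta (simplex (List.ofFn w)) = ∑ σ : Equiv.Perm (Fin k), (Equiv.Perm.sign σ : ℤ) •
      simplex (List.ofFn fun i : Fin k => supFlag (fun j => w (σ j)) i) := by
  induction k with
  | zero => simp [simplex_nil, beta_one]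
  | succ k ih =>
    have h1 : ∀ σ : Equiv.Perm (Fin (k + 1)),
        simplex (List.ofFn fun i : Fin (k + 1) => supFlag (fun j => w (σ j)) i) =
        simplex (List.ofFn fun i : Fin k =>
          supFlag (fun j : Fin k => w (σ j.castSucc)) i) * simplex [sSup (Set.range w)] := by
      intro σ
      rw [simplex_ofFn_succ]
      have h2 : supFlag (fun j => w (σ j)) (Fin.last k) = sSup (Set.range w) := by
        unfold supFlag
        congr 1
        ext U
        constructor
        · rintro ⟨j, -, rfl⟩
          exact ⟨_, rfl⟩
        · rintro ⟨j, rfl⟩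
          exact ⟨σ.symm j, Nat.lt_succ_iff.1 (σ.symm j).2, by simp⟩
      rw [h2]
      congr 3
      funext i
      exact supFlag_castSucc _ i.castSucc i.2
    have h3 := sum_perm_last w fun x : Fin k → α =>
      simplex (List.ofFn fun i : Fin k => supFlag x i) * simplex [sSup (Set.range w)]
    have h4 : sSup {s | s ∈ List.ofFn w} = sSup (Set.range w) := by
      congr 1
      ext
      exact List.mem_ofFn' _ _
    simp only [h1]
    rw [h3, beta_simplex (List.nodup_ofFn.2 hw) (List.length_ofFn), h4, boundary_simplex_ofFn]
    simp only [map_sum, map_smul, Finset.sum_mul, smul_mul_assoc]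
    congr 1
    refine Finset.sum_congr rfl fun i _ => ?_
    rw [ih (fun j => w (i.succAbove j)) (hw.comp Fin.succAbove_right_injective)]
    simp only [Finset.sum_mul, smul_mul_assoc]

/-- The value of `beta` on the boundary of a simplex: the flags of `beta_ofFn` with the last member,
the supremum of all vertices, left out. -/
theorem beta_boundary_ofFn {m : ℕ} (hm : 1 ≤ m) (w : Fin m → α) (hw : Function.Injective w) :
    beta (boundary (simplex (List.ofFn w))) = (-1 : ℤ) ^ (m - 1) •
      ∑ σ : Equiv.Perm (Fin m), (Equiv.Perm.sign σ : ℤ) •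
        simplex (List.ofFn fun i : Fin (m - 1) => supFlag (fun j => w (σ j)) i) := by
  obtain ⟨k, rfl⟩ := Nat.exists_eq_add_of_le' hm
  have h3 := sum_perm_last w fun x : Fin k → α =>
    simplex (List.ofFn fun i : Fin k => supFlag x i)
  have h1 : ∀ σ : Equiv.Perm (Fin (k + 1)),
      simplex (List.ofFn fun i : Fin (k + 1 - 1) => supFlag (fun j => w (σ j)) i) =
        simplex (List.ofFn fun i : Fin k => supFlag (fun j : Fin k => w (σ j.castSucc)) i) := by
    intro σ
    change simplex (List.ofFn fun i : Fin k => _) = _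
    congr 2
    funext i
    exact supFlag_castSucc _ i i.2
  simp only [h1]
  rw [h3, Nat.add_sub_cancel, smul_smul, ← mul_pow, boundary_simplex_ofFn]
  simp only [map_sum, map_smul, neg_mul_neg, one_mul, one_pow, one_smul]
  refine Finset.sum_congr rfl fun i _ => ?_
  rw [beta_ofFn (fun j => w (i.succAbove j)) (hw.comp Fin.succAbove_right_injective)]

/-- The expansion of `([a₁] - [b₁]) * ⋯ * ([a_m] - [b_m])`. -/
theorem prod_sub_simplex {S : Type*} {m : ℕ} (a b : Fin m → S) :
    (List.ofFn fun i => simplex [a i] - simplex [b i]).prod =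
      ∑ ε : Fin m → Bool, (∏ i, if ε i then (-1 : ℤ) else 1) •
        simplex (List.ofFn fun i => if ε i then b i else a i) := by
  induction m with
  | zero => simp [simplex_nil]
  | succ m ih =>
    rw [List.ofFn_succ, List.prod_cons, ih,
      ← (Fin.consEquiv fun _ : Fin (m + 1) => Bool).sum_comp, Fintype.sum_prod_type]
    simp only [Fintype.sum_bool, Fin.consEquiv_apply, Fin.prod_univ_succ, Fin.cons_zero,
      Fin.cons_succ, List.ofFn_succ, simplex_cons' _ (List.ofFn _), if_true, Bool.false_eq_true,
      if_false, one_mul, neg_mul, neg_smul, Finset.sum_neg_distrib, sub_mul, smul_sub,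
      Finset.sum_sub_distrib, Finset.mul_sum, mul_smul_comm]
    abel

end Beta

/-! ### Relative homology -/

section Homology

variable {S S' : Type*} {X Y Z : AugComplex S} {X' Y' : AugComplex S'} {k : ℕ}

theorem relClass_eq_iff {c c' : Chains S} (hc : c ∈ relCycles X Y k) (hc' : c' ∈ relCycles X Y k) :
    relClass c hc = relClass c' hc' ↔ c - c' ∈ relBoundaries X Y k :=
  Submodule.Quotient.eq _

theorem relClass_eq_zero_iff {c : Chains S} (hc : c ∈ relCycles X Y k) :
    relClass c hc = 0 ↔ c ∈ relBoundaries X Y k :=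
  Submodule.Quotient.mk_eq_zero _

theorem mem_relBoundaries {c : Chains S} :
    c ∈ relBoundaries X Y k ↔ ∃ e ∈ X.chains (k + 1), ∃ y ∈ Y.chains k, boundary e + y = c := by
  rw [relBoundaries, Submodule.mem_sup]
  constructor
  · rintro ⟨_, ⟨e, he, rfl⟩, y, hy, h⟩
    exact ⟨e, he, y, hy, h⟩
  · rintro ⟨e, he, y, hy, h⟩
    exact ⟨_, ⟨e, he, rfl⟩, y, hy, h⟩

theorem mem_relBoundaries_void {c : Chains S} :
    c ∈ relBoundaries X (AugComplex.void S) k ↔ ∃ e ∈ X.chains (k + 1), boundary e = c := by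
  rw [mem_relBoundaries]
  constructor
  · rintro ⟨e, he, y, hy, h⟩
    rw [AugComplex.void_chains, Submodule.mem_bot] at hy
    exact ⟨e, he, by rw [← h, hy, add_zero]⟩
  · rintro ⟨e, he, h⟩
    exact ⟨e, he, 0, Submodule.zero_mem _, by rw [h, add_zero]⟩

theorem mem_relCycles {c : Chains S} :
    c ∈ relCycles X Y k ↔ c ∈ X.chains k ∧ boundary c ∈ Y.chains (k - 1) := Iff.rfl

theorem mem_relCycles_void {c : Chains S} :
    c ∈ relCycles X (AugComplex.void S) k ↔ c ∈ X.chains k ∧ boundary c = 0 := by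
  rw [mem_relCycles, AugComplex.void_chains, Submodule.mem_bot]

/-- Taking homology classes, as a linear map. -/
def relMk (X Y : AugComplex S) (k : ℕ) : ↥(relCycles X Y k) →ₗ[ℤ] RelHomology X Y k :=
  Submodule.mkQ _

theorem relHomology_ext {M : Type*} [AddCommGroup M] [Module ℤ M]
    {f g : RelHomology X Y k →ₗ[ℤ] M} (h : ∀ c hc, f (relClass c hc) = g (relClass c hc)) :
    f = g := by
  refine LinearMap.ext fun x => ?_
  obtain ⟨c, hc, rfl⟩ := relClass_surjective x
  exact h c hc

/-- The map on relative homology induced by a chain map. -/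
def homologyMapOfChain (f : Chains S →ₗ[ℤ] Chains S')
    (hf : ∀ c, boundary (f c) = f (boundary c))
    (hX : ∀ k c, c ∈ X.chains k → f c ∈ X'.chains k)
    (hY : ∀ k c, c ∈ Y.chains k → f c ∈ Y'.chains k) (k : ℕ) :
    RelHomology X Y k →ₗ[ℤ] RelHomology X' Y' k :=
  Submodule.mapQ _ _
    (f.restrict (p := relCycles X Y k) (q := relCycles X' Y' k)
      fun c hc => ⟨hX _ _ hc.1, by
        change boundary (f c) ∈ Y'.chains _
        rw [hf]
        exact hY _ _ hc.2⟩)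
    (by
      rintro ⟨c, hc⟩ h
      obtain ⟨e, he, y, hy, h⟩ := mem_relBoundaries.1 h
      refine mem_relBoundaries.2 ⟨f e, hX _ _ he, f y, hY _ _ hy, ?_⟩
      rw [hf, ← map_add]
      exact congrArg f h)

theorem connecting_relClass {c : Chains S} (hc : c ∈ relCycles X Y (k + 1))
    (hc' : boundary c ∈ relCycles Y Z k) :
    connecting X Y Z k (relClass c hc) = relClass (boundary c) hc' := rfl

/-- For a cone `X` the long exact sequence of the pair `(X, Y)` reduces to isomorphisms. -/
theorem connecting_bijective_of_isCone {x : S} (hX : X.IsCone x)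
    (hYX : ∀ σ, Y.IsFace σ → X.IsFace σ) :
    Function.Bijective (connecting X Y (AugComplex.void S) k) := by
  constructor
  · rw [← LinearMap.ker_eq_bot, eq_bot_iff]
    intro z hz
    obtain ⟨c, hc, rfl⟩ := relClass_surjective z
    have hc' : boundary c ∈ relCycles Y (AugComplex.void S) k :=
      mem_relCycles_void.2 ⟨hc.2, boundary_boundary c⟩
    rw [LinearMap.mem_ker, connecting_relClass hc hc', relClass_eq_zero_iff,
      mem_relBoundaries_void] at hz
    obtain ⟨e, he, hb⟩ := hz
    obtain ⟨f, hf, hfb⟩ := hX.exists_boundary_eq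
      (Submodule.sub_mem _ hc.1 (AugComplex.chains_mono hYX _ he))
      (by rw [map_sub, hb, sub_self])
    rw [Submodule.mem_bot, relClass_eq_zero_iff, mem_relBoundaries]
    exact ⟨f, hf, e, he, by rw [hfb, sub_add_cancel]⟩
  · intro y
    obtain ⟨c, hc, rfl⟩ := relClass_surjective y
    rw [mem_relCycles_void] at hc
    obtain ⟨f, hf, hfb⟩ := hX.exists_boundary_eq (AugComplex.chains_mono hYX _ hc.1) hc.2
    have hf' : f ∈ relCycles X Y (k + 1) := mem_relCycles.2 ⟨hf, by rw [hfb]; exact hc.1⟩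
    refine ⟨relClass f hf', ?_⟩
    · rw [connecting_relClass _ (by rw [hfb]; exact mem_relCycles_void.2 hc)]
      exact relClass_congr hfb _ _

end Homology

/-! ### Complexes of lines and complexes of flags -/

section LinesFlags

variable {K V : Type*} [Field K] [AddCommGroup V] [Module K V]

/-- The complex of sets of lines whose span belongs to `P`. -/
def lineComplex (P : Set (Submodule K V)) (hP : IsLowerSet P) : AugComplex (Submodule K V) where
  IsFace σ := (∀ L ∈ σ, Module.finrank K L = 1) ∧ sSup σ ∈ P
  down_closed _ _ hτ h := ⟨fun L hL => h.1 L (hτ hL), hP (sSup_le_sSup hτ) h.2⟩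

/-- The complex of flags of non-zero members of `P`. -/
def flagComplex (P : Set (Submodule K V)) : AugComplex (Submodule K V) where
  IsFace σ := (∀ U ∈ σ, U ≠ ⊥ ∧ U ∈ P) ∧ IsChain (· ≤ ·) σ
  down_closed _ _ hτ h := ⟨fun U hU => h.1 U (hτ hU), h.2.mono hτ⟩

/-- Sets of lines of `W`. -/
abbrev linesLe (W : Submodule K V) : AugComplex (Submodule K V) :=
  lineComplex (Set.Iic W) (isLowerSet_Iic W)

/-- Sets of lines of `W` that do not span `W`. -/
abbrev linesLt (W : Submodule K V) : AugComplex (Submodule K V) :=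
  lineComplex (Set.Iio W) (isLowerSet_Iio W)

theorem ne_bot_of_finrank_eq_one {L : Submodule K V} (h : Module.finrank K L = 1) : L ≠ ⊥ := by
  rintro rfl
  simp at h

theorem exists_line_le {U : Submodule K V} (h : U ≠ ⊥) : ∃ L ≤ U, Module.finrank K L = 1 := by
  obtain ⟨x, hx, hx0⟩ := Submodule.exists_mem_ne_zero_of_ne_bot h
  exact ⟨Submodule.span K {x}, (Submodule.span_singleton_le_iff_mem x U).2 hx,
    finrank_span_singleton hx0⟩

open scoped Classical in
/-- A line contained in `U` (if `U ≠ 0`). -/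
def lineIn (U : Submodule K V) : Submodule K V :=
  if h : U ≠ ⊥ then (exists_line_le h).choose else ⊥

theorem lineIn_le (U : Submodule K V) : lineIn U ≤ U := by
  unfold lineIn
  split_ifs with h
  · exact (exists_line_le h).choose_spec.1
  · exact bot_le

theorem finrank_lineIn {U : Submodule K V} (h : U ≠ ⊥) : Module.finrank K (lineIn U) = 1 := by
  unfold lineIn
  rw [dif_pos h]
  exact (exists_line_le h).choose_spec.2

theorem lineComplex_isCone {P : Set (Submodule K V)} (hP : IsLowerSet P) {L : Submodule K V}
    (hL : Module.finrank K L = 1) (h : ∀ U ∈ P, L ⊔ U ∈ P) : (lineComplex P hP).IsCone L := by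
  rintro σ ⟨h1, h2⟩
  refine ⟨?_, ?_⟩
  · rintro L' (rfl | h')
    · exact hL
    · exact h1 _ h'
  · rw [sSup_insert]
    exact h _ h2

theorem flagComplex_Iic_isCone {W : Submodule K V} (hW : W ≠ ⊥) :
    (flagComplex (Set.Iic W)).IsCone W := by
  rintro σ ⟨h1, h2⟩
  refine ⟨?_, h2.insert fun b hb _ => Or.inr (h1 b hb).2⟩
  rintro U (rfl | h')
  · exact ⟨hW, le_refl U⟩
  · exact h1 _ h'

theorem beta_mem_flagComplex {P : Set (Submodule K V)} (hP : IsLowerSet P) {k : ℕ}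
    {c : Chains (Submodule K V)} (hc : c ∈ (lineComplex P hP).chains k) :
    beta c ∈ (flagComplex P).chains k := by
  refine beta_mem_chains (X := lineComplex P hP) (Y := flagComplex P)
    (fun σ hσ τ hτ => ⟨fun U hU => ?_, hτ.2⟩) hc
  obtain ⟨t, ht, ⟨L, hL⟩, rfl⟩ := hτ.1 U hU
  refine ⟨fun h => ?_, hP (sSup_le_sSup ht) hσ.2⟩
  exact ne_bot_of_finrank_eq_one (hσ.1 L (ht hL)) (eq_bot_iff.2 ((le_sSup hL).trans h.le))

theorem linesLt_le_linesLe (W : Submodule K V) (σ : Set (Submodule K V))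
    (h : (linesLt W).IsFace σ) : (linesLe W).IsFace σ :=
  ⟨h.1, le_of_lt (b := W) h.2⟩

theorem linesLe_isCone {W : Submodule K V} (hW : W ≠ ⊥) : (linesLe W).IsCone (lineIn W) :=
  lineComplex_isCone _ (finrank_lineIn hW) fun U (hU : U ≤ W) =>
    show _ ≤ W from sup_le (lineIn_le W) hU

theorem neg_beta_boundary_mem {W : Submodule K V} {k : ℕ} {a : Chains (Submodule K V)}
    (ha : a ∈ relCycles (linesLe W) (linesLt W) (k + 1)) :
    -beta (boundary a) ∈ relCycles (titsBuilding W) (AugComplex.void _) k := by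
  refine Submodule.neg_mem _
    (mem_relCycles_void.2 ⟨beta_mem_flagComplex (isLowerSet_Iio W) ha.2, ?_⟩)
  rw [boundary_beta, boundary_boundary, map_zero]

theorem chainMap_one {S S' : Type*} (f : S → S') : chainMap f (1 : Chains S) = 1 := by
  rw [← simplex_nil, chainMap_simplex, List.map_nil, simplex_nil]

section

variable (ω : LinearMap.BilinForm K V)

/-- The totally isotropic subspaces of `W`. -/
def isotropicIn (W : Submodule K V) : Set (Submodule K V) :=
  {U | U ≤ W ∧ ∀ x ∈ U, ∀ y ∈ U, ω x y = 0}

theorem isLowerSet_isotropicIn (W : Submodule K V) : IsLowerSet (isotropicIn ω W) :=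
  fun _ _ h hU => ⟨h.trans hU.1, fun x hx y hy => hU.2 x (h hx) y (h hy)⟩

/-- Sets of lines of `W` with isotropic span. -/
abbrev isoLines (W : Submodule K V) : AugComplex (Submodule K V) :=
  lineComplex (isotropicIn ω W) (isLowerSet_isotropicIn ω W)

theorem bot_mem_isotropicIn (W : Submodule K V) : ⊥ ∈ isotropicIn ω W :=
  ⟨bot_le, fun x hx y _ => by rw [(Submodule.mem_bot K).1 hx, map_zero, LinearMap.zero_apply]⟩

theorem beta_mem_sympTits {W : Submodule K V} {k : ℕ} {b : Chains (Submodule K V)}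
    (hb : b ∈ relCycles (isoLines ω W) (AugComplex.void _) k) :
    beta b ∈ relCycles (sympTitsBuilding ω W) (AugComplex.void _) k := by
  rw [mem_relCycles_void] at hb
  refine mem_relCycles_void.2 ⟨beta_mem_flagComplex (isLowerSet_isotropicIn ω W) hb.1, ?_⟩
  rw [boundary_beta, hb.2, map_zero]

end

variable [FiniteDimensional K V]

theorem sSup_mem_of_isChain {σ : Set (Submodule K V)} (hσ : IsChain (· ≤ ·) σ)
    (hne : σ.Nonempty) : sSup σ ∈ σ := by
  obtain ⟨m, hm, hmax⟩ := (wellFounded_gt (α := Submodule K V)).has_min σ hne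
  have : sSup σ = m := le_antisymm (sSup_le fun U hU => by
    rcases hσ.total hU hm with h | h
    · exact h
    · exact (h.eq_or_lt.resolve_right (hmax U hU)).ge) (le_sSup hm)
  rwa [this]

theorem isSimplicial_lineIn {P : Set (Submodule K V)} (hP : IsLowerSet P) (h0 : ⊥ ∈ P) :
    IsSimplicial lineIn (flagComplex P) (lineComplex P hP) := by
  rintro σ ⟨h1, h2⟩
  refine ⟨?_, ?_⟩
  · rintro _ ⟨U, hU, rfl⟩
    exact finrank_lineIn (h1 U hU).1
  · rcases σ.eq_empty_or_nonempty with rfl | hne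
    · simpa using h0
    · refine hP ?_ (h1 _ (sSup_mem_of_isChain h2 hne)).2
      refine sSup_le ?_
      rintro _ ⟨U, hU, rfl⟩
      exact (lineIn_le U).trans (le_sSup hU)

/-- Cycles of a complex of lines are homologous to the cycles obtained by subdividing and then
choosing lines. -/
theorem exists_boundary_eq_lineIn_beta_sub {P : Set (Submodule K V)} (hP : IsLowerSet P) {k : ℕ}
    {c : Chains (Submodule K V)} (hc : c ∈ (lineComplex P hP).chains k) (hb : boundary c = 0) :
    ∃ e ∈ (lineComplex P hP).chains (k + 1), boundary e = chainMap lineIn (beta c) - c := by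
  refine exists_boundary_eq_of_carrier (X := lineComplex P hP) (Y := lineComplex P hP)
    (chainMap lineIn ∘ₗ beta - LinearMap.id) (fun c => ?_) ?_
    (fun s => linesLe (sSup (s : Set (Submodule K V))))
    (fun s => lineIn (sSup (s : Set (Submodule K V)))) ?_ ?_ ?_ ?_ hc hb
  · simp only [LinearMap.sub_apply, LinearMap.comp_apply, LinearMap.id_apply, map_sub,
      ← chainMap_boundary, boundary_beta]
  · simp [beta_one, chainMap_one]
  · exact fun s t hst σ hσ => ⟨hσ.1, hσ.2.trans (sSup_le_sSup (Finset.coe_subset.2 hst))⟩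
  · intro s hs hX
    obtain ⟨L, hL⟩ := hs
    refine lineComplex_isCone _ (finrank_lineIn fun h => ?_)
      fun U (hU : U ≤ _) => show _ ≤ _ from sup_le (lineIn_le _) hU
    exact ne_bot_of_finrank_eq_one (hX.1 L hL) (eq_bot_iff.2 ((le_sSup hL).trans h.le))
  · intro l hl
    have h : simplex l ∈ (linesLe (sSup (l.toFinset : Set (Submodule K V)))).chains l.length :=
      AugComplex.simplex_mem_chains rfl ⟨hl.1, by simp⟩
    have h' := chainMap_mem_chains (isSimplicial_lineIn (isLowerSet_Iic _)
      (Set.mem_Iic.2 bot_le))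
      (beta_mem_flagComplex _ h)
    exact Submodule.sub_mem _ h' h
  · exact fun s hs σ hσ => ⟨hσ.1, hP hσ.2 hs.2⟩

/-- Cycles of a complex of flags are homologous to the cycles obtained by choosing lines and
subdividing. -/
theorem exists_boundary_eq_beta_lineIn_sub {P : Set (Submodule K V)} (hP : IsLowerSet P) {k : ℕ}
    {c : Chains (Submodule K V)} (hc : c ∈ (flagComplex P).chains k) (hb : boundary c = 0) :
    ∃ e ∈ (flagComplex P).chains (k + 1), boundary e = beta (chainMap lineIn c) - c := by
  refine exists_boundary_eq_of_carrier (X := flagComplex P) (Y := flagComplex P)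
    (beta ∘ₗ chainMap lineIn - LinearMap.id) (fun c => ?_) ?_
    (fun s => flagComplex (Set.Iic (sSup (s : Set (Submodule K V)))))
    (fun s => sSup (s : Set (Submodule K V))) ?_ ?_ ?_ ?_ hc hb
  · simp only [LinearMap.sub_apply, LinearMap.comp_apply, LinearMap.id_apply, map_sub,
      chainMap_boundary, boundary_beta]
  · simp [beta_one, chainMap_one]
  · exact fun s t hst σ hσ => ⟨fun U hU => ⟨(hσ.1 U hU).1,
      (hσ.1 U hU).2.trans (sSup_le_sSup (Finset.coe_subset.2 hst))⟩, hσ.2⟩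
  · intro s hs hX
    obtain ⟨L, hL⟩ := hs
    refine flagComplex_Iic_isCone fun h => ?_
    exact (hX.1 L hL).1 (eq_bot_iff.2 ((le_sSup hL).trans h.le))
  · intro l hl
    have h : simplex l ∈
        (flagComplex (Set.Iic (sSup (l.toFinset : Set (Submodule K V))))).chains l.length :=
      AugComplex.simplex_mem_chains rfl ⟨fun U hU => ⟨(hl.1 U hU).1,
        le_sSup (List.mem_toFinset.2 hU)⟩, hl.2⟩
    have h' := beta_mem_flagComplex (isLowerSet_Iic _)
      (chainMap_mem_chains (isSimplicial_lineIn (isLowerSet_Iic _)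
      (Set.mem_Iic.2 bot_le)) h)
    exact Submodule.sub_mem _ h' h
  · intro s hs σ hσ
    refine ⟨fun U hU => ⟨(hσ.1 U hU).1, ?_⟩, hσ.2⟩
    rcases s.eq_empty_or_nonempty with rfl | hne
    · have h := (hσ.1 U hU).2
      rw [Finset.coe_empty, sSup_empty, Set.mem_Iic, le_bot_iff] at h
      exact ((hσ.1 U hU).1 h).elim
    · exact hP (hσ.1 U hU).2 (hs.1 _ (sSup_mem_of_isChain hs.2 hne)).2

/-- The map `H̃(lines) → H̃(flags)` induced by subdivision. -/
def betaHom (P : Set (Submodule K V)) (hP : IsLowerSet P) (k : ℕ) :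
    RedHomology (lineComplex P hP) k →ₗ[ℤ] RedHomology (flagComplex P) k :=
  homologyMapOfChain beta boundary_beta (fun _ _ hc => beta_mem_flagComplex hP hc)
    (fun _ _ hc => by
      rw [AugComplex.void_chains] at hc ⊢
      rw [(Submodule.mem_bot ℤ).1 hc, map_zero]
      exact Submodule.zero_mem _) k

/-- Complexes of lines and of flags have the same homology: the inverse of the subdivision map is
induced by choosing a line in each subspace. -/
theorem betaHom_bijective {P : Set (Submodule K V)} (hP : IsLowerSet P) (h0 : ⊥ ∈ P) (k : ℕ) :
    Function.Bijective (betaHom P hP k) := by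
  constructor
  · rw [← LinearMap.ker_eq_bot, eq_bot_iff]
    intro z hz
    obtain ⟨c, hc, rfl⟩ := relClass_surjective z
    have hc' := mem_relCycles_void.1 hc
    have h1 : relClass (beta c) (mem_relCycles_void.2 ⟨beta_mem_flagComplex hP hc'.1, by
        rw [boundary_beta, hc'.2, map_zero]⟩) = (0 : RedHomology (flagComplex P) k) := hz
    rw [relClass_eq_zero_iff, mem_relBoundaries_void] at h1
    obtain ⟨e, he, hb⟩ := h1
    obtain ⟨e', he', hb'⟩ := exists_boundary_eq_lineIn_beta_sub hP hc'.1 hc'.2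
    rw [Submodule.mem_bot, relClass_eq_zero_iff, mem_relBoundaries_void]
    refine ⟨chainMap lineIn e - e', Submodule.sub_mem _
      (chainMap_mem_chains (isSimplicial_lineIn hP h0) he) he', ?_⟩
    rw [map_sub, ← chainMap_boundary, hb, hb', sub_sub_cancel]
  · intro y
    obtain ⟨c, hc, rfl⟩ := relClass_surjective y
    have hc' := mem_relCycles_void.1 hc
    have h1 : chainMap lineIn c ∈ relCycles (lineComplex P hP) (AugComplex.void _) k :=
      mem_relCycles_void.2 ⟨chainMap_mem_chains (isSimplicial_lineIn hP h0) hc'.1, by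
        rw [← chainMap_boundary, hc'.2, map_zero]⟩
    refine ⟨relClass _ h1, ?_⟩
    refine (relClass_eq_iff (k := k) (X := flagComplex P) (mem_relCycles_void.2
      ⟨beta_mem_flagComplex hP (mem_relCycles_void.1 h1).1, ?_⟩) hc).2 ?_
    · rw [boundary_beta, (mem_relCycles_void.1 h1).2, map_zero]
    · exact mem_relBoundaries_void.2 (exists_boundary_eq_beta_lineIn_sub hP hc'.1 hc'.2)

/-- A flag of non-zero subspaces has at most as many members as the dimension of the largest. -/
theorem flagComplex_chains_eq_bot {P : Set (Submodule K V)} {d k : ℕ}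
    (hP : ∀ U ∈ P, Module.finrank K U ≤ d) (hk : d < k) : (flagComplex P).chains k = ⊥ := by
  classical
  refine AugComplex.chains_eq_bot fun l hn hl hX => ?_
  have hinj : Set.InjOn (fun U : Submodule K V => Module.finrank K U) (l.toFinset : Set _) := by
    intro U hU U' hU' h
    rw [List.coe_toFinset] at hU hU'
    rcases hX.2.total hU hU' with h' | h'
    · exact Submodule.eq_of_le_of_finrank_eq h' h
    · exact (Submodule.eq_of_le_of_finrank_eq h' h.symm).symm
  have hmaps : Set.MapsTo (fun U : Submodule K V => Module.finrank K U) (l.toFinset : Set _)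
      (Finset.Icc 1 d : Set ℕ) := by
    intro U hU
    rw [List.coe_toFinset] at hU
    rw [Finset.coe_Icc]
    refine ⟨Nat.one_le_iff_ne_zero.2 fun h => ?_, hP U (hX.1 U hU).2⟩
    exact (hX.1 U hU).1 (Submodule.finrank_eq_zero.1 h)
  have := Finset.card_le_card_of_injOn _ hmaps hinj
  rw [List.toFinset_card_of_nodup hn, hl, Nat.card_Icc] at this
  omega

/-- Above the maximal dimension of the members of `P`, the complex of lines has no homology. -/
theorem lineComplex_exists_boundary_eq {P : Set (Submodule K V)} (hP : IsLowerSet P) {d k : ℕ}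
    (hd : ∀ U ∈ P, Module.finrank K U ≤ d) (hk : d < k)
    {c : Chains (Submodule K V)} (hc : c ∈ (lineComplex P hP).chains k) (hb : boundary c = 0) :
    ∃ e ∈ (lineComplex P hP).chains (k + 1), boundary e = c := by
  obtain ⟨e, he, h⟩ := exists_boundary_eq_lineIn_beta_sub hP hc hb
  have h0 : beta c = 0 := by
    have := beta_mem_flagComplex hP hc
    rwa [flagComplex_chains_eq_bot hd hk, Submodule.mem_bot] at this
  refine ⟨-e, Submodule.neg_mem _ he, ?_⟩
  rw [map_neg, h, h0, map_zero, zero_sub, neg_neg]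

/-! ### The Steinberg modules in terms of lines -/

/-- `St(W)` in terms of lines: it is the homology of the pair consisting of the complex of all sets
of lines of `W` and the subcomplex of the sets that do not span `W`. The sign is the one for which
a basis of an even-dimensional space, as a set of lines, gives the apartment class
(`apartmentClass_eq`). -/
def steinbergIso (W : Submodule K V) (hW : W ≠ ⊥) :
    RelHomology (linesLe W) (linesLt W) (Module.finrank K W - 1 + 1) ≃ₗ[ℤ] Steinberg W :=
  LinearEquiv.ofBijective
    (-(betaHom (Set.Iio W) (isLowerSet_Iio W) (Module.finrank K W - 1) ∘ₗ
      connecting (linesLe W) (linesLt W) (AugComplex.void _) (Module.finrank K W - 1)))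
    (by
      have h := (betaHom_bijective (isLowerSet_Iio W) (bot_lt_iff_ne_bot.2 hW)
        (Module.finrank K W - 1)).comp (connecting_bijective_of_isCone
          (k := Module.finrank K W - 1) (linesLe_isCone hW) (linesLt_le_linesLe W))
      exact (Equiv.neg _).bijective.comp h)

theorem steinbergIso_relClass {W : Submodule K V} (hW : W ≠ ⊥) {a : Chains (Submodule K V)}
    (ha : a ∈ relCycles (linesLe W) (linesLt W) (Module.finrank K W - 1 + 1)) :
    steinbergIso W hW (relClass a ha) =
      relClass (-beta (boundary a)) (neg_beta_boundary_mem ha) := rfl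

variable (ω : LinearMap.BilinForm K V)

/-- `St^ω(W)` in terms of lines: it is the homology of the complex of the sets of lines of `W` with
isotropic span. -/
def sympSteinbergIso (W : Submodule K V) :
    RedHomology (isoLines ω W) (Module.finrank K W / 2) ≃ₗ[ℤ] SympSteinberg ω W :=
  LinearEquiv.ofBijective (betaHom (isotropicIn ω W) (isLowerSet_isotropicIn ω W) _)
    (betaHom_bijective _ (bot_mem_isotropicIn ω W) _)

theorem sympSteinbergIso_relClass {W : Submodule K V} {b : Chains (Submodule K V)}
    (hb : b ∈ relCycles (isoLines ω W) (AugComplex.void _) (Module.finrank K W / 2)) :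
    sympSteinbergIso ω W (relClass b hb) = relClass (beta b) (beta_mem_sympTits ω hb) := rfl

end LinesFlags

/-! ### Radicals and the genus -/

section Genus

variable {K V : Type*} [Field K] [AddCommGroup V] [Module K V]

/-- The radical of the restriction of `ω` to `U`. -/
def rad (ω : LinearMap.BilinForm K V) (U : Submodule K V) : Submodule K V := U ⊓ ω.orthogonal U

variable {ω : LinearMap.BilinForm K V}

theorem rad_le (U : Submodule K V) : rad ω U ≤ U := inf_le_left

theorem le_orthogonal_comm (hω : ω.IsAlt) {U U' : Submodule K V} :
    U ≤ ω.orthogonal U' ↔ U' ≤ ω.orthogonal U :=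
  ⟨fun h x hx _ hy => hω.eq_iff.1 (h hy x hx), fun h x hx _ hy => hω.eq_iff.1 (h hy x hx)⟩

theorem restrict_nondegenerate_iff_rad (hω : ω.IsAlt) {U : Submodule K V} :
    (ω.restrict U).Nondegenerate ↔ rad ω U = ⊥ := by
  constructor
  · intro h
    rw [eq_bot_iff]
    intro x hx
    have h0 : (⟨x, hx.1⟩ : U) = 0 := h.2 _ fun y => hx.2 y y.2
    exact congrArg Subtype.val h0
  · intro h
    refine ω.nondegenerate_restrict_of_disjoint_orthogonal hω.isRefl ?_
    exact disjoint_iff.2 h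

theorem ker_restrict_map (hω : ω.IsAlt) (U : Submodule K V) :
    (LinearMap.ker (ω.restrict U)).map U.subtype = rad ω U := by
  refine le_antisymm ?_ (LinearMap.BilinForm.inf_orthogonal_self_le_ker_restrict hω.isRefl)
  rintro _ ⟨x, hx, rfl⟩
  exact ⟨x.2, fun y hy => hω.eq_iff.1 (LinearMap.congr_fun (LinearMap.mem_ker.1 hx) ⟨y, hy⟩)⟩

theorem rad_sup_eq (hω : ω.IsAlt) {U R : Submodule K V} (hUR : R ≤ ω.orthogonal U)
    (hR : R ≤ ω.orthogonal R) : rad ω (U ⊔ R) = rad ω U ⊔ R := by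
  have hRr : R ≤ rad ω (U ⊔ R) := by
    refine le_inf le_sup_right ?_
    rw [le_orthogonal_comm hω]
    exact sup_le ((le_orthogonal_comm hω).1 hUR) hR
  refine le_antisymm (fun z hz => ?_) (sup_le ?_ hRr)
  · obtain ⟨u, hu, r, hr, rfl⟩ := Submodule.mem_sup.1 hz.1
    refine Submodule.add_mem_sup ⟨hu, fun y hy => ?_⟩ hr
    have h1 : ω y (u + r) = 0 := hz.2 y (Submodule.mem_sup_left hy)
    have h2 : ω y r = 0 := hUR hr y hy
    rw [map_add, h2, add_zero] at h1
    exact h1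
  · refine le_inf ((rad_le U).trans le_sup_left) ?_
    rw [le_orthogonal_comm hω]
    exact sup_le ((le_orthogonal_comm hω).1 inf_le_right)
      (hUR.trans (LinearMap.BilinForm.orthogonal_le (rad_le U)))

theorem rad_top (hnd : ω.Nondegenerate) : rad ω ⊤ = ⊥ := by
  rw [rad, LinearMap.BilinForm.orthogonal_top_eq_bot hnd, inf_bot_eq]

variable [FiniteDimensional K V]

theorem finrank_range_restrict_add (hω : ω.IsAlt) (U : Submodule K V) :
    Module.finrank K (LinearMap.range (ω.restrict U)) + Module.finrank K (rad ω U) =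
      Module.finrank K U := by
  rw [← ker_restrict_map hω, Submodule.finrank_map_subtype_eq,
    LinearMap.finrank_range_add_finrank_ker]

/-- A symplectic subspace `W` of `E` splits off orthogonally. -/
theorem finrank_sup_of_rad_eq_bot (hω : ω.IsAlt) {W E : Submodule K V} (hW : rad ω W = ⊥)
    (hWE : W ≤ E) :
    W ⊔ (E ⊓ ω.orthogonal W) = E ∧
      Module.finrank K W + Module.finrank K ↥(E ⊓ ω.orthogonal W) = Module.finrank K E := by
  have hc : IsCompl W (ω.orthogonal W) :=
    LinearMap.BilinForm.isCompl_orthogonal_of_restrict_nondegenerate hω.isRefl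
      ((restrict_nondegenerate_iff_rad hω).2 hW)
  have h1 : W ⊔ (E ⊓ ω.orthogonal W) = E := by
    rw [inf_comm, ← sup_inf_assoc_of_le _ hWE, hc.sup_eq_top, top_inf_eq]
  refine ⟨h1, ?_⟩
  have h2 := Submodule.finrank_sup_add_finrank_inf_eq W (E ⊓ ω.orthogonal W)
  rw [h1, inf_left_comm, hc.inf_eq_bot, inf_bot_eq, finrank_bot, add_zero] at h2
  exact h2.symm

theorem rad_inf_orthogonal (hω : ω.IsAlt) {W E : Submodule K V} (hW : rad ω W = ⊥)
    (hWE : W ≤ E) : rad ω (E ⊓ ω.orthogonal W) ≤ rad ω E := by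
  rintro x ⟨hx, hx'⟩
  refine ⟨hx.1, ?_⟩
  rw [← (finrank_sup_of_rad_eq_bot hω hW hWE).1]
  intro y hy
  obtain ⟨w, hw, z, hz, rfl⟩ := Submodule.mem_sup.1 hy
  change ω (w + z) x = 0
  rw [map_add, LinearMap.add_apply, hx.2 w hw, hx' z hz, add_zero]

/-- The rank of an alternating form is even. -/
theorem exists_finrank_eq_rad_add (hω : ω.IsAlt) (U : Submodule K V) :
    ∃ g, Module.finrank K U = Module.finrank K (rad ω U) + 2 * g := by
  induction hd : Module.finrank K U using Nat.strong_induction_on generalizing U with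
  | _ d ih =>
    by_cases h : ∀ x ∈ U, ∀ y ∈ U, ω y x = 0
    · refine ⟨0, ?_⟩
      have : rad ω U = U := inf_eq_left.2 h
      rw [this, hd, mul_zero, add_zero]
    · push Not at h
      obtain ⟨x, hx, y, hy, hxy⟩ := h
      -- split off the hyperbolic plane spanned by `x` and `y`
      have hrange : Set.range ![x, y] = {x, y} := by simp [Set.pair_comm]
      have hli : LinearIndependent K ![x, y] := by
        rw [LinearIndependent.pair_iff]
        intro s t hst
        have h1 := congrArg (ω y) hst
        have h2 := congrArg (fun z => ω z x) hst
        simp only [map_add, map_smul, smul_eq_mul, map_zero, LinearMap.add_apply,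
          LinearMap.smul_apply, LinearMap.zero_apply, hω.self_eq_zero, mul_zero, add_zero,
          zero_add] at h1 h2
        exact ⟨(mul_eq_zero.1 h1).resolve_right hxy, (mul_eq_zero.1 h2).resolve_right hxy⟩
      have hP2 : Module.finrank K (Submodule.span K {x, y}) = 2 := by
        have := finrank_span_eq_card hli
        rwa [hrange, Fintype.card_fin] at this
      have hP : rad ω (Submodule.span K {x, y}) = ⊥ := by
        rw [eq_bot_iff]
        rintro z ⟨hz, hz'⟩
        obtain ⟨s, t, rfl⟩ := Submodule.mem_span_pair.1 hz
        have h1 : ω x (s • x + t • y) = 0 := hz' x (Submodule.subset_span (by simp))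
        have h2 : ω y (s • x + t • y) = 0 := hz' y (Submodule.subset_span (by simp))
        have hyx : ω x y ≠ 0 := fun h => hxy (hω.eq_iff.1 h)
        simp only [map_add, map_smul, smul_eq_mul, hω.self_eq_zero, mul_zero, add_zero,
          zero_add] at h1 h2
        rw [(mul_eq_zero.1 h1).resolve_right hyx, (mul_eq_zero.1 h2).resolve_right hxy]
        simp
      have hle : Submodule.span K {x, y} ≤ U := by
        rw [Submodule.span_le]
        rintro z (rfl | rfl)
        · exact hx
        · exact hy
      have hdim := (finrank_sup_of_rad_eq_bot hω hP hle).2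
      obtain ⟨g, hg⟩ := ih _ (by omega) (U ⊓ ω.orthogonal (Submodule.span K {x, y})) rfl
      have hrad : rad ω (U ⊓ ω.orthogonal (Submodule.span K {x, y})) = rad ω U := by
        refine le_antisymm (rad_inf_orthogonal hω hP hle) ?_
        rintro z ⟨hz, hz'⟩
        exact ⟨⟨hz, fun w hw => hz' w (hle hw)⟩, fun w hw => hz' w hw.1⟩
      rw [hrad] at hg
      exact ⟨g + 1, by omega⟩

theorem finrank_eq_rad_add_genus (hω : ω.IsAlt) (U : Submodule K V) :
    Module.finrank K U = Module.finrank K (rad ω U) + 2 * genus ω U := by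
  obtain ⟨g, hg⟩ := exists_finrank_eq_rad_add hω U
  have h := finrank_range_restrict_add hω U
  have : genus ω U = g := by
    unfold genus
    omega
  rw [this, hg]

theorem isotropic_iff_genus (hω : ω.IsAlt) {U : Submodule K V} :
    (∀ x ∈ U, ∀ y ∈ U, ω x y = 0) ↔ genus ω U < 1 := by
  have h := finrank_eq_rad_add_genus hω U
  constructor
  · intro h'
    have : rad ω U = U := inf_eq_left.2 fun x hx y hy => h' y hy x hx
    rw [this] at h
    omega
  · intro h' x hx y hy
    have h1 : rad ω U = U := Submodule.eq_of_le_of_finrank_eq (rad_le U) (by omega)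
    rw [← h1] at hy
    exact hy.2 x hx

theorem finrank_eq_of_rad_eq_bot (hω : ω.IsAlt) {W : Submodule K V} (hW : rad ω W = ⊥) :
    Module.finrank K W = 2 * genus ω W := by
  rw [finrank_eq_rad_add_genus hω, hW, finrank_bot, zero_add]

theorem genus_lt_of_lt (hω : ω.IsAlt) {U W : Submodule K V} (hW : rad ω W = ⊥) (h : U < W) :
    genus ω U < genus ω W := by
  have h1 := finrank_eq_of_rad_eq_bot hω hW
  have h2 := finrank_eq_rad_add_genus hω U
  have h3 := Submodule.finrank_lt_finrank_of_lt h
  omega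

/-- Enlarging `U` by an isotropic subspace orthogonal to it does not change the genus. -/
theorem genus_sup_eq (hω : ω.IsAlt) {U R : Submodule K V} (hUR : R ≤ ω.orthogonal U)
    (hR : R ≤ ω.orthogonal R) : genus ω (U ⊔ R) = genus ω U := by
  have h1 := finrank_eq_rad_add_genus hω U
  have h2 := finrank_eq_rad_add_genus hω (U ⊔ R)
  have h3 := Submodule.finrank_sup_add_finrank_inf_eq U R
  have h4 := Submodule.finrank_sup_add_finrank_inf_eq (rad ω U) R
  have h5 : rad ω U ⊓ R = U ⊓ R := by
    rw [rad, inf_assoc, inf_eq_right.2 hUR]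
  rw [rad_sup_eq hω hUR hR] at h2
  rw [h5] at h4
  omega

/-- The radical of `U` is contained in the orthogonal complement of `U`, which bounds the dimension
of `U` in terms of its genus. -/
theorem finrank_le_add_genus (hω : ω.IsAlt) (hnd : ω.Nondegenerate) {n : ℕ}
    (hdim : Module.finrank K V = 2 * n) (U : Submodule K V) :
    Module.finrank K U ≤ n + genus ω U := by
  have h1 := finrank_eq_rad_add_genus hω U
  have h2 := LinearMap.BilinForm.finrank_orthogonal hnd U
  have h3 : Module.finrank K (rad ω U) ≤ Module.finrank K (ω.orthogonal U) :=
    Submodule.finrank_mono inf_le_right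
  have h4 := Submodule.finrank_le U
  omega

end Genus

/-! ### Filtering simplices of fixed genus by their lines outside the radical -/

section ChainTools

variable {S : Type*}

/-- The projection of chains to those simplices whose vertex set satisfies `Q`. -/
theorem exists_projection (Q : Set S → Prop) : ∃ π : Chains S →ₗ[ℤ] Chains S, ∀ l : List S,
    (Q {s | s ∈ l} → π (simplex l) = simplex l) ∧ (¬ Q {s | s ∈ l} → π (simplex l) = 0) := by
  classical
  obtain ⟨π, hπ⟩ := exists_linear (fun s : Finset S => if Q s then stdSimplex s else 0)
  refine ⟨π, fun l => ?_⟩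
  by_cases hn : l.Nodup
  · have h := hπ l.toFinset
    rw [List.coe_toFinset] at h
    rcases simplex_eq_stdSimplex hn with h' | h' <;> rw [h'] <;>
      refine ⟨fun hQ => ?_, fun hQ => ?_⟩ <;> simp [h, hQ]
  · simp [simplex_of_not_nodup hn]

theorem contractLeft_simplex_mul {s : S} {l : List S} (hs : s ∉ l) (d : Chains S)
    (hd : CliffordAlgebra.contractLeft (Finsupp.lapply (R := ℤ) s) d = (0 : Chains S)) :
    CliffordAlgebra.contractLeft (Finsupp.lapply (R := ℤ) s) (simplex l * d) =
      (0 : Chains S) := by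
  induction l with
  | nil => rwa [simplex_nil, one_mul]
  | cons t l ih =>
    rw [List.mem_cons, not_or] at hs
    rw [simplex_cons, mul_assoc, ExteriorAlgebra.ι, CliffordAlgebra.contractLeft_ι_mul, ih hs.2,
      mul_zero, sub_zero, Finsupp.lapply_apply, Finsupp.single_eq_of_ne hs.1, zero_smul]

/-- The join with a fixed simplex is injective on chains not involving its vertices. -/
theorem eq_zero_of_simplex_mul_eq_zero {X : AugComplex S} {k : ℕ} {d : Chains S}
    (hd : d ∈ X.chains k) {l : List S} (hn : l.Nodup) (hl : ∀ s ∈ l, ∀ σ, X.IsFace σ → s ∉ σ)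
    (h : simplex l * d = 0) : d = 0 := by
  induction l with
  | nil => rwa [simplex_nil, one_mul] at h
  | cons s l ih =>
    have h0 : CliffordAlgebra.contractLeft (Finsupp.lapply (R := ℤ) s) d = (0 : Chains S) := by
      suffices X.chains k ≤ LinearMap.ker
        (CliffordAlgebra.contractLeft (Q := (0 : QuadraticForm ℤ (S →₀ ℤ)))
          (Finsupp.lapply (R := ℤ) s)) from this hd
      refine AugComplex.chains_le fun l' _ _ hX => ?_
      have h1 := contractLeft_simplex_mul (s := s) (l := l') (hl s (by simp) _ hX) 1
        (CliffordAlgebra.contractLeft_one _ _)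
      rwa [mul_one] at h1
    have h1 := congrArg (CliffordAlgebra.contractLeft (Q := (0 : QuadraticForm ℤ (S →₀ ℤ)))
      (Finsupp.lapply (R := ℤ) s)) h
    rw [simplex_cons, mul_assoc, ExteriorAlgebra.ι, CliffordAlgebra.contractLeft_ι_mul,
      contractLeft_simplex_mul (List.nodup_cons.1 hn).1 d h0, map_zero, mul_zero, sub_zero,
      Finsupp.lapply_apply, Finsupp.single_eq_same, one_smul] at h1
    exact ih (List.nodup_cons.1 hn).2 (fun t ht => hl t (List.mem_cons_of_mem _ ht)) h1

end ChainTools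

section Stages

variable {K V : Type*} [Field K] [AddCommGroup V] [Module K V] (ω : LinearMap.BilinForm K V)

/-- The members of `σ` that are not contained in the radical of the span of `σ`. -/
def nonRad (σ : Set (Submodule K V)) : Set (Submodule K V) := {L ∈ σ | ¬ L ≤ rad ω (sSup σ)}

variable {ω} in
theorem nonRad_mono {σ τ : Set (Submodule K V)} (h : τ ⊆ σ) : nonRad ω τ ⊆ nonRad ω σ := by
  rintro L ⟨hL, hL'⟩
  exact ⟨h hL, fun h' => hL' (le_inf (le_sSup hL)
    ((h'.trans inf_le_right).trans (LinearMap.BilinForm.orthogonal_le (sSup_le_sSup h))))⟩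

/-- A set `N` of lines of `E` that spans a subspace of genus `p` and has no member in the radical
of its span. -/
structure IsCore (E : Submodule K V) (p : ℕ) (N : Set (Submodule K V)) : Prop where
  line : ∀ L ∈ N, Module.finrank K L = 1
  le : sSup N ≤ E
  genus_eq : genus ω (sSup N) = p
  not_le_rad : ∀ L ∈ N, ¬ L ≤ rad ω (sSup N)

/-- The sets `τ` of lines of `E` with isotropic span orthogonal to `N`. If `N` is a core, then the
simplices `N ∪ τ` are those of the same genus as `N` whose lines outside the radical are the
members of `N`, see `nonRad_union` and `isCore_nonRad`. -/
abbrev linkIn (E : Submodule K V) (N : Set (Submodule K V)) : AugComplex (Submodule K V) :=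
  isoLines ω (E ⊓ ω.orthogonal (sSup N))

variable {ω}

theorem linkIn_le_orthogonal {E : Submodule K V} {N τ : Set (Submodule K V)}
    (h : (linkIn ω E N).IsFace τ) : sSup τ ≤ ω.orthogonal (sSup τ) :=
  fun x hx y hy => h.2.2 y hy x hx

theorem linkIn_disjoint {E : Submodule K V} {p : ℕ} {N : Set (Submodule K V)}
    (hN : IsCore ω E p N) {L : Submodule K V} (hL : L ∈ N) {τ : Set (Submodule K V)}
    (hτ : (linkIn ω E N).IsFace τ) : L ∉ τ := by
  intro h
  exact hN.not_le_rad L hL (le_inf (le_sSup hL)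
    ((le_sSup h).trans (hτ.2.1.trans inf_le_right)))

theorem nonRad_union_subset (hω : ω.IsAlt) {E : Submodule K V} {N σ τ : Set (Submodule K V)}
    (hσ : σ ⊆ N) (hτ : (linkIn ω E N).IsFace τ) : nonRad ω (σ ∪ τ) ⊆ σ := by
  rintro L ⟨hL | hL, hL'⟩
  · exact hL
  · refine (hL' ?_).elim
    rw [sSup_union]
    refine (le_sSup hL).trans (le_inf le_sup_right ?_)
    rw [le_orthogonal_comm hω]
    refine sup_le ((le_orthogonal_comm hω).1 ((hτ.2.1.trans inf_le_right).trans
      (LinearMap.BilinForm.orthogonal_le (sSup_le_sSup hσ)))) (linkIn_le_orthogonal hτ)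

theorem nonRad_union (hω : ω.IsAlt) {E : Submodule K V} {p : ℕ} {N τ : Set (Submodule K V)}
    (hN : IsCore ω E p N) (hτ : (linkIn ω E N).IsFace τ) : nonRad ω (N ∪ τ) = N := by
  refine (nonRad_union_subset hω subset_rfl hτ).antisymm fun L hL => ⟨Or.inl hL, fun h => ?_⟩
  refine hN.not_le_rad L hL (le_inf (le_sSup hL) ((h.trans inf_le_right).trans
    (LinearMap.BilinForm.orthogonal_le (sSup_le_sSup Set.subset_union_left))))

variable [FiniteDimensional K V]

theorem genus_union_eq (hω : ω.IsAlt) {E : Submodule K V} {N σ τ : Set (Submodule K V)}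
    (hσ : σ ⊆ N) (hτ : (linkIn ω E N).IsFace τ) :
    genus ω (sSup (σ ∪ τ)) = genus ω (sSup σ) := by
  rw [sSup_union]
  exact genus_sup_eq hω ((hτ.2.1.trans inf_le_right).trans
    (LinearMap.BilinForm.orthogonal_le (sSup_le_sSup hσ))) (linkIn_le_orthogonal hτ)

/-- The lines of a simplex of genus `p` that are outside the radical of its span form a core, and the
others belong to the link of this core. -/
theorem isCore_nonRad (hω : ω.IsAlt) {E : Submodule K V} {p : ℕ} {σ : Set (Submodule K V)}
    (h1 : ∀ L ∈ σ, Module.finrank K L = 1) (h2 : sSup σ ≤ E) (h3 : genus ω (sSup σ) = p) :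
    IsCore ω E p (nonRad ω σ) ∧ (linkIn ω E (nonRad ω σ)).IsFace (σ \ nonRad ω σ) := by
  have hsub : nonRad ω σ ⊆ σ := fun L hL => hL.1
  have hrest : sSup (σ \ nonRad ω σ) ≤ rad ω (sSup σ) := by
    refine sSup_le fun L hL => ?_
    by_contra h
    exact hL.2 ⟨hL.1, h⟩
  have hleσ : ∀ {τ : Set (Submodule K V)}, τ ⊆ σ →
      sSup (σ \ nonRad ω σ) ≤ ω.orthogonal (sSup τ) := fun hτ =>
    (hrest.trans inf_le_right).trans (LinearMap.BilinForm.orthogonal_le (sSup_le_sSup hτ))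
  have hface : (linkIn ω E (nonRad ω σ)).IsFace (σ \ nonRad ω σ) := by
    refine ⟨fun L hL => h1 L hL.1, le_inf ((sSup_le_sSup Set.sdiff_subset).trans h2) (hleσ hsub),
      fun x hx y hy => hleσ Set.sdiff_subset hy x hx⟩
  refine ⟨⟨fun L hL => h1 L hL.1, (sSup_le_sSup hsub).trans h2, ?_, ?_⟩, hface⟩
  · rw [← h3, ← genus_union_eq hω subset_rfl hface, Set.union_sdiff_cancel hsub]
  · intro L hL h
    refine hL.2 (le_inf (le_sSup hL.1) ?_)
    rw [← Set.union_sdiff_cancel hsub, sSup_union, le_orthogonal_comm hω]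
    refine sup_le ((le_orthogonal_comm hω).1 (h.trans inf_le_right)) ?_
    exact (hleσ hsub).trans (LinearMap.BilinForm.orthogonal_le (le_sSup hL))

variable (ω)

/-- The sets of lines of `E` whose span has genus less than `p`. -/
def genusIn (E : Submodule K V) (p : ℕ) : AugComplex (Submodule K V) :=
  lineComplex {U | U ≤ E ∧ genus ω U < p}
    fun _ _ h hU => ⟨h.trans hU.1, (genus_mono ω h).trans_lt hU.2⟩

/-- The complex between `genusIn ω E p` and `genusIn ω E (p + 1)` in which the simplices of genus
`p` have at most `A` lines outside the radical of their span. -/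
def stage (E : Submodule K V) (p A : ℕ) : AugComplex (Submodule K V) where
  IsFace σ := (∀ L ∈ σ, Module.finrank K L = 1) ∧ sSup σ ≤ E ∧
    (genus ω (sSup σ) < p ∨ genus ω (sSup σ) = p ∧ (nonRad ω σ).encard ≤ A)
  down_closed σ τ hτ h := by
    refine ⟨fun L hL => h.1 L (hτ hL), (sSup_le_sSup hτ).trans h.2.1, ?_⟩
    have hg := genus_mono ω (sSup_le_sSup hτ)
    rcases h.2.2 with h' | ⟨h', h''⟩
    · exact Or.inl (hg.trans_lt h')
    · rcases (hg.trans h'.le).lt_or_eq with h3 | h3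
      · exact Or.inl h3
      · exact Or.inr ⟨h3, (Set.encard_le_encard (nonRad_mono hτ)).trans h''⟩

variable {ω}

theorem stage_mono {E : Submodule K V} {p A B : ℕ} (h : A ≤ B) (σ : Set (Submodule K V))
    (hσ : (stage ω E p A).IsFace σ) : (stage ω E p B).IsFace σ := by
  refine ⟨hσ.1, hσ.2.1, hσ.2.2.imp_right fun h' => ⟨h'.1, h'.2.trans ?_⟩⟩
  exact_mod_cast h

theorem stage_le_genusIn {E : Submodule K V} {p A : ℕ} (σ : Set (Submodule K V))
    (hσ : (stage ω E p A).IsFace σ) : (genusIn ω E (p + 1)).IsFace σ :=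
  ⟨hσ.1, hσ.2.1, by
    rcases hσ.2.2 with h | h <;> omega⟩

theorem genusIn_le_stage {E : Submodule K V} {p A : ℕ} (σ : Set (Submodule K V))
    (hσ : (genusIn ω E p).IsFace σ) : (stage ω E p A).IsFace σ :=
  ⟨hσ.1, hσ.2.1, Or.inl hσ.2.2⟩

theorem genusIn_chains_le_stage {E : Submodule K V} {p k : ℕ} :
    (genusIn ω E (p + 1)).chains k ≤ (stage ω E p k).chains k := by
  classical
  refine AugComplex.chains_le fun l hn hl hX => AugComplex.simplex_mem_chains hl ?_
  refine ⟨hX.1, hX.2.1, ?_⟩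
  have h2 : genus ω (sSup {s | s ∈ l}) < p + 1 := hX.2.2
  rcases (Nat.lt_succ_iff.1 h2).lt_or_eq with h3 | h3
  · exact Or.inl h3
  · refine Or.inr ⟨h3, ?_⟩
    calc (nonRad ω {s | s ∈ l}).encard ≤ ({s | s ∈ l} : Set (Submodule K V)).encard :=
          Set.encard_le_encard fun L hL => hL.1
      _ ≤ k := by
        rw [← List.coe_toFinset, Set.encard_coe_eq_coe_finsetCard,
          List.toFinset_card_of_nodup hn, hl]

theorem finrank_sSup_le (N : Finset (Submodule K V)) (h : ∀ L ∈ N, Module.finrank K L = 1) :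
    Module.finrank K ↥(sSup (N : Set (Submodule K V))) ≤ N.card := by
  classical
  induction N using Finset.induction_on with
  | empty => simp
  | insert L N hL ih =>
    rw [Finset.coe_insert, sSup_insert, Finset.card_insert_of_notMem hL]
    have h1 := Submodule.finrank_sup_add_finrank_inf_eq L (sSup (N : Set (Submodule K V)))
    have h2 := ih fun L' hL' => h L' (Finset.mem_insert_of_mem hL')
    have h3 := h L (Finset.mem_insert_self _ _)
    omega

/-- A simplex of genus `p` has at least `2 p` lines outside the radical of its span. -/
theorem stage_le_genusIn_of_lt (hω : ω.IsAlt) {E : Submodule K V} {p A : ℕ} (hA : A < 2 * p)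
    (σ : Set (Submodule K V)) (hσ : (stage ω E p A).IsFace σ) : (genusIn ω E p).IsFace σ := by
  refine ⟨hσ.1, hσ.2.1, hσ.2.2.resolve_right ?_⟩
  rintro ⟨h1, h2⟩
  have hc := (isCore_nonRad hω hσ.1 hσ.2.1 h1).1
  have hfin : (nonRad ω σ).Finite := Set.finite_of_encard_le_coe h2
  obtain ⟨N, hN⟩ := hfin.exists_finset_coe
  rw [← hN] at hc h2
  rw [Set.encard_coe_eq_coe_finsetCard, Nat.cast_le] at h2
  have h3 := finrank_sSup_le N fun L hL => hc.line L hL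
  have h4 := finrank_eq_rad_add_genus hω (sSup (N : Set (Submodule K V)))
  rw [hc.genus_eq] at h4
  omega

/-- Joins of at most `A` lines of a core with its link belong to `stage ω E p A`. -/
theorem subset_mul_mem_stage (hω : ω.IsAlt) {E : Submodule K V} {p A a b : ℕ}
    {N : Finset (Submodule K V)} (hN : IsCore ω E p N) {l : List (Submodule K V)}
    (hl : l.length = a) (hn : l.Nodup) (hlN : ∀ L ∈ l, L ∈ N) (ha : a ≤ A)
    {c : Chains (Submodule K V)} (hc : c ∈ (linkIn ω E N).chains b) :
    simplex l * c ∈ (stage ω E p A).chains (a + b) := by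
  classical
  let X : AugComplex (Submodule K V) :=
    { IsFace := fun σ => σ ⊆ {s | s ∈ l}, down_closed := fun _ _ h h' => h.trans h' }
  have hX : simplex l ∈ X.chains a := AugComplex.simplex_mem_chains hl (Set.Subset.refl _)
  refine AugComplex.mul_mem_chains (X := X) (Y := linkIn ω E N) (fun σ τ hσ hτ => ?_) hX hc
  have hσN : σ ⊆ N := fun L hL => hlN L (hσ hL)
  have hg := genus_union_eq hω hσN hτ
  refine ⟨?_, ?_, ?_⟩
  · rintro L (hL | hL)
    · exact hN.line L (hσN hL)
    · exact hτ.1 L hL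
  · rw [sSup_union]
    exact sup_le ((sSup_le_sSup hσN).trans hN.le) (hτ.2.1.trans inf_le_left)
  · have hle := (genus_mono ω (sSup_le_sSup hσN)).trans hN.genus_eq.le
    rw [← hg] at hle
    rcases hle.lt_or_eq with h | h
    · exact Or.inl h
    · refine Or.inr ⟨h, ?_⟩
      calc (nonRad ω (σ ∪ τ)).encard ≤ ({s | s ∈ l} : Set (Submodule K V)).encard :=
            Set.encard_le_encard ((nonRad_union_subset hω hσN hτ).trans hσ)
        _ ≤ A := by
          rw [← List.coe_toFinset, Set.encard_coe_eq_coe_finsetCard,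
            List.toFinset_card_of_nodup hn, hl]
          exact_mod_cast ha

theorem stdSimplex_mul_mem_stage (hω : ω.IsAlt) {E : Submodule K V} {p b : ℕ}
    {N : Finset (Submodule K V)} (hN : IsCore ω E p N)
    {c : Chains (Submodule K V)} (hc : c ∈ (linkIn ω E N).chains b) :
    stdSimplex N * c ∈ (stage ω E p N.card).chains (N.card + b) :=
  subset_mul_mem_stage hω hN (Finset.length_toList N) (Finset.nodup_toList N)
    (fun _ => Finset.mem_toList.1) le_rfl hc

theorem boundary_stdSimplex_mul_mem_stage (hω : ω.IsAlt) {E : Submodule K V} {p A b : ℕ}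
    {N : Finset (Submodule K V)} (hN : IsCore ω E p N) (hA : N.card = A + 1)
    {c : Chains (Submodule K V)} (hc : c ∈ (linkIn ω E N).chains b) :
    boundary (stdSimplex N) * c ∈ (stage ω E p A).chains (A + b) := by
  rw [stdSimplex, boundary_simplex, Finset.sum_mul]
  refine Submodule.sum_mem _ fun i hi => ?_
  rw [smul_mul_assoc]
  refine Submodule.smul_mem _ _ (subset_mul_mem_stage hω hN ?_ ?_ ?_ le_rfl hc)
  · rw [List.length_eraseIdx_of_lt (Finset.mem_range.1 hi), Finset.length_toList, hA,
      Nat.add_sub_cancel]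
  · exact (Finset.nodup_toList N).sublist (List.eraseIdx_sublist _ _)
  · exact fun L hL => Finset.mem_toList.1 (List.mem_of_mem_eraseIdx hL)

/-- The new simplices of `stage ω E p (A + 1)` are the joins of a core of cardinality `A + 1` with a
simplex of its link. -/
theorem stage_succ_chains_le (hω : ω.IsAlt) (E : Submodule K V) (p A b : ℕ) :
    (stage ω E p (A + 1)).chains (A + 1 + b) ≤ (stage ω E p A).chains (A + 1 + b) ⊔
      ⨆ N : {N : Finset (Submodule K V) // IsCore ω E p N ∧ N.card = A + 1},
        ((linkIn ω E N.1).chains b).map (LinearMap.mulLeft ℤ (stdSimplex N.1)) := by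
  classical
  refine AugComplex.chains_le fun l hn hl hX => ?_
  by_cases hA : (stage ω E p A).IsFace {s | s ∈ l}
  · exact Submodule.mem_sup_left (AugComplex.simplex_mem_chains hl hA)
  · refine Submodule.mem_sup_right ?_
    obtain ⟨hg, hle⟩ := hX.2.2.resolve_left fun h => hA ⟨hX.1, hX.2.1, Or.inl h⟩
    obtain ⟨hcore, hface⟩ := isCore_nonRad hω hX.1 hX.2.1 hg
    let N : Finset (Submodule K V) := l.toFinset.filter (· ∈ nonRad ω {s | s ∈ l})
    have hNset : (N : Set (Submodule K V)) = nonRad ω {s | s ∈ l} := by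
      ext L
      simp only [N, Finset.coe_filter, List.mem_toFinset, Set.mem_ofPred_eq]
      exact ⟨fun h => h.2, fun h => ⟨h.1, h⟩⟩
    have hcard : N.card = A + 1 := by
      rw [← hNset, Set.encard_coe_eq_coe_finsetCard, Nat.cast_le] at hle
      refine le_antisymm hle ?_
      by_contra h
      refine hA ⟨hX.1, hX.2.1, Or.inr ⟨hg, ?_⟩⟩
      rw [← hNset, Set.encard_coe_eq_coe_finsetCard, Nat.cast_le]
      omega
    have hperm : l.Perm (N.toList ++ l.filter (· ∉ N)) := by
      refine (List.perm_ext_iff_of_nodup hn ?_).2 fun L => ?_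
      · refine List.nodup_append.2 ⟨Finset.nodup_toList N, hn.filter _, ?_⟩
        rintro a ha _ hb rfl
        simp only [List.mem_filter, decide_eq_true_eq] at hb
        exact hb.2 (Finset.mem_toList.1 ha)
      · simp only [List.mem_append, Finset.mem_toList, List.mem_filter, decide_eq_true_eq]
        constructor
        · exact fun h => or_iff_not_imp_left.2 fun h' => ⟨h, h'⟩
        · rintro (h | h)
          · exact List.mem_toFinset.1 (Finset.mem_filter.1 h).1
          · exact h.1
    have hlen : (l.filter (· ∉ N)).length = b := by
      have := hperm.length_eq
      rw [List.length_append, Finset.length_toList, hcard, hl] at this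
      omega
    have hrest : {s | s ∈ l.filter (· ∉ N)} = {s | s ∈ l} \ nonRad ω {s | s ∈ l} := by
      ext L
      rw [← hNset]
      simp
    rw [← hNset] at hcore hface
    have hmem : stdSimplex N * simplex (l.filter (· ∉ N)) ∈
        ((linkIn ω E N).chains b).map (LinearMap.mulLeft ℤ (stdSimplex N)) :=
      Submodule.mem_map_of_mem (f := LinearMap.mulLeft ℤ (stdSimplex N))
        (AugComplex.simplex_mem_chains hlen (by rw [hrest, ← hNset]; exact hface))
    refine Submodule.mem_iSup_of_mem ⟨N, hcore, hcard⟩ ?_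
    have heq : simplex (N.toList ++ l.filter (· ∉ N)) =
        stdSimplex N * simplex (l.filter (· ∉ N)) := simplex_append _ _
    rcases simplex_perm hperm with h | h
    · rw [h, heq]
      exact hmem
    · rw [h, heq]
      exact Submodule.neg_mem _ hmem

/-- A cycle of `stage ω E p (A + 1)` relative to `stage ω E p A` is a sum of joins of cores `N` of
cardinality `A + 1` with cycles of their links. -/
theorem exists_core_decomposition (hω : ω.IsAlt) {E : Submodule K V} {p A b : ℕ}
    {z : Chains (Submodule K V)} (hz : z ∈ (stage ω E p (A + 1)).chains (A + 1 + b))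
    (hbz : boundary z ∈ (stage ω E p A).chains (A + b)) :
    ∃ (I : Finset {N : Finset (Submodule K V) // IsCore ω E p N ∧ N.card = A + 1})
      (c : {N : Finset (Submodule K V) // IsCore ω E p N ∧ N.card = A + 1} →
        Chains (Submodule K V)),
      (∀ N, c N ∈ (linkIn ω E N.1).chains b) ∧ (∀ N ∈ I, boundary (c N) = 0) ∧
        z - ∑ N ∈ I, stdSimplex N.1 * c N ∈ (stage ω E p A).chains (A + 1 + b) := by
  obtain ⟨y, hy, x, hx, rfl⟩ := Submodule.mem_sup.1 (stage_succ_chains_le hω E p A b hz)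
  obtain ⟨f, hf, rfl⟩ := (Submodule.mem_iSup_iff_exists_finsupp _ _).1 hx
  choose c hc hcf using hf
  simp only [LinearMap.mulLeft_apply] at hcf
  have hsum : (f.sum fun _ x => x) = ∑ N ∈ f.support, stdSimplex N.1 * c N :=
    Finset.sum_congr rfl fun N _ => (hcf N).symm
  refine ⟨f.support, c, hc, fun N hN => ?_, by rwa [hsum, add_sub_cancel_right]⟩
  have hbc : ∀ N, boundary (c N) ∈ (linkIn ω E N.1).chains (b - 1) :=
    fun N => AugComplex.boundary_mem_chains' (hc N)
  obtain ⟨π, hπ⟩ := exists_projection fun σ : Set (Submodule K V) =>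
    genus ω (sSup σ) = p ∧ nonRad ω σ = N.1
  -- the projection to the simplices with core `N` kills the lower stage
  have hπ0 : ∀ {k : ℕ} {c : Chains (Submodule K V)}, c ∈ (stage ω E p A).chains k → π c = 0 := by
    intro k c hc
    suffices (stage ω E p A).chains k ≤ LinearMap.ker π from this hc
    refine AugComplex.chains_le fun l _ _ hX => (hπ l).2 ?_
    rintro ⟨h1, h2⟩
    rcases hX.2.2 with h | ⟨-, h⟩
    · omega
    · rw [h2, Set.encard_coe_eq_coe_finsetCard, Nat.cast_le, N.2.2] at h
      omega
  have hπN : ∀ (N' : {N : Finset (Submodule K V) // IsCore ω E p N ∧ N.card = A + 1}) (k : ℕ)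
      (d : Chains (Submodule K V)), d ∈ (linkIn ω E N'.1).chains k →
      π (stdSimplex N'.1 * d) = if N' = N then stdSimplex N'.1 * d else 0 := by
    intro N' k d hd
    suffices (linkIn ω E N'.1).chains k ≤ LinearMap.eqLocus
        (π ∘ₗ LinearMap.mulLeft ℤ (stdSimplex N'.1))
        (if N' = N then LinearMap.mulLeft ℤ (stdSimplex N'.1) else 0) by
      have h := LinearMap.mem_eqLocus.1 (this hd)
      split_ifs at h ⊢ <;> exact h
    refine AugComplex.chains_le fun l _ _ hX => ?_
    have hset : {s | s ∈ N'.1.toList ++ l} = (N'.1 : Set (Submodule K V)) ∪ {s | s ∈ l} := by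
      ext
      simp
    have hh := hπ (N'.1.toList ++ l)
    rw [simplex_append, hset, nonRad_union hω N'.2.1 hX, genus_union_eq hω subset_rfl hX,
      N'.2.1.genus_eq] at hh
    rw [LinearMap.mem_eqLocus, LinearMap.comp_apply, LinearMap.mulLeft_apply]
    split_ifs with h
    · subst h
      exact hh.1 ⟨rfl, rfl⟩
    · exact hh.2 fun h' => h (Subtype.ext (Finset.coe_injective h'.2))
  have hstd : ∀ N' : {N : Finset (Submodule K V) // IsCore ω E p N ∧ N.card = A + 1},
      stdSimplex N'.1 ∈ (AugComplex.full _).chains (A + 1) := fun N' =>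
    AugComplex.simplex_mem_chains (by rw [Finset.length_toList, N'.2.2]) trivial
  have h1 := hπ0 hbz
  rw [hsum, map_add, map_add, hπ0 (AugComplex.boundary_mem_chains' hy), zero_add, map_sum,
    map_sum, Finset.sum_eq_single N] at h1
  · rw [boundary_mul (hstd N), map_add,
      hπ0 (boundary_stdSimplex_mul_mem_stage hω N.2.1 N.2.2 (hc N)), zero_add, map_smul,
      hπN N _ _ (hbc N), if_pos rfl] at h1
    have h2 : stdSimplex N.1 * boundary (c N) = 0 := by
      rcases neg_one_pow_eq_or ℤ (A + 1) with h | h <;> simpa [h] using h1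
    exact eq_zero_of_simplex_mul_eq_zero (hbc N) (Finset.nodup_toList N.1)
      (fun L hL τ hτ => linkIn_disjoint N.2.1 (Finset.mem_toList.1 hL) hτ) h2
  · intro N' _ hne
    rw [boundary_mul (hstd N'), map_add,
      hπ0 (boundary_stdSimplex_mul_mem_stage hω N'.2.1 N'.2.2 (hc N')), zero_add, map_smul,
      hπN N' _ _ (hbc N'), if_neg hne, smul_zero]
  · exact fun h => (h hN).elim

/-- If the links of all cores of cardinality `A + 1` have no homology in the relevant degree, then
relative cycles may be moved to the next lower stage. -/
theorem exists_sub_boundary_mem_stage (hω : ω.IsAlt) {E : Submodule K V} {p A b : ℕ}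
    (hlink : ∀ N : Finset (Submodule K V), IsCore ω E p N → N.card = A + 1 →
      ∀ c ∈ (linkIn ω E N).chains b, boundary c = 0 →
        ∃ e ∈ (linkIn ω E N).chains (b + 1), boundary e = c)
    {z : Chains (Submodule K V)} (hz : z ∈ (stage ω E p (A + 1)).chains (A + 1 + b))
    (hbz : boundary z ∈ (stage ω E p A).chains (A + b)) :
    ∃ w ∈ (stage ω E p (A + 1)).chains (A + 1 + b + 1),
      z - boundary w ∈ (stage ω E p A).chains (A + 1 + b) := by
  classical
  obtain ⟨I, c, hc, hbc, hzc⟩ := exists_core_decomposition hω hz hbz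
  have hex : ∀ N, ∃ e ∈ (linkIn ω E N.1).chains (b + 1), N ∈ I → boundary e = c N := by
    intro N
    by_cases hN : N ∈ I
    · obtain ⟨e, he, h⟩ := hlink N.1 N.2.1 N.2.2 _ (hc N) (hbc N hN)
      exact ⟨e, he, fun _ => h⟩
    · exact ⟨0, Submodule.zero_mem _, fun h => (hN h).elim⟩
  choose e he hbe using hex
  refine ⟨∑ N ∈ I, (-1 : ℤ) ^ (A + 1) • (stdSimplex N.1 * e N), ?_, ?_⟩
  · refine Submodule.sum_mem _ fun N _ => Submodule.smul_mem _ _ ?_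
    have := stdSimplex_mul_mem_stage hω N.2.1 (he N)
    rwa [N.2.2] at this
  · have hstd : ∀ N' : {N : Finset (Submodule K V) // IsCore ω E p N ∧ N.card = A + 1},
        stdSimplex N'.1 ∈ (AugComplex.full _).chains (A + 1) := fun N' =>
      AugComplex.simplex_mem_chains (by rw [Finset.length_toList, N'.2.2]) trivial
    have h1 : boundary (∑ N ∈ I, (-1 : ℤ) ^ (A + 1) • (stdSimplex N.1 * e N)) =
        ∑ N ∈ I, (-1 : ℤ) ^ (A + 1) • (boundary (stdSimplex N.1) * e N) +
          ∑ N ∈ I, stdSimplex N.1 * c N := by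
      rw [map_sum, ← Finset.sum_add_distrib]
      refine Finset.sum_congr rfl fun N hN => ?_
      rw [map_smul, boundary_mul (hstd N), smul_add, smul_smul, ← mul_pow, hbe N hN]
      simp
    rw [h1, sub_add_eq_sub_sub_swap]
    refine Submodule.sub_mem _ hzc (Submodule.sum_mem _ fun N _ => Submodule.smul_mem _ _ ?_)
    have := boundary_stdSimplex_mul_mem_stage hω N.2.1 N.2.2 (he N)
    convert this using 2
    omega

end Stages

/-! ### Vanishing of homology -/

section Vanishing

variable {K V : Type*} [Field K] [AddCommGroup V] [Module K V] [FiniteDimensional K V]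
  {ω : LinearMap.BilinForm K V}

/-- The link of a core `N` is a cone if the span of `N` is degenerate, and otherwise it is the
complex of isotropic sets of lines of a symplectic space of genus `m - p`. -/
theorem linkIn_exists_boundary_eq (hω : ω.IsAlt) {E : Submodule K V} {m p b : ℕ}
    (hE : rad ω E = ⊥) (hdim : Module.finrank K E = 2 * m)
    (hV : ∀ E' : Submodule K V, rad ω E' = ⊥ → Module.finrank K E' = 2 * (m - p) →
      ∀ k < m - p, ∀ c ∈ (isoLines ω E').chains k, boundary c = 0 →
        ∃ e ∈ (isoLines ω E').chains (k + 1), boundary e = c)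
    {N : Set (Submodule K V)} (hN : IsCore ω E p N) (hb : b + p < m)
    {c : Chains (Submodule K V)} (hc : c ∈ (linkIn ω E N).chains b) (hbc : boundary c = 0) :
    ∃ e ∈ (linkIn ω E N).chains (b + 1), boundary e = c := by
  by_cases h : rad ω (sSup N) = ⊥
  · refine hV _ ?_ ?_ b (by omega) c hc hbc
    · exact eq_bot_iff.2 ((rad_inf_orthogonal hω h hN.le).trans hE.le)
    · have h1 := (finrank_sup_of_rad_eq_bot hω h hN.le).2
      have h2 := finrank_eq_of_rad_eq_bot hω h
      rw [hN.genus_eq] at h2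
      omega
  · refine (lineComplex_isCone _ (finrank_lineIn h) ?_).exists_boundary_eq hc hbc
    rintro U ⟨hU1, hU2⟩
    have hx : lineIn (rad ω (sSup N)) ≤ rad ω (sSup N) := lineIn_le _
    have hxU : lineIn (rad ω (sSup N)) ≤ ω.orthogonal U :=
      (hx.trans inf_le_left).trans ((le_orthogonal_comm hω).1 (hU1.trans inf_le_right))
    refine ⟨sup_le (le_inf ((hx.trans inf_le_left).trans hN.le) (hx.trans inf_le_right)) hU1, ?_⟩
    have hiso : lineIn (rad ω (sSup N)) ⊔ U ≤
        ω.orthogonal (lineIn (rad ω (sSup N)) ⊔ U) := by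
      rw [le_orthogonal_comm hω]
      refine sup_le ?_ ?_
      · rw [le_orthogonal_comm hω]
        refine sup_le ((hx.trans inf_le_right).trans
          (LinearMap.BilinForm.orthogonal_le (hx.trans inf_le_left))) ?_
        exact (le_orthogonal_comm hω).1 hxU
      · rw [le_orthogonal_comm hω]
        exact sup_le hxU fun x hx y hy => hU2 y hy x hx
    exact fun x hx y hy => hiso hy x hx

/-- Relative cycles of `(genusIn ω E (p + 1), genusIn ω E p)` may be moved to `stage ω E p B`. -/
theorem exists_sub_boundary_mem_stage_of_le (hω : ω.IsAlt) {E : Submodule K V} {m p k B : ℕ}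
    (hE : rad ω E = ⊥) (hdim : Module.finrank K E = 2 * m)
    (hV : ∀ E' : Submodule K V, rad ω E' = ⊥ → Module.finrank K E' = 2 * (m - p) →
      ∀ k < m - p, ∀ c ∈ (isoLines ω E').chains k, boundary c = 0 →
        ∃ e ∈ (isoLines ω E').chains (k + 1), boundary e = c)
    (hk : k + p ≤ m + B) {z : Chains (Submodule K V)} (hz : z ∈ (genusIn ω E (p + 1)).chains k)
    (hbz : boundary z ∈ (genusIn ω E p).chains (k - 1)) :
    ∃ w ∈ (genusIn ω E (p + 1)).chains (k + 1), z - boundary w ∈ (stage ω E p B).chains k := by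
  have key : ∀ A, B ≤ A → A ≤ k → ∀ z ∈ (stage ω E p A).chains k,
      boundary z ∈ (genusIn ω E p).chains (k - 1) →
      ∃ w ∈ (genusIn ω E (p + 1)).chains (k + 1),
        z - boundary w ∈ (stage ω E p B).chains k := by
    intro A hA
    induction A, hA using Nat.le_induction with
    | base =>
      intro _ z hz _
      exact ⟨0, Submodule.zero_mem _, by rwa [map_zero, sub_zero]⟩
    | succ A hA ih =>
      intro hAk z hz hbz
      obtain ⟨b, rfl⟩ := Nat.exists_eq_add_of_le hAk
      have hidx : A + 1 + b - 1 = A + b := by omega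
      obtain ⟨w, hw, hzw⟩ := exists_sub_boundary_mem_stage hω
        (fun N hN _ c hc hbc => linkIn_exists_boundary_eq hω hE hdim hV hN (by omega) hc hbc) hz
        (by
          rw [hidx] at hbz
          exact AugComplex.chains_mono genusIn_le_stage _ hbz)
      obtain ⟨w', hw', hzw'⟩ := ih (by omega) _ hzw
        (by rwa [map_sub, boundary_boundary, sub_zero])
      refine ⟨w + w', Submodule.add_mem _ (AugComplex.chains_mono stage_le_genusIn _ hw) hw', ?_⟩
      rwa [map_add, ← sub_sub]
  have hz' := genusIn_chains_le_stage hz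
  rcases le_total B k with h | h
  · exact key k h le_rfl z hz' hbz
  · exact ⟨0, Submodule.zero_mem _, by
      rw [map_zero, sub_zero]
      exact AugComplex.chains_mono (stage_mono h) _ hz'⟩

/-- Below degree `m + p` there is no homology of the pair `(genusIn ω E (p + 1), genusIn ω E p)`: the
chains are moved down to the stage `2 * p - 1`, where there are no simplices of genus `p` left. -/
theorem genusIn_exists_sub_boundary_mem (hω : ω.IsAlt) {E : Submodule K V} {m p k : ℕ}
    (hE : rad ω E = ⊥) (hdim : Module.finrank K E = 2 * m)
    (hV : ∀ E' : Submodule K V, rad ω E' = ⊥ → Module.finrank K E' = 2 * (m - p) →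
      ∀ k < m - p, ∀ c ∈ (isoLines ω E').chains k, boundary c = 0 →
        ∃ e ∈ (isoLines ω E').chains (k + 1), boundary e = c)
    (hp : 1 ≤ p) (hk : k < m + p) {z : Chains (Submodule K V)}
    (hz : z ∈ (genusIn ω E (p + 1)).chains k)
    (hbz : boundary z ∈ (genusIn ω E p).chains (k - 1)) :
    ∃ w ∈ (genusIn ω E (p + 1)).chains (k + 1),
      z - boundary w ∈ (genusIn ω E p).chains k := by
  obtain ⟨w, hw, h⟩ := exists_sub_boundary_mem_stage_of_le hω hE hdim hV (B := 2 * p - 1)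
    (by omega) hz hbz
  exact ⟨w, hw, AugComplex.chains_mono (stage_le_genusIn_of_lt hω (by omega)) _ h⟩

/-- The vanishing of the homology of `genusIn ω E (p + 1)`, given that of the complexes of isotropic
lines of smaller symplectic spaces. The induction is downward on `p`: for `p = m` the complex is a
cone, and the step from `p + 1` to `p` is the vanishing of the relative homology. -/
theorem genusIn_exists_boundary_eq_aux (hω : ω.IsAlt) {E : Submodule K V} {m : ℕ}
    (hE : rad ω E = ⊥) (hdim : Module.finrank K E = 2 * m)
    (hV : ∀ p, 1 ≤ p → p ≤ m → ∀ E' : Submodule K V, rad ω E' = ⊥ →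
      Module.finrank K E' = 2 * (m - p) →
      ∀ k < m - p, ∀ c ∈ (isoLines ω E').chains k, boundary c = 0 →
        ∃ e ∈ (isoLines ω E').chains (k + 1), boundary e = c)
    {p k : ℕ} (hp : p ≤ m) (hk : k < m + p) {c : Chains (Submodule K V)}
    (hc : c ∈ (genusIn ω E (p + 1)).chains k) (hbc : boundary c = 0) :
    ∃ e ∈ (genusIn ω E (p + 1)).chains (k + 1), boundary e = c := by
  obtain ⟨j, rfl⟩ := Nat.exists_eq_add_of_le hp
  induction j generalizing p k c with
  | zero =>
    have hEne : E ≠ ⊥ := by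
      rintro rfl
      rw [finrank_bot] at hdim
      omega
    refine AugComplex.IsCone.exists_boundary_eq (x := lineIn E) ?_ hc hbc
    refine lineComplex_isCone _ (finrank_lineIn hEne) ?_
    rintro U ⟨hU, -⟩
    have hle : lineIn E ⊔ U ≤ E := sup_le (lineIn_le E) hU
    refine ⟨hle, ?_⟩
    have h1 := finrank_eq_of_rad_eq_bot hω hE
    have h2 := genus_mono ω hle
    omega
  | succ j ih =>
    have hmono : ∀ σ, (genusIn ω E (p + 1)).IsFace σ → (genusIn ω E (p + 1 + 1)).IsFace σ :=
      fun σ hσ => ⟨hσ.1, hσ.2.1, hσ.2.2.trans (Nat.lt_succ_self _)⟩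
    obtain ⟨g, hg, hgc⟩ := ih (p := p + 1) (k := k) (AugComplex.chains_mono hmono _ hc) hbc
      (by rw [hdim]; ring) (by
        intro q h1 h2
        have := hV q h1 (by omega)
        have h3 : p + 1 + j = p + (j + 1) := by omega
        rwa [h3]) (by omega) (by omega)
    obtain ⟨w, hw, h⟩ := genusIn_exists_sub_boundary_mem hω hE hdim
      (hV (p + 1) (by omega) (by omega)) (by omega) (k := k + 1) (by omega) hg
      (by rw [hgc]; exact hc)
    exact ⟨_, h, by rw [map_sub, boundary_boundary, sub_zero, hgc]⟩

theorem isoLines_iff_genusIn (hω : ω.IsAlt) {E : Submodule K V} (σ : Set (Submodule K V)) :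
    (isoLines ω E).IsFace σ ↔ (genusIn ω E 1).IsFace σ :=
  and_congr_right fun _ => and_congr_right fun _ => isotropic_iff_genus hω

theorem isoLines_chains (hω : ω.IsAlt) (E : Submodule K V) (k : ℕ) :
    (isoLines ω E).chains k = (genusIn ω E 1).chains k :=
  le_antisymm (AugComplex.chains_mono (fun σ => (isoLines_iff_genusIn hω σ).1) k)
    (AugComplex.chains_mono (fun σ => (isoLines_iff_genusIn hω σ).2) k)

/-- The complex of isotropic sets of lines of a symplectic space of genus `m` has no homology in
degrees below `m`. The proof is by induction on `m`. -/
theorem isoLines_exists_boundary_eq (hω : ω.IsAlt) (m : ℕ) : ∀ E : Submodule K V, rad ω E = ⊥ →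
    Module.finrank K E = 2 * m → ∀ k < m, ∀ c ∈ (isoLines ω E).chains k, boundary c = 0 →
      ∃ e ∈ (isoLines ω E).chains (k + 1), boundary e = c := by
  induction m using Nat.strong_induction_on with
  | _ m ih =>
    intro E hE hdim k hk c hc hbc
    rw [isoLines_chains hω] at hc ⊢
    exact genusIn_exists_boundary_eq_aux hω hE hdim (fun p h1 h2 => ih (m - p) (by omega))
      (Nat.zero_le _) (by omega) hc hbc

/-- Below degree `m + p` there is no homology in `genusIn ω E (p + 1)`, for `p ≤ m`. -/
theorem genusIn_exists_boundary_eq (hω : ω.IsAlt) {E : Submodule K V} {m : ℕ}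
    (hE : rad ω E = ⊥) (hdim : Module.finrank K E = 2 * m)
    {p k : ℕ} (hp : p ≤ m) (hk : k < m + p) {c : Chains (Submodule K V)}
    (hc : c ∈ (genusIn ω E (p + 1)).chains k) (hbc : boundary c = 0) :
    ∃ e ∈ (genusIn ω E (p + 1)).chains (k + 1), boundary e = c :=
  genusIn_exists_boundary_eq_aux hω hE hdim
    (fun p _ _ => isoLines_exists_boundary_eq hω (m - p)) hp hk hc hbc

end Vanishing

/-! ### Joins of relative cycles -/

section Join

variable {S : Type*} {X Y B Z Z' : AugComplex S} {i j k : ℕ}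

theorem mul_mem_relCycles (hX : ∀ σ τ, X.IsFace σ → B.IsFace τ → Z.IsFace (σ ∪ τ))
    (hY : ∀ σ τ, Y.IsFace σ → B.IsFace τ → Z'.IsFace (σ ∪ τ)) (hk : i + 1 + j = k)
    {a b : Chains S} (ha : a ∈ relCycles X Y (i + 1))
    (hb : b ∈ relCycles B (AugComplex.void S) j) : a * b ∈ relCycles Z Z' k := by
  subst hk
  rw [mem_relCycles_void] at hb
  refine mem_relCycles.2 ⟨AugComplex.mul_mem_chains hX ha.1 hb.1, ?_⟩
  rw [boundary_mul ha.1, hb.2, mul_zero, smul_zero, add_zero]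
  have hi : i + 1 + j - 1 = i + j := by omega
  rw [hi]
  exact AugComplex.mul_mem_chains hY ha.2 hb.1

/-- The join `H(X, Y) ⊗ H̃(B) → H(Z, Z')`. -/
def joinHom (hX : ∀ σ τ, X.IsFace σ → B.IsFace τ → Z.IsFace (σ ∪ τ))
    (hY : ∀ σ τ, Y.IsFace σ → B.IsFace τ → Z'.IsFace (σ ∪ τ)) (hk : i + 1 + j = k) :
    RelHomology X Y (i + 1) →ₗ[ℤ] RedHomology B j →ₗ[ℤ] RelHomology Z Z' k :=
  let f : ↥(relCycles X Y (i + 1)) →ₗ[ℤ] ↥(relCycles B (AugComplex.void S) j) →ₗ[ℤ]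
      RelHomology Z Z' k :=
    LinearMap.mk₂ ℤ (fun a b => relMk Z Z' k ⟨a * b, mul_mem_relCycles hX hY hk a.2 b.2⟩)
      (fun a a' b => by
        rw [← map_add]
        exact congrArg _ (Subtype.ext (add_mul _ _ _)))
      (fun r a b => by
        rw [← map_smul]
        exact congrArg _ (Subtype.ext (smul_mul_assoc _ _ _)))
      (fun a b b' => by
        rw [← map_add]
        exact congrArg _ (Subtype.ext (mul_add _ _ _)))
      (fun r a b => by
        rw [← map_smul]
        exact congrArg _ (Subtype.ext (mul_smul_comm _ _ _)))
  Submodule.liftQ _ (LinearMap.flip (Submodule.liftQ _ f.flip (by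
      rintro ⟨b, hb⟩ h
      obtain ⟨e, he, rfl⟩ := mem_relBoundaries_void.1 h
      refine LinearMap.ext fun a => ?_
      refine (relClass_eq_zero_iff (mul_mem_relCycles hX hY hk a.2 hb)).2 ?_
      refine mem_relBoundaries.2 ⟨(-1 : ℤ) ^ (i + 1) • ((a : Chains S) * e),
        Submodule.smul_mem _ _ ?_, -((-1 : ℤ) ^ (i + 1) • (boundary (a : Chains S) * e)),
        Submodule.neg_mem _ (Submodule.smul_mem _ _ ?_), ?_⟩
      · have := AugComplex.mul_mem_chains hX a.2.1 he
        rwa [← add_assoc, hk] at this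
      · have := AugComplex.mul_mem_chains hY a.2.2 he
        rwa [Nat.add_sub_cancel, add_left_comm, add_comm j, hk] at this
      · rw [map_smul, boundary_mul a.2.1, smul_add, add_comm, smul_smul, ← mul_pow]
        simp))) (by
    rintro ⟨a, ha⟩ h
    obtain ⟨e, he, y, hy, rfl⟩ := mem_relBoundaries.1 h
    refine LinearMap.ext fun b => ?_
    obtain ⟨b, hb, rfl⟩ := relClass_surjective b
    have hb' := mem_relCycles_void.1 hb
    refine (relClass_eq_zero_iff (mul_mem_relCycles hX hY hk ha hb)).2 ?_
    refine mem_relBoundaries.2 ⟨e * b, ?_, y * b, ?_, ?_⟩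
    · have := AugComplex.mul_mem_chains hX he hb'.1
      rwa [add_right_comm, hk] at this
    · have := AugComplex.mul_mem_chains hY hy hb'.1
      rwa [hk] at this
    · rw [boundary_mul he, hb'.2, mul_zero, smul_zero, add_zero, add_mul])

theorem joinHom_relClass (hX : ∀ σ τ, X.IsFace σ → B.IsFace τ → Z.IsFace (σ ∪ τ))
    (hY : ∀ σ τ, Y.IsFace σ → B.IsFace τ → Z'.IsFace (σ ∪ τ)) (hk : i + 1 + j = k)
    {a b : Chains S} (ha : a ∈ relCycles X Y (i + 1))
    (hb : b ∈ relCycles B (AugComplex.void S) j) :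
    joinHom hX hY hk (relClass a ha) (relClass b hb) =
      relClass (a * b) (mul_mem_relCycles hX hY hk ha hb) := rfl

end Join

/-! ### Flags through a given subspace -/

section Contraction

variable {S : Type*}

/-- Contraction with the vertex `s` from the right: `[s₁, …, s_k, s] ↦ [s₁, …, s_k]`, and `0` on
simplices not containing `s`. It picks out the simplices with vertex `s`. -/
def removeLast (s : S) : Chains S →ₗ[ℤ] Chains S :=
  (CliffordAlgebra.contractRight (Q := (0 : QuadraticForm ℤ (S →₀ ℤ)))).flip
    (Finsupp.lapply (R := ℤ) s)

theorem removeLast_mul_self (s : S) (c : Chains S) :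
    removeLast s (c * simplex [s]) = c - removeLast s c * simplex [s] := by
  rw [simplex_singleton]
  refine (CliffordAlgebra.contractRight_mul_ι _ _ _).trans ?_
  rw [Finsupp.lapply_apply, Finsupp.single_eq_same, one_smul]
  rfl

theorem removeLast_mul_of_ne {s t : S} (h : s ≠ t) (c : Chains S) :
    removeLast s (c * simplex [t]) = -(removeLast s c * simplex [t]) := by
  rw [simplex_singleton]
  refine (CliffordAlgebra.contractRight_mul_ι _ _ _).trans ?_
  rw [Finsupp.lapply_apply, Finsupp.single_eq_of_ne h, zero_smul, zero_sub]
  rfl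

theorem removeLast_one (s : S) : removeLast s 1 = 0 :=
  CliffordAlgebra.contractRight_one _ _

theorem removeLast_eq_zero {X : AugComplex S} {k : ℕ} {c : Chains S} (hc : c ∈ X.chains k) {s : S}
    (hs : ∀ σ, X.IsFace σ → s ∉ σ) : removeLast s c = 0 := by
  suffices X.chains k ≤ LinearMap.ker (removeLast s) from this hc
  refine AugComplex.chains_le fun l hn hl hX => ?_
  have h := hs _ hX
  rw [LinearMap.mem_ker]
  clear hX hn hl
  induction l using List.reverseRecOn with
  | nil => rw [simplex_nil, removeLast_one]
  | append_singleton l t ih =>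
    have h' : s ∉ l ∧ s ≠ t := by simpa using h
    rw [simplex_append, removeLast_mul_of_ne h'.2, ih h'.1, zero_mul, neg_zero]

end Contraction

section Flags

variable {K V : Type*} [Field K] [AddCommGroup V] [Module K V] {ω : LinearMap.BilinForm K V}

theorem isoLines_disjoint {W : Submodule K V} (hW : rad ω W = ⊥) {σ τ : Set (Submodule K V)}
    (hσ : (linesLe W).IsFace σ) (hτ : (isoLines ω (ω.orthogonal W)).IsFace τ)
    {L : Submodule K V} (hLσ : L ∈ σ) : L ∉ τ := by
  intro h
  refine ne_bot_of_finrank_eq_one (hσ.1 L hLσ) (eq_bot_iff.2 (le_trans ?_ hW.le))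
  exact le_inf ((le_sSup hLσ).trans hσ.2) ((le_sSup h).trans hτ.2.1)

/-- The lines of `τ` lie in the radical of the span of `σ ∪ τ`, so they are absent if this span is
symplectic. -/
theorem sSup_eq_bot_of_rad_eq_bot (hω : ω.IsAlt) {W W' : Submodule K V}
    (hW' : rad ω W' = ⊥) {σ τ : Set (Submodule K V)} (hσ : sSup σ ≤ W)
    (hτ : sSup τ ∈ isotropicIn ω (ω.orthogonal W)) (h : W' = sSup (σ ∪ τ)) : sSup τ = ⊥ := by
  rw [eq_bot_iff, ← hW', h, sSup_union]
  refine le_inf le_sup_right ?_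
  rw [le_orthogonal_comm hω]
  exact sup_le ((le_orthogonal_comm hω).1 (hτ.1.trans (LinearMap.BilinForm.orthogonal_le hσ)))
    fun x hx y hy => hτ.2 y hy x hx

/-- A symplectic subspace spanned by lines of `W` and isotropic lines orthogonal to `W` is spanned
by the former. Hence a symplectic subspace not contained in the span of `σ` occurs in no flag of the
subdivision of `σ ∪ τ`. -/
theorem notMem_supFlags_union (hω : ω.IsAlt) {W W' : Submodule K V}
    (hW' : rad ω W' = ⊥) {σ τ : Set (Submodule K V)} (hσ : sSup σ ≤ W)
    (hτ : sSup τ ∈ isotropicIn ω (ω.orthogonal W)) (h : ¬ W' ≤ sSup σ) {ρ : Set (Submodule K V)}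
    (hρ : (supFlags (σ ∪ τ)).IsFace ρ) : W' ∉ ρ := by
  intro hmem
  obtain ⟨t, ht, -, htW⟩ := hρ.1 _ hmem
  have h1 : t = (t ∩ σ) ∪ (t ∩ τ) := by
    rw [← Set.inter_union_distrib_left, Set.inter_eq_left.2 ht]
  rw [h1] at htW
  have h2 := sSup_eq_bot_of_rad_eq_bot hω hW' ((sSup_le_sSup Set.inter_subset_right).trans hσ)
    (isLowerSet_isotropicIn ω _ (sSup_le_sSup Set.inter_subset_right) hτ) htW
  rw [sSup_union, h2, sup_bot_eq] at htW
  exact h (htW.le.trans (sSup_le_sSup Set.inter_subset_right))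

variable [FiniteDimensional K V]

theorem beta_eq_zero_of_finrank_lt {P : Set (Submodule K V)} (hP : IsLowerSet P) {d k : ℕ}
    (hd : ∀ U ∈ P, Module.finrank K U ≤ d) (hk : d < k) {c : Chains (Submodule K V)}
    (hc : c ∈ (lineComplex P hP).chains k) : beta c = 0 := by
  have := beta_mem_flagComplex hP hc
  rwa [flagComplex_chains_eq_bot hd hk, Submodule.mem_bot] at this

theorem finrank_sSup_list_le {l : List (Submodule K V)} (h : ∀ L ∈ l, Module.finrank K L = 1) :
    Module.finrank K ↥(sSup {L | L ∈ l}) ≤ l.length := by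
  classical
  have := finrank_sSup_le l.toFinset fun L hL => h L (List.mem_toFinset.1 hL)
  rw [List.coe_toFinset] at this
  exact this.trans l.toFinset_card_le

/-- The flags through `W = ⟨l⟩` in the subdivision of `l * t`, with `W` removed: such a flag consists
of a flag of proper subspaces of `W`, of `W` itself, and of the subspaces `W + U` for a flag of
subspaces `U` spanned by lines of `t`. -/
theorem removeLast_beta_simplex_mul (hω : ω.IsAlt) {W : Submodule K V} (hW : rad ω W = ⊥)
    (hW0 : W ≠ ⊥) {l : List (Submodule K V)} (hn : l.Nodup)
    (hl : ∀ L ∈ l, Module.finrank K L = 1)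
    (hlen : l.length = Module.finrank K W) (hlW : sSup {L | L ∈ l} = W) (j : ℕ) :
    ∀ t : List (Submodule K V), t.Nodup → t.length = j →
      (isoLines ω (ω.orthogonal W)).IsFace {L | L ∈ t} →
      removeLast W (beta (simplex l * simplex t)) = (-1 : ℤ) ^ (Module.finrank K W - 1 + j) •
        (beta (boundary (simplex l)) * chainMap (W ⊔ ·) (beta (simplex t))) := by
  obtain ⟨m, hm⟩ : ∃ m, Module.finrank K W = m + 1 := Nat.exists_eq_succ_of_ne_zero fun h =>
    hW0 (Submodule.finrank_eq_zero.1 h)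
  have hlm : l.length = m + 1 := hlen.trans hm
  -- the proper faces of `l` do not span `W`
  have hface : ∀ t : List (Submodule K V),
      (isoLines ω (ω.orthogonal W)).IsFace {L | L ∈ t} →
      removeLast W (beta (boundary (simplex l) * simplex t)) = 0 := by
    intro t ht
    rw [boundary_simplex, Finset.sum_mul, map_sum, map_sum]
    refine Finset.sum_eq_zero fun i hi => ?_
    rw [smul_mul_assoc, map_smul, map_smul, ← simplex_append]
    have hset : {L | L ∈ l.eraseIdx i ++ t} = {L | L ∈ l.eraseIdx i} ∪ {L | L ∈ t} := by
      ext
      simp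
    have hsub : sSup {L | L ∈ l.eraseIdx i} ≤ W := by
      rw [← hlW]
      exact sSup_le_sSup fun L hL => List.mem_of_mem_eraseIdx hL
    have hlt : ¬ W ≤ sSup {L | L ∈ l.eraseIdx i} := by
      intro h
      have h1 := finrank_sSup_list_le (l := l.eraseIdx i)
        fun L hL => hl L (List.mem_of_mem_eraseIdx hL)
      rw [hsub.antisymm h, List.length_eraseIdx_of_lt (Finset.mem_range.1 hi)] at h1
      omega
    have hmem := beta_simplex_mem (l.eraseIdx i ++ t)
    rw [hset] at hmem
    rw [removeLast_eq_zero hmem fun ρ hρ => notMem_supFlags_union hω hW hsub ht.2 hlt hρ,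
      smul_zero]
  rw [hm, Nat.add_sub_cancel]
  induction j with
  | zero =>
    intro t _ htl ht
    have h0 := hface [] ((isoLines ω (ω.orthogonal W)).down_closed _ _ (by simp) ht)
    rw [simplex_nil, mul_one] at h0
    rw [List.length_eq_zero_iff.1 htl, simplex_nil, mul_one, beta_one, chainMap_one, mul_one,
      beta_simplex hn hlm, hlW, map_smul, removeLast_mul_self, h0, zero_mul, sub_zero, add_zero]
  | succ j ih =>
    intro t htn htl ht
    have hWface : (linesLe W).IsFace {L | L ∈ l} := ⟨hl, hlW.le⟩
    have hn' : (l ++ t).Nodup := by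
      refine List.nodup_append.2 ⟨hn, htn, ?_⟩
      rintro L hL _ hL' rfl
      exact isoLines_disjoint hW hWface ht hL hL'
    have hsup : sSup {L | L ∈ l ++ t} = W ⊔ sSup {L | L ∈ t} := by
      conv_rhs => rw [← hlW, ← sSup_union]
      congr 1
      ext
      simp
    have hne : W ≠ W ⊔ sSup {L | L ∈ t} := by
      intro h
      obtain ⟨L, hL⟩ := List.exists_mem_of_length_pos (l := t) (by omega)
      have h1 : L ≤ W := by
        rw [h]
        exact (le_sSup (show L ∈ {L | L ∈ t} from hL)).trans le_sup_right
      have h2 : (linesLe W).IsFace {L} :=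
        ⟨fun L' hL' => by
          rw [Set.mem_singleton_iff.1 hL']
          exact ht.1 L hL, show sSup {L} ≤ W by rwa [sSup_singleton]⟩
      exact isoLines_disjoint hW h2 ht (Set.mem_singleton L) hL
    -- the induction hypothesis, applied to the boundary of `t`
    have hih : removeLast W (beta (simplex l * boundary (simplex t))) =
        (-1 : ℤ) ^ (m + j) •
          (beta (boundary (simplex l)) * chainMap (W ⊔ ·) (beta (boundary (simplex t)))) := by
      rw [boundary_simplex t]
      simp only [map_sum, map_smul, Finset.mul_sum, mul_smul_comm, Finset.smul_sum]
      refine Finset.sum_congr rfl fun i hi => ?_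
      rw [ih (t.eraseIdx i) (htn.sublist (List.eraseIdx_sublist _ _)) (by
        rw [List.length_eraseIdx_of_lt (Finset.mem_range.1 hi), htl, Nat.add_sub_cancel])
        ((isoLines ω (ω.orthogonal W)).down_closed _ _
          (fun L hL => List.mem_of_mem_eraseIdx hL) ht), smul_comm]
    have hmap : chainMap (W ⊔ ·) (beta (simplex t)) = (-1 : ℤ) ^ j •
        (chainMap (W ⊔ ·) (beta (boundary (simplex t))) *
          simplex [W ⊔ sSup {L | L ∈ t}]) := by
      rw [beta_simplex htn htl, map_smul, chainMap_mul, chainMap_simplex]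
      rfl
    rw [← simplex_append, beta_simplex hn' (k := m + 1 + j) (by
      rw [List.length_append, hlm, htl]
      ring), hsup, simplex_append, map_smul, removeLast_mul_of_ne hne, boundary_simplex_mul,
      map_add, map_add, hface t ht, zero_add, map_smul, map_smul, hih, hmap, hlm]
    simp only [mul_smul_comm, smul_mul_assoc, smul_smul, smul_neg, mul_assoc]
    rw [← neg_smul]
    congr 1
    have hm' : (-1 : ℤ) ^ m * (-1 : ℤ) ^ m = 1 := by
      rw [← mul_pow]
      simp
    linear_combination (-(-1 : ℤ) ^ m * ((-1) ^ j) ^ 2) * hm'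

end Flags

section FlagsProduct

variable {K V : Type*} [Field K] [AddCommGroup V] [Module K V] {ω : LinearMap.BilinForm K V}

/-- No flag in the subdivision of a join of lines of `W` with isotropic lines orthogonal to `W` passes through a symplectic subspace `W'` that is not
contained in `W`. -/
theorem removeLast_beta_mul_of_ne (hω : ω.IsAlt) {W W' : Submodule K V} (hW' : rad ω W' = ⊥)
    (h : ¬ W' ≤ W) {i j : ℕ} {a b : Chains (Submodule K V)}
    (ha : a ∈ (linesLe W).chains i) (hb : b ∈ (isoLines ω (ω.orthogonal W)).chains j) :
    removeLast W' (beta (a * b)) = 0 := by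
  have key : ∀ l : List (Submodule K V), (linesLe W).IsFace {L | L ∈ l} →
      removeLast W' (beta (simplex l * b)) = 0 := by
    intro l hX
    suffices (isoLines ω (ω.orthogonal W)).chains j ≤ LinearMap.ker
        (removeLast W' ∘ₗ beta ∘ₗ LinearMap.mulLeft ℤ (simplex l)) from
      LinearMap.mem_ker.1 (this hb)
    refine AugComplex.chains_le fun t htn htl ht => ?_
    have hle : sSup {L | L ∈ l} ≤ W := hX.2
    have hset : {L | L ∈ l ++ t} = {L | L ∈ l} ∪ {L | L ∈ t} := by
      ext
      simp
    have hmem := beta_simplex_mem (l ++ t)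
    rw [hset] at hmem
    change removeLast W' (beta (simplex l * simplex t)) = 0
    rw [← simplex_append]
    exact removeLast_eq_zero hmem fun ρ hρ =>
      notMem_supFlags_union hω hW' hle ht.2 (fun h' => h (h'.trans hle)) hρ
  suffices (linesLe W).chains i ≤ LinearMap.ker
      (removeLast W' ∘ₗ beta ∘ₗ LinearMap.mulRight ℤ b) from LinearMap.mem_ker.1 (this ha)
  exact AugComplex.chains_le fun l _ _ hX => key l hX

variable [FiniteDimensional K V]

/-- The flags through `W` in the subdivision of a join of a simplex of lines spanning `W` with
isotropic lines orthogonal to `W`. -/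
theorem removeLast_beta_mul (hω : ω.IsAlt) {W : Submodule K V} (hW : rad ω W = ⊥)
    (hW0 : W ≠ ⊥) {j : ℕ} {a b : Chains (Submodule K V)}
    (ha : a ∈ (linesLe W).chains (Module.finrank K W - 1 + 1))
    (hb : b ∈ (isoLines ω (ω.orthogonal W)).chains j) :
    removeLast W (beta (a * b)) = (-1 : ℤ) ^ (Module.finrank K W - 1 + j) •
      (beta (boundary a) * chainMap (W ⊔ ·) (beta b)) := by
  have hpos : Module.finrank K W ≠ 0 := fun h => hW0 (Submodule.finrank_eq_zero.1 h)
  rw [Nat.sub_add_cancel (Nat.one_le_iff_ne_zero.2 hpos)] at ha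
  have key : ∀ l : List (Submodule K V), l.Nodup → l.length = Module.finrank K W →
      (linesLe W).IsFace {L | L ∈ l} → removeLast W (beta (simplex l * b)) =
        (-1 : ℤ) ^ (Module.finrank K W - 1 + j) •
          (beta (boundary (simplex l)) * chainMap (W ⊔ ·) (beta b)) := by
    intro l hn hl hX
    suffices (isoLines ω (ω.orthogonal W)).chains j ≤ LinearMap.eqLocus
        (removeLast W ∘ₗ beta ∘ₗ LinearMap.mulLeft ℤ (simplex l))
        ((-1 : ℤ) ^ (Module.finrank K W - 1 + j) •
          (LinearMap.mulLeft ℤ (beta (boundary (simplex l))) ∘ₗ chainMap (W ⊔ ·) ∘ₗ beta)) from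
      LinearMap.mem_eqLocus.1 (this hb)
    refine AugComplex.chains_le fun t htn htl ht => ?_
    have hle : sSup {L | L ∈ l} ≤ W := hX.2
    rcases hle.eq_or_lt with h | h
    · exact removeLast_beta_simplex_mul hω hW hW0 hn hX.1 hl h j t htn htl ht
    · -- if `l` does not span `W`, then both sides vanish
      have hset : {L | L ∈ l ++ t} = {L | L ∈ l} ∪ {L | L ∈ t} := by
        ext
        simp
      have hmem := beta_simplex_mem (l ++ t)
      rw [hset] at hmem
      have h1 : removeLast W (beta (simplex l * simplex t)) = 0 := by
        rw [← simplex_append]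
        exact removeLast_eq_zero hmem fun ρ hρ =>
          notMem_supFlags_union hω hW hle ht.2 h.not_ge hρ
      have h2 : beta (simplex l) = 0 := by
        refine beta_eq_zero_of_finrank_lt (isLowerSet_Iio W) (d := Module.finrank K W - 1)
          (k := Module.finrank K W) (fun U hU => ?_) (by omega)
          (AugComplex.simplex_mem_chains hl ⟨hX.1, h⟩)
        have := Submodule.finrank_lt_finrank_of_lt hU
        omega
      refine LinearMap.mem_eqLocus.2 (h1.trans ?_)
      change 0 = (-1 : ℤ) ^ (Module.finrank K W - 1 + j) •
        (beta (boundary (simplex l)) * chainMap (W ⊔ ·) (beta (simplex t)))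
      rw [← boundary_beta, h2, map_zero, zero_mul, smul_zero]
  suffices (linesLe W).chains (Module.finrank K W) ≤ LinearMap.eqLocus
      (removeLast W ∘ₗ beta ∘ₗ LinearMap.mulRight ℤ b)
      ((-1 : ℤ) ^ (Module.finrank K W - 1 + j) •
        (LinearMap.mulRight ℤ (chainMap (W ⊔ ·) (beta b)) ∘ₗ beta ∘ₗ boundary)) from
    LinearMap.mem_eqLocus.1 (this ha)
  exact AugComplex.chains_le key

end FlagsProduct

/-! ### Homology in the top degree -/

section TopDegree

variable {S : Type*}

/-- A linear map on relative cycles that kills boundaries, as a map on homology. -/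
def relLift {X Y : AugComplex S} {k : ℕ} {M : Type*} [AddCommGroup M]
    (f : ↥(relCycles X Y k) →ₗ[ℤ] M)
    (h : ∀ c hc, c ∈ relBoundaries X Y k → f ⟨c, hc⟩ = 0) : RelHomology X Y k →ₗ[ℤ] M :=
  Submodule.liftQ _ f fun c hc => h c.1 c.2 hc

/-- If `X` has no simplices with `k + 1` vertices, then its homology in this degree consists of
cycles. -/
theorem exists_toChains {X : AugComplex S} {k : ℕ} (h : X.chains (k + 1) = ⊥) :
    ∃ f : RedHomology X k →ₗ[ℤ] Chains S, Function.Injective f ∧ ∀ c hc, f (relClass c hc) = c := by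
  have h0 : ∀ c hc, c ∈ relBoundaries X (AugComplex.void S) k →
      (relCycles X (AugComplex.void S) k).subtype ⟨c, hc⟩ = 0 := by
    intro c hc hc'
    obtain ⟨e, he, rfl⟩ := mem_relBoundaries_void.1 hc'
    rw [h, Submodule.mem_bot] at he
    change boundary e = 0
    rw [he, map_zero]
  refine ⟨relLift _ h0, ?_, fun c hc => rfl⟩
  rw [← LinearMap.ker_eq_bot, eq_bot_iff]
  intro z hz
  obtain ⟨c, hc, rfl⟩ := relClass_surjective z
  have h0 : c = 0 := hz
  subst h0
  exact (relClass_eq_zero_iff hc).2 (Submodule.zero_mem _)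

open scoped Classical in
/-- A join of chains on disjoint sets of vertices determines the tensor product of the chains. -/
theorem exists_tensor_of_mul (P Q : Set S) (hPQ : Disjoint P Q) :
    ∃ f : Chains S →ₗ[ℤ] Chains S ⊗[ℤ] Chains S, ∀ {X Y : AugComplex S} {i j : ℕ},
      (∀ σ, X.IsFace σ → σ ⊆ P) → (∀ τ, Y.IsFace τ → τ ⊆ Q) →
        ∀ c ∈ X.chains i, ∀ d ∈ Y.chains j, f (c * d) = c ⊗ₜ d := by
  obtain ⟨f, hf⟩ := exists_linear fun s : Finset S =>
    if stdSimplex s = stdSimplex (s.filter (· ∈ P)) * stdSimplex (s.filter (· ∈ Q)) then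
      stdSimplex (s.filter (· ∈ P)) ⊗ₜ[ℤ] stdSimplex (s.filter (· ∈ Q))
    else -(stdSimplex (s.filter (· ∈ P)) ⊗ₜ[ℤ] stdSimplex (s.filter (· ∈ Q)))
  have hstd : ∀ s t : Finset S, (∀ x ∈ s, x ∈ P) → (∀ x ∈ t, x ∈ Q) →
      f (stdSimplex s * stdSimplex t) = stdSimplex s ⊗ₜ stdSimplex t := by
    intro s t hs ht
    have h1 : (s ∪ t).filter (· ∈ P) = s := by
      ext x
      simp only [Finset.mem_filter, Finset.mem_union]
      refine ⟨?_, fun h => ⟨Or.inl h, hs x h⟩⟩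
      rintro ⟨h | h, h'⟩
      · exact h
      · exact (Set.disjoint_left.1 hPQ h' (ht x h)).elim
    have h2 : (s ∪ t).filter (· ∈ Q) = t := by
      ext x
      simp only [Finset.mem_filter, Finset.mem_union]
      refine ⟨?_, fun h => ⟨Or.inr h, ht x h⟩⟩
      rintro ⟨h | h, h'⟩
      · exact (Set.disjoint_left.1 hPQ (hs x h) h').elim
      · exact h
    have h3 := hf (s ∪ t)
    rw [h1, h2] at h3
    have hdisj : ∀ x ∈ s, x ∉ t := fun x hx hx' =>
      Set.disjoint_left.1 hPQ (hs x hx) (ht x hx')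
    have h4 : stdSimplex s * stdSimplex t = stdSimplex (s ∪ t) ∨
        stdSimplex s * stdSimplex t = -stdSimplex (s ∪ t) := by
      rw [stdSimplex, stdSimplex, ← simplex_append]
      refine simplex_perm ((List.perm_ext_iff_of_nodup ?_ (Finset.nodup_toList _)).2 (by simp))
      refine List.nodup_append.2 ⟨Finset.nodup_toList s, Finset.nodup_toList t, ?_⟩
      rintro x hx _ hx' rfl
      exact hdisj x (Finset.mem_toList.1 hx) (Finset.mem_toList.1 hx')
    split_ifs at h3 with h5
    · rw [← h5, h3]
    · rcases h4 with h4 | h4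
      · exact (h5 h4.symm).elim
      · rw [h4, map_neg, h3, neg_neg]
  refine ⟨f, fun {X Y i j} hX hY c hc d hd => ?_⟩
  have key : ∀ l t : List S, l.Nodup → t.Nodup → X.IsFace {s | s ∈ l} → Y.IsFace {s | s ∈ t} →
      f (simplex l * simplex t) = simplex l ⊗ₜ simplex t := by
    intro l t hl ht hXl hYt
    have h := hstd l.toFinset t.toFinset (fun x hx => hX _ hXl (List.mem_toFinset.1 hx))
      (fun x hx => hY _ hYt (List.mem_toFinset.1 hx))
    rcases simplex_eq_stdSimplex hl with h1 | h1 <;>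
      rcases simplex_eq_stdSimplex ht with h2 | h2 <;>
      simp [h1, h2, h, TensorProduct.neg_tmul, TensorProduct.tmul_neg]
  have key' : ∀ l : List S, l.Nodup → X.IsFace {s | s ∈ l} →
      f (simplex l * d) = simplex l ⊗ₜ d := by
    intro l hl hXl
    suffices Y.chains j ≤ LinearMap.eqLocus (f ∘ₗ LinearMap.mulLeft ℤ (simplex l))
      (TensorProduct.mk ℤ _ _ (simplex l)) from LinearMap.mem_eqLocus.1 (this hd)
    exact AugComplex.chains_le fun t ht _ hYt => key l t hl ht hXl hYt
  suffices X.chains i ≤ LinearMap.eqLocus (f ∘ₗ LinearMap.mulRight ℤ d)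
    ((TensorProduct.mk ℤ (Chains S) (Chains S)).flip d) from LinearMap.mem_eqLocus.1 (this hc)
  exact AugComplex.chains_le fun l hl _ hXl => key' l hl hXl

/-- The tensor product of two injections into groups of chains is injective, since these groups are
free. -/
theorem injective_map_of_injective_chains {S S' : Type*} {M N : Type*} [AddCommGroup M] [AddCommGroup N]
    {f : M →ₗ[ℤ] Chains S} {g : N →ₗ[ℤ] Chains S'}
    (hf : Function.Injective f) (hg : Function.Injective g) :
    Function.Injective (TensorProduct.map f g) := by
  have hM : Module.IsTorsionFree ℤ M := hf.moduleIsTorsionFree f (fun r x => map_smul f r x)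
  have h : TensorProduct.map f g = f.rTensor _ ∘ₗ g.lTensor M := by
    rw [LinearMap.rTensor_comp_lTensor]
  rw [h, LinearMap.coe_comp]
  exact (Module.Flat.rTensor_preserves_injective_linearMap f hf).comp
    (Module.Flat.lTensor_preserves_injective_linearMap g hg)

end TopDegree

/-! ### The terms of the resolution as relative homology groups -/

section Comparison

variable {K V : Type*} [Field K] [AddCommGroup V] [Module K V] {ω : LinearMap.BilinForm K V}

theorem SympSubspace.rad_eq_bot (hω : ω.IsAlt) {p : ℕ} (W : SympSubspace ω p) :
    rad ω W.1 = ⊥ := (restrict_nondegenerate_iff_rad hω).1 W.2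

theorem SympSubspace.ne_bot {p : ℕ} (W : SympSubspace ω (p + 1)) : W.1 ≠ ⊥ := by
  intro h
  have h2 := W.finrank_eq
  rw [h, finrank_bot] at h2
  omega

/-- The product `St(W) ⊗ St^ω(W^⊥) → Chains`, `[c] ⊗ [d] ↦ c * (W ⊔ d)`, is injective: a pair of
flags, of proper subspaces of `W` and of isotropic subspaces of `W^⊥`, is determined by its image. -/
theorem exists_injective_flagProduct {W : Submodule K V} (hW : rad ω W = ⊥)
    (h1 : (titsBuilding W).chains (Module.finrank K W - 1 + 1) = ⊥)
    (h2 : (sympTitsBuilding ω (ω.orthogonal W)).chains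
      (Module.finrank K (ω.orthogonal W) / 2 + 1) = ⊥) :
    ∃ f : Summand ω W →ₗ[ℤ] Chains (Submodule K V), Function.Injective f ∧ ∀ c hc d hd,
      f ((relClass c hc : Steinberg W) ⊗ₜ[ℤ]
        (relClass d hd : SympSteinberg ω (ω.orthogonal W))) = c * chainMap (W ⊔ ·) d := by
  obtain ⟨f, hf, hf'⟩ := exists_toChains h1
  obtain ⟨g, hg, hg'⟩ := exists_toChains h2
  obtain ⟨T, hT⟩ := exists_tensor_of_mul (Set.Iio W) (Set.Ioi W)
    (Set.disjoint_left.2 fun U (h : U < W) (h' : W < U) => lt_asymm h h')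
  have hsup : IsSimplicial (W ⊔ ·) (sympTitsBuilding ω (ω.orthogonal W))
      { IsFace := fun σ => σ ⊆ Set.Ioi W, down_closed := fun _ _ h h' => h.trans h' } := by
    rintro σ hσ _ ⟨U, hU, rfl⟩
    refine lt_of_le_of_ne (show W ≤ W ⊔ U from le_sup_left) fun h =>
      (hσ.1 U hU).1 (eq_bot_iff.2 ?_)
    rw [← hW]
    exact le_inf (le_sup_right.trans h.ge) (hσ.1 U hU).2.1
  have hinv : ∀ k, ∀ d ∈ (sympTitsBuilding ω (ω.orthogonal W)).chains k,
      chainMap (· ⊓ ω.orthogonal W) (chainMap (W ⊔ ·) d) = d := by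
    intro k d hd
    suffices (sympTitsBuilding ω (ω.orthogonal W)).chains k ≤ LinearMap.eqLocus
      (chainMap (· ⊓ ω.orthogonal W) ∘ₗ chainMap (W ⊔ ·)) LinearMap.id from this hd
    refine AugComplex.chains_le fun l _ _ hl => ?_
    rw [LinearMap.mem_eqLocus, LinearMap.comp_apply, chainMap_simplex, chainMap_simplex,
      List.map_map, LinearMap.id_apply]
    congr 1
    refine (List.map_congr_left fun U hU => ?_).trans (List.map_id l)
    change (W ⊔ U) ⊓ ω.orthogonal W = U
    rw [sup_comm, sup_inf_assoc_of_le _ (hl.1 U hU).2.1]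
    change U ⊔ rad ω W = U
    rw [hW, sup_bot_eq]
  -- `U` is recovered from `W + U` as its intersection with `W^⊥`, which gives a left inverse
  refine ⟨TensorProduct.lift ((LinearMap.mul ℤ (Chains (Submodule K V))).compl₁₂ f
    (chainMap (W ⊔ ·) ∘ₗ g)), ?_, fun c hc d hd => ?_⟩
  · have hcomp : ∀ x, TensorProduct.map LinearMap.id (chainMap (· ⊓ ω.orthogonal W))
        (T (TensorProduct.lift ((LinearMap.mul ℤ (Chains (Submodule K V))).compl₁₂ f
          (chainMap (W ⊔ ·) ∘ₗ g)) x)) = TensorProduct.map f g x := by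
      intro x
      induction x using TensorProduct.induction_on with
      | zero => simp only [map_zero]
      | add x y hx hy => simp only [map_add, hx, hy]
      | tmul x y =>
        obtain ⟨c, hc, rfl⟩ := relClass_surjective x
        obtain ⟨d, hd, rfl⟩ := relClass_surjective y
        have hd' := (mem_relCycles_void.1 hd).1
        change TensorProduct.map LinearMap.id (chainMap (· ⊓ ω.orthogonal W))
          (T (f (relClass c hc) * chainMap (W ⊔ ·) (g (relClass d hd)))) = _ ⊗ₜ _
        rw [hf', hg', hT (X := titsBuilding W) (fun σ hσ U hU => (hσ.1 U hU).2) (fun _ h => h) c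
          (mem_relCycles_void.1 hc).1 _ (chainMap_mem_chains hsup hd'), TensorProduct.map_tmul,
          hinv _ _ hd', LinearMap.id_apply]
    intro x y hxy
    refine injective_map_of_injective_chains hf hg ?_
    exact (hcomp x).symm.trans ((congrArg _ (congrArg T hxy)).trans (hcomp y))
  · change f (relClass c hc) * chainMap (W ⊔ ·) (g (relClass d hd)) = _
    rw [hf', hg']

variable [FiniteDimensional K V]

theorem genusFiltration_chains (p k : ℕ) :
    (genusFiltration ω p).chains k = (genusIn ω ⊤ p).chains k :=
  le_antisymm
    (AugComplex.chains_mono (X := genusFiltration ω p) (Y := genusIn ω ⊤ p)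
      (fun _ h => ⟨h.1, le_top, h.2⟩) k)
    (AugComplex.chains_mono (X := genusIn ω ⊤ p) (Y := genusFiltration ω p)
      (fun _ h => ⟨h.1, h.2.2⟩) k)

theorem SympSubspace.genus_eq (hω : ω.IsAlt) {p : ℕ} (W : SympSubspace ω p) :
    genus ω W.1 = p := by
  have h1 := finrank_eq_of_rad_eq_bot hω (W.rad_eq_bot hω)
  have h2 := W.finrank_eq
  omega

theorem SympSubspace.index_eq (hnd : ω.Nondegenerate) {n : ℕ}
    (hdim : Module.finrank K V = 2 * n) {p : ℕ} (W : SympSubspace ω (p + 1)) :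
    Module.finrank K W.1 - 1 + 1 + Module.finrank K (ω.orthogonal W.1) / 2 = n + (p + 1) := by
  have h1 := LinearMap.BilinForm.finrank_orthogonal hnd W.1
  have h2 := W.finrank_eq
  have h3 := Submodule.finrank_le W.1
  omega

theorem union_mem_genusFiltration (hω : ω.IsAlt) {W : Submodule K V} {p : ℕ}
    (hp : genus ω W < p) {σ τ : Set (Submodule K V)} (hσ : (linesLe W).IsFace σ)
    (hτ : (isoLines ω (ω.orthogonal W)).IsFace τ) : (genusFiltration ω p).IsFace (σ ∪ τ) := by
  have hσ' : sSup σ ≤ W := hσ.2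
  refine ⟨?_, ?_⟩
  · rintro L (h | h)
    · exact hσ.1 L h
    · exact hτ.1 L h
  · rw [sSup_union, genus_sup_eq hω (hτ.2.1.trans (LinearMap.BilinForm.orthogonal_le hσ'))
      fun x hx y hy => hτ.2.2 y hy x hx]
    exact (genus_mono ω hσ').trans_lt hp

theorem union_mem_genusFiltration_of_linesLt (hω : ω.IsAlt) {W : Submodule K V} {p : ℕ}
    (hW : rad ω W = ⊥) (hp : genus ω W = p) {σ τ : Set (Submodule K V)}
    (hσ : (linesLt W).IsFace σ) (hτ : (isoLines ω (ω.orthogonal W)).IsFace τ) :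
    (genusFiltration ω p).IsFace (σ ∪ τ) := by
  have hσ' : sSup σ < W := hσ.2
  refine union_mem_genusFiltration (W := sSup σ) hω ?_ ⟨hσ.1, le_refl (sSup σ)⟩
    ⟨hτ.1, hτ.2.1.trans (LinearMap.BilinForm.orthogonal_le hσ'.le), hτ.2.2⟩
  rw [← hp]
  exact genus_lt_of_lt hω hW hσ'

variable (hω : ω.IsAlt) (hnd : ω.Nondegenerate) {n : ℕ} (hdim : Module.finrank K V = 2 * n)

section Summand

variable {p : ℕ} (W : SympSubspace ω (p + 1))

include hω hnd hdim in
theorem mul_mem_eOne {a b : Chains (Submodule K V)}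
    (ha : a ∈ relCycles (linesLe W.1) (linesLt W.1) (Module.finrank K W.1 - 1 + 1))
    (hb : b ∈ relCycles (isoLines ω (ω.orthogonal W.1)) (AugComplex.void _)
      (Module.finrank K (ω.orthogonal W.1) / 2)) :
    a * b ∈ relCycles (genusFiltration ω (p + 1 + 1)) (genusFiltration ω (p + 1)) (n + (p + 1)) :=
  mul_mem_relCycles
    (fun _ _ => union_mem_genusFiltration hω ((W.genus_eq hω).trans_lt (Nat.lt_succ_self _)))
    (fun _ _ => union_mem_genusFiltration_of_linesLt hω (W.rad_eq_bot hω) (W.genus_eq hω))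
    (W.index_eq hnd hdim) ha hb

/-- The map `St(W) ⊗ St^ω(W^⊥) → E¹` given by the join of chains of lines. -/
def comparisonSummand :
    Steinberg W.1 ⊗[ℤ] SympSteinberg ω (ω.orthogonal W.1) →ₗ[ℤ] EOne ω n (p + 1) :=
  TensorProduct.lift (joinHom
    (fun _ _ => union_mem_genusFiltration hω ((W.genus_eq hω).trans_lt (Nat.lt_succ_self _)))
    (fun _ _ => union_mem_genusFiltration_of_linesLt hω (W.rad_eq_bot hω) (W.genus_eq hω))
    (W.index_eq hnd hdim)) ∘ₗ
    TensorProduct.map (steinbergIso W.1 W.ne_bot).symm.toLinearMap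
      (sympSteinbergIso ω (ω.orthogonal W.1)).symm.toLinearMap

theorem comparisonSummand_tmul {a b : Chains (Submodule K V)}
    (ha : a ∈ relCycles (linesLe W.1) (linesLt W.1) (Module.finrank K W.1 - 1 + 1))
    (hb : b ∈ relCycles (isoLines ω (ω.orthogonal W.1)) (AugComplex.void _)
      (Module.finrank K (ω.orthogonal W.1) / 2)) :
    comparisonSummand hω hnd hdim W (steinbergIso W.1 W.ne_bot (relClass a ha) ⊗ₜ
      sympSteinbergIso ω (ω.orthogonal W.1) (relClass b hb)) =
      relClass (a * b) (mul_mem_eOne hω hnd hdim W ha hb) := by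
  have h : ∀ x y, comparisonSummand hω hnd hdim W (x ⊗ₜ y) = joinHom
      (fun _ _ => union_mem_genusFiltration hω ((W.genus_eq hω).trans_lt (Nat.lt_succ_self _)))
      (fun _ _ => union_mem_genusFiltration_of_linesLt hω (W.rad_eq_bot hω) (W.genus_eq hω))
      (W.index_eq hnd hdim) ((steinbergIso W.1 W.ne_bot).symm x)
      ((sympSteinbergIso ω (ω.orthogonal W.1)).symm y) := fun _ _ => rfl
  rw [h, LinearEquiv.symm_apply_apply, LinearEquiv.symm_apply_apply, joinHom_relClass]

end Summand

theorem SteinbergSum.hom_ext_lines {p : ℕ} {M : Type*} [AddCommGroup M]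
    {f f' : SteinbergSum ω (p + 1) →ₗ[ℤ] M}
    (h : ∀ (W : SympSubspace ω (p + 1)) a ha b hb,
      f (SteinbergSum.of ω W (steinbergIso W.1 W.ne_bot (relClass a ha) ⊗ₜ
        sympSteinbergIso ω (ω.orthogonal W.1) (relClass b hb))) =
      f' (SteinbergSum.of ω W (steinbergIso W.1 W.ne_bot (relClass a ha) ⊗ₜ
        sympSteinbergIso ω (ω.orthogonal W.1) (relClass b hb)))) : f = f' := by
  refine SteinbergSum.hom_ext ω fun W c hc d hd => ?_
  obtain ⟨x, hx⟩ := (steinbergIso W.1 W.ne_bot).surjective (relClass c hc)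
  obtain ⟨y, hy⟩ := (sympSteinbergIso ω (ω.orthogonal W.1)).surjective (relClass d hd)
  obtain ⟨a, ha, rfl⟩ := relClass_surjective x
  obtain ⟨b, hb, rfl⟩ := relClass_surjective y
  rw [← hx, ← hy]
  exact h W a ha b hb

open scoped Classical in
/-- The map `⨁ St(W) ⊗ St^ω(W^⊥) → E¹` given by the join of chains of lines. -/
def comparisonSum (p : ℕ) : SteinbergSum ω (p + 1) →ₗ[ℤ] EOne ω n (p + 1) :=
  DirectSum.toModule ℤ (SympSubspace ω (p + 1)) _
    fun W => (comparisonSummand hω hnd hdim W : Summand ω W.1 →ₗ[ℤ] _)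

theorem comparisonSum_of {p : ℕ} (W : SympSubspace ω (p + 1)) (x) :
    comparisonSum hω hnd hdim p (SteinbergSum.of ω W x) = comparisonSummand hω hnd hdim W x := by
  classical
  exact DirectSum.toModule_lof ℤ (M := fun W : SympSubspace ω (p + 1) => Summand ω W.1) W x

/-! ### Surjectivity of the comparison map -/

include hω in
/-- A core of genus `p + 1` of the minimal cardinality `2 * (p + 1)` spans a symplectic subspace. -/
theorem exists_sympSubspace_of_isCore {p : ℕ} {N : Finset (Submodule K V)}
    (hN : IsCore ω ⊤ (p + 1) N) (hcard : N.card = 2 * (p + 1)) :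
    ∃ W : SympSubspace ω (p + 1), sSup (N : Set (Submodule K V)) = W.1 := by
  have h1 := finrank_sSup_le N hN.line
  have h2 := finrank_eq_rad_add_genus hω (sSup (N : Set (Submodule K V)))
  rw [hN.genus_eq] at h2
  refine ⟨⟨sSup N, (restrict_nondegenerate_iff_rad hω).2 ?_, by omega⟩, rfl⟩
  exact Submodule.finrank_eq_zero.1 (by omega)

theorem relClass_stdSimplex_mul_mem_range {p b : ℕ} (hb : 2 * (p + 1) + b = n + (p + 1))
    {N : Finset (Submodule K V)} (hN : IsCore ω ⊤ (p + 1) N) (hcard : N.card = 2 * (p + 1))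
    {c : Chains (Submodule K V)} (hc : c ∈ (linkIn ω ⊤ N).chains b) (hbc : boundary c = 0) :
    ∃ h, relClass (stdSimplex N * c) h ∈ LinearMap.range (comparisonSum hω hnd hdim p) := by
  obtain ⟨W, hW⟩ := exists_sympSubspace_of_isCore hω hN hcard
  have hWdim := W.finrank_eq
  have ha : stdSimplex N ∈
      relCycles (linesLe W.1) (linesLt W.1) (Module.finrank K W.1 - 1 + 1) := by
    refine mem_relCycles.2 ⟨AugComplex.simplex_mem_chains ?_ ⟨?_, ?_⟩, ?_⟩
    · rw [Finset.length_toList]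
      omega
    · exact fun L hL => hN.line L (Finset.mem_toList.1 hL)
    · change sSup _ ≤ W.1
      rw [← hW]
      exact sSup_le_sSup fun L hL => Finset.mem_toList.1 hL
    · rw [Nat.add_sub_cancel, stdSimplex, boundary_simplex]
      refine Submodule.sum_mem _ fun i hi => Submodule.smul_mem _ _ ?_
      have hlen : (N.toList.eraseIdx i).length = Module.finrank K W.1 - 1 := by
        rw [List.length_eraseIdx_of_lt (Finset.mem_range.1 hi), Finset.length_toList]
        omega
      have hline : ∀ L ∈ N.toList.eraseIdx i, Module.finrank K L = 1 := fun L hL =>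
        hN.line L (Finset.mem_toList.1 (List.mem_of_mem_eraseIdx hL))
      refine AugComplex.simplex_mem_chains hlen ⟨hline, ?_⟩
      have hle : sSup {L | L ∈ N.toList.eraseIdx i} ≤ W.1 := by
        rw [← hW]
        exact sSup_le_sSup fun L hL => Finset.mem_toList.1 (List.mem_of_mem_eraseIdx hL)
      refine hle.lt_of_ne fun h => ?_
      have := finrank_sSup_list_le hline
      rw [h, hlen] at this
      omega
  have hb' : c ∈ relCycles (isoLines ω (ω.orthogonal W.1)) (AugComplex.void _)
      (Module.finrank K (ω.orthogonal W.1) / 2) := by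
    have hidx := W.index_eq hnd hdim
    have hb'' : Module.finrank K (ω.orthogonal W.1) / 2 = b := by omega
    rw [linkIn, hW, top_inf_eq] at hc
    rw [hb'']
    exact mem_relCycles_void.2 ⟨hc, hbc⟩
  exact ⟨mul_mem_eOne hω hnd hdim W ha hb', _,
    (comparisonSum_of hω hnd hdim W _).trans (comparisonSummand_tmul hω hnd hdim W ha hb')⟩

/-- Relative cycles can be moved to the stage `2 * (p + 1)`, where they are sums of joins of cores
that span symplectic subspaces with cycles of isotropic lines of the orthogonal complements. -/
theorem comparisonSum_surjective (p : ℕ) :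
    Function.Surjective (comparisonSum hω hnd hdim p) := by
  classical
  rw [← LinearMap.range_eq_top, eq_top_iff]
  rintro x -
  obtain ⟨z, hz, rfl⟩ := relClass_surjective x
  have hE := rad_top hnd
  have hdim' : Module.finrank K (⊤ : Submodule K V) = 2 * n := by rw [finrank_top, hdim]
  obtain ⟨hz1, hz2⟩ := mem_relCycles.1 hz
  rw [genusFiltration_chains] at hz1 hz2
  by_cases hp : p + 1 ≤ n
  · obtain ⟨w, hw, hzw⟩ := exists_sub_boundary_mem_stage_of_le hω hE hdim' (B := 2 * (p + 1))
      (fun E' hE' hdim' => isoLines_exists_boundary_eq hω _ E' hE' hdim') (by omega) hz1 hz2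
    obtain ⟨b, hb⟩ := Nat.exists_eq_add_of_le (show 2 * (p + 1) ≤ n + (p + 1) by omega)
    have hA : 2 * (p + 1) = 2 * p + 1 + 1 := by ring
    have hzw' : z - boundary w ∈ (stage ω ⊤ (p + 1) (2 * p + 1 + 1)).chains
        (2 * p + 1 + 1 + b) := by
      rwa [← hA, ← hb]
    obtain ⟨I, c, hc, hbc, hzc⟩ := exists_core_decomposition hω hzw' (by
      rw [map_sub, boundary_boundary, sub_zero]
      have hidx : n + (p + 1) - 1 = 2 * p + 1 + b := by omega
      rw [hidx] at hz2
      exact AugComplex.chains_mono genusIn_le_stage _ hz2)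
    have key : ∀ N ∈ I, ∃ h, (relClass (stdSimplex N.1 * c N) h : EOne ω n (p + 1)) ∈
        LinearMap.range (comparisonSum hω hnd hdim p) := fun N hN =>
      relClass_stdSimplex_mul_mem_range hω hnd hdim hb.symm N.2.1 (N.2.2.trans hA.symm) (hc N)
        (hbc N hN)
    choose h hr using key
    have hsum : ∑ N ∈ I, stdSimplex N.1 * c N ∈ relCycles (genusFiltration ω (p + 1 + 1))
        (genusFiltration ω (p + 1)) (n + (p + 1)) := Submodule.sum_mem _ h
    have heq : relClass z hz = relClass _ hsum := by
      rw [relClass_eq_iff, mem_relBoundaries]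
      refine ⟨w, ?_, z - boundary w - ∑ N ∈ I, stdSimplex N.1 * c N, ?_, by abel⟩
      · rwa [genusFiltration_chains]
      · rw [genusFiltration_chains]
        have := AugComplex.chains_mono (stage_le_genusIn_of_lt hω (by omega)) _ hzc
        have hidx : 2 * p + 1 + 1 + b = n + (p + 1) := by omega
        rwa [hidx] at this
    have hsum' : relClass _ hsum = ∑ N : I, (relClass (stdSimplex N.1.1 * c N.1) (h N.1 N.2) :
        EOne ω n (p + 1)) := by
      have h1 : (⟨_, hsum⟩ : ↥(relCycles (genusFiltration ω (p + 1 + 1))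
          (genusFiltration ω (p + 1)) (n + (p + 1)))) =
          ∑ N : I, ⟨stdSimplex N.1.1 * c N.1, h N.1 N.2⟩ := by
        refine Subtype.ext ?_
        rw [AddSubmonoidClass.coe_finsetSum]
        exact (Finset.sum_coe_sort I fun N => stdSimplex N.1 * c N).symm
      have h2 := congrArg (relMk (genusFiltration ω (p + 1 + 1))
          (genusFiltration ω (p + 1)) (n + (p + 1))) h1
      rw [map_sum] at h2
      exact h2
    rw [heq, hsum']
    exact Submodule.sum_mem _ fun N _ => hr N.1 N.2
  · -- there are no subspaces of genus `p + 1 > n`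
    have h0 : relClass z hz = (0 : EOne ω n (p + 1)) := by
      rw [relClass_eq_zero_iff, mem_relBoundaries]
      refine ⟨0, Submodule.zero_mem _, z, ?_, by rw [map_zero, zero_add]⟩
      refine AugComplex.chains_mono (X := genusFiltration ω (p + 1 + 1))
        (Y := genusFiltration ω (p + 1)) (fun σ hσ => ⟨hσ.1, ?_⟩) _ hz.1
      have h1 := finrank_eq_rad_add_genus hω (sSup σ)
      have h2 := Submodule.finrank_le (sSup σ)
      omega
    rw [h0]
    exact Submodule.zero_mem _

/-! ### Injectivity of the comparison map -/

include hω hnd hdim in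
theorem beta_eq_zero_of_genusFiltration {p k : ℕ} (hk : n + p < k + 1)
    {c : Chains (Submodule K V)} (hc : c ∈ (genusFiltration ω p).chains k) : beta c = 0 := by
  rw [genusFiltration_chains] at hc
  cases p with
  | zero =>
    have : (genusIn ω ⊤ 0).chains k = ⊥ :=
      AugComplex.chains_eq_bot fun l _ _ h => absurd h.2.2 (Nat.not_lt_zero _)
    rw [this, Submodule.mem_bot] at hc
    rw [hc, map_zero]
  | succ p =>
    refine beta_eq_zero_of_finrank_lt _ (d := n + p) (fun U hU => ?_) (by omega) hc
    have h1 := finrank_le_add_genus hω hnd hdim U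
    have h2 : genus ω U < p + 1 := hU.2
    omega

/-- The flags in the subdivision of a relative cycle only depend on its homology class, because of
the bound on the dimension of subspaces of given genus. -/
def betaEOne (p : ℕ) : EOne ω n p →ₗ[ℤ] Chains (Submodule K V) :=
  relLift (beta ∘ₗ Submodule.subtype _) fun c hc h => by
    obtain ⟨e, he, y, hy, rfl⟩ := mem_relBoundaries.1 h
    change beta (boundary e + y) = 0
    rw [map_add, ← boundary_beta, beta_eq_zero_of_genusFiltration hω hnd hdim (by omega) he,
      beta_eq_zero_of_genusFiltration hω hnd hdim (by omega) hy, map_zero, add_zero]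

theorem betaEOne_relClass {p : ℕ} (c hc) :
    betaEOne hω hnd hdim p (relClass c hc) = beta c := rfl

theorem titsBuilding_chains_eq_bot (W : Submodule K V) :
    (titsBuilding W).chains (Module.finrank K W - 1 + 1) = ⊥ :=
  flagComplex_chains_eq_bot (P := Set.Iio W) (d := Module.finrank K W - 1) (fun U hU => by
    have := Submodule.finrank_lt_finrank_of_lt hU
    omega) (Nat.lt_succ_self _)

include hω hnd hdim in
/-- An isotropic subspace of `W^⊥` has at most half the dimension of `W^⊥`. -/
theorem sympTitsBuilding_chains_eq_bot {p : ℕ} (W : SympSubspace ω p) :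
    (sympTitsBuilding ω (ω.orthogonal W.1)).chains
      (Module.finrank K (ω.orthogonal W.1) / 2 + 1) = ⊥ := by
  refine flagComplex_chains_eq_bot (P := isotropicIn ω (ω.orthogonal W.1)) (fun U hU => ?_)
    (Nat.lt_succ_self _)
  have h1 := finrank_le_add_genus hω hnd hdim (W.1 ⊔ U)
  have h2 := Submodule.finrank_sup_add_finrank_inf_eq W.1 U
  have h3 : W.1 ⊓ U = ⊥ := eq_bot_iff.2 ((inf_le_inf_left _ hU.1).trans (W.rad_eq_bot hω).le)
  have h4 := LinearMap.BilinForm.finrank_orthogonal hnd W.1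
  have h5 := W.finrank_eq
  rw [genus_sup_eq hω hU.1 fun x hx y hy => hU.2 y hy x hx, W.genus_eq hω] at h1
  rw [h3, finrank_bot] at h2
  omega

/-- The component in the summand of `W` of an element can be read off from the flags through `W` in
the subdivision of its image. -/
theorem comparisonSum_injective (p : ℕ) :
    Function.Injective (comparisonSum hω hnd hdim p) := by
  classical
  rw [← LinearMap.ker_eq_bot, eq_bot_iff]
  intro x hx
  rw [Submodule.mem_bot]
  refine DirectSum.ext_component ℤ fun W => ?_
  obtain ⟨f, hf, hf'⟩ := exists_injective_flagProduct (W.rad_eq_bot hω)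
    (titsBuilding_chains_eq_bot W.1) (sympTitsBuilding_chains_eq_bot hω hnd hdim W)
  have key : removeLast W.1 ∘ₗ betaEOne hω hnd hdim (p + 1) ∘ₗ comparisonSum hω hnd hdim p =
      (-(-1 : ℤ) ^ (Module.finrank K W.1 - 1 + Module.finrank K (ω.orthogonal W.1) / 2)) •
        (f ∘ₗ DirectSum.component ℤ (SympSubspace ω (p + 1)) (fun W => Summand ω W.1) W) := by
    refine SteinbergSum.hom_ext_lines fun W' a ha b hb => ?_
    have h1 : (removeLast W.1 ∘ₗ betaEOne hω hnd hdim (p + 1) ∘ₗ comparisonSum hω hnd hdim p)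
        (SteinbergSum.of ω W' (steinbergIso W'.1 W'.ne_bot (relClass a ha) ⊗ₜ
          sympSteinbergIso ω (ω.orthogonal W'.1) (relClass b hb))) =
        removeLast W.1 (beta (a * b)) := by
      rw [LinearMap.comp_apply, LinearMap.comp_apply, comparisonSum_of, comparisonSummand_tmul,
        betaEOne_relClass]
    rw [h1]
    by_cases h : W' = W
    · subst h
      rw [removeLast_beta_mul hω (W'.rad_eq_bot hω) W'.ne_bot ha.1 (mem_relCycles_void.1 hb).1]
      have h2 : DirectSum.component ℤ (SympSubspace ω (p + 1)) (fun W => Summand ω W.1) W'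
          (SteinbergSum.of ω W' (steinbergIso W'.1 W'.ne_bot (relClass a ha) ⊗ₜ
          sympSteinbergIso ω (ω.orthogonal W'.1) (relClass b hb))) =
          steinbergIso W'.1 W'.ne_bot (relClass a ha) ⊗ₜ
          sympSteinbergIso ω (ω.orthogonal W'.1) (relClass b hb) :=
        DirectSum.component.lof_self ℤ W' _
      rw [LinearMap.smul_apply, LinearMap.comp_apply, h2, steinbergIso_relClass,
        sympSteinbergIso_relClass, hf', neg_mul, smul_neg, neg_smul, neg_neg]
    · have h2 : DirectSum.component ℤ (SympSubspace ω (p + 1)) (fun W => Summand ω W.1) W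
          (SteinbergSum.of ω W' (steinbergIso W'.1 W'.ne_bot (relClass a ha) ⊗ₜ
          sympSteinbergIso ω (ω.orthogonal W'.1) (relClass b hb))) = 0 :=
        DirectSum.of_eq_of_ne _ _ _ (Ne.symm h)
      rw [LinearMap.smul_apply, LinearMap.comp_apply, h2, map_zero, smul_zero]
      refine removeLast_beta_mul_of_ne hω (W.rad_eq_bot hω) (fun hle => h ?_) ha.1
        (mem_relCycles_void.1 hb).1
      exact (SympSubspace.ext (Submodule.eq_of_le_of_finrank_eq hle
        (W.finrank_eq.trans W'.finrank_eq.symm))).symm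
  have h := LinearMap.congr_fun key x
  rw [LinearMap.comp_apply, LinearMap.comp_apply, LinearMap.mem_ker.1 hx, map_zero, map_zero,
    LinearMap.smul_apply, LinearMap.comp_apply] at h
  have h' : f (DirectSum.component ℤ (SympSubspace ω (p + 1)) (fun W => Summand ω W.1) W x) =
      0 := by
    rcases neg_one_pow_eq_or ℤ
      (Module.finrank K W.1 - 1 + Module.finrank K (ω.orthogonal W.1) / 2) with h1 | h1 <;>
      simpa [h1] using h.symm
  rw [map_zero]
  exact hf (h'.trans (map_zero f).symm)

end Comparison

/-! ### The comparison isomorphism and its equivariance -/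

section RelHomologyCongr

variable {S : Type*} {X Y X' Y' : AugComplex S} {k k' : ℕ}

theorem mem_relCycles_congr (hX : ∀ σ, X.IsFace σ ↔ X'.IsFace σ)
    (hY : ∀ σ, Y.IsFace σ ↔ Y'.IsFace σ) (hk : k = k') {c : Chains S} (hc : c ∈ relCycles X Y k) :
    c ∈ relCycles X' Y' k' := by
  subst hk
  exact mem_relCycles.2 ⟨AugComplex.chains_mono (fun σ => (hX σ).1) _ hc.1,
    AugComplex.chains_mono (fun σ => (hY σ).1) _ hc.2⟩

theorem isSimplicial_id (hX : ∀ σ, X.IsFace σ ↔ X'.IsFace σ) : IsSimplicial id X X' :=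
  fun σ hσ => by rwa [Set.image_id, ← hX]

/-- Pairs with the same simplices have the same homology. -/
def relHomologyCongr (hX : ∀ σ, X.IsFace σ ↔ X'.IsFace σ) (hY : ∀ σ, Y.IsFace σ ↔ Y'.IsFace σ)
    (hk : k = k') : RelHomology X Y k ≃ₗ[ℤ] RelHomology X' Y' k' :=
  LinearEquiv.ofLinearMap (homologyMap id (isSimplicial_id hX) (isSimplicial_id hY) hk)
    (homologyMap id (isSimplicial_id fun σ => (hX σ).symm) (isSimplicial_id fun σ => (hY σ).symm)
      hk.symm)
    (relHomology_ext fun c hc => by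
      refine (relClass_congr ?_ _ _ : relClass (chainMap id (chainMap id c)) _ = relClass c hc)
      rw [chainMap_id, chainMap_id])
    (relHomology_ext fun c hc => by
      refine (relClass_congr ?_ _ _ : relClass (chainMap id (chainMap id c)) _ = relClass c hc)
      rw [chainMap_id, chainMap_id])

theorem relHomologyCongr_relClass (hX : ∀ σ, X.IsFace σ ↔ X'.IsFace σ)
    (hY : ∀ σ, Y.IsFace σ ↔ Y'.IsFace σ) (hk : k = k') {c : Chains S} (hc : c ∈ relCycles X Y k) :
    relHomologyCongr hX hY hk (relClass c hc) =
      relClass c (mem_relCycles_congr hX hY hk hc) :=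
  relClass_congr (chainMap_id c) _ _

end RelHomologyCongr

section ComparisonEquiv

variable {K V : Type*} [Field K] [AddCommGroup V] [Module K V] {ω : LinearMap.BilinForm K V}

theorem top_ne_bot_of_finrank {n : ℕ} (hn : 1 ≤ n)
    (hdim : Module.finrank K V = 2 * n) : (⊤ : Submodule K V) ≠ ⊥ := by
  intro h
  have h1 := finrank_top K V
  rw [h, finrank_bot] at h1
  omega

open scoped Pointwise

/-- The action of `g ∈ Sp(V)` on the lattice of subspaces. -/
def smulOrderIso (g : Sp ω) : Submodule K V ≃o Submodule K V where
  toFun U := g • U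
  invFun U := g⁻¹ • U
  left_inv U := inv_smul_smul g U
  right_inv U := smul_inv_smul g U
  map_rel_iff' {U U'} := ⟨fun h => by
    have := smul_le_smul ω g⁻¹ h
    change g⁻¹ • g • U ≤ g⁻¹ • g • U' at this
    rwa [inv_smul_smul, inv_smul_smul] at this, smul_le_smul ω g⟩

theorem beta_smul (g : Sp ω) (c : Chains (Submodule K V)) :
    beta (chainMap (g • ·) c) = chainMap (g • ·) (beta c) :=
  beta_chainMap (smulOrderIso g) c

theorem smul_neg_beta_boundary (g : Sp ω) (a : Chains (Submodule K V)) :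
    chainMap (g • ·) (-beta (boundary a)) = -beta (boundary (chainMap (g • ·) a)) := by
  rw [map_neg, ← beta_smul, chainMap_boundary]

theorem sSup_smul (g : Sp ω) (σ : Set (Submodule K V)) :
    sSup ((g • ·) '' σ) = g • sSup σ := by
  change sSup (smulOrderIso g '' σ) = smulOrderIso g (sSup σ)
  rw [sSup_image, map_sSup, sSup_image]

theorem linesLe_smul (g : Sp ω) (W : Submodule K V) :
    IsSimplicial (g • ·) (linesLe W) (linesLe (g • W)) := by
  rintro σ ⟨h1, h2⟩
  refine ⟨?_, ?_⟩
  · rintro _ ⟨L, hL, rfl⟩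
    exact (finrank_smul ω g L).trans (h1 L hL)
  · rw [sSup_smul]
    exact smul_le_smul ω g h2

theorem linesLt_smul (g : Sp ω) (W : Submodule K V) :
    IsSimplicial (g • ·) (linesLt W) (linesLt (g • W)) := by
  rintro σ ⟨h1, h2⟩
  refine ⟨?_, ?_⟩
  · rintro _ ⟨L, hL, rfl⟩
    exact (finrank_smul ω g L).trans (h1 L hL)
  · rw [sSup_smul]
    exact smul_lt_smul ω g h2

theorem isoLines_smul (g : Sp ω) {W W' : Submodule K V} (h : g • W ≤ W') :
    IsSimplicial (g • ·) (isoLines ω W) (isoLines ω W') := by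
  rintro σ ⟨h1, h2⟩
  refine ⟨?_, ?_⟩
  · rintro _ ⟨L, hL, rfl⟩
    exact (finrank_smul ω g L).trans (h1 L hL)
  · rw [sSup_smul]
    refine ⟨(smul_le_smul ω g h2.1).trans h, ?_⟩
    rintro _ ⟨x, hx, rfl⟩ _ ⟨y, hy, rfl⟩
    exact (Sp.form_smul g x y).trans (h2.2 x hx y hy)

variable [FiniteDimensional K V]

theorem isoLines_top_iff (hω : ω.IsAlt) (σ : Set (Submodule K V)) :
    (isoLines ω ⊤).IsFace σ ↔ (genusFiltration ω 1).IsFace σ :=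
  and_congr_right fun _ => ⟨fun h => (isotropic_iff_genus hω).1 h.2,
    fun h => ⟨le_top, (isotropic_iff_genus hω).2 h⟩⟩

theorem void_iff (σ : Set (Submodule K V)) :
    (AugComplex.void (Submodule K V)).IsFace σ ↔ (genusFiltration ω 0).IsFace σ :=
  ⟨False.elim, fun h => Nat.not_lt_zero _ h.2⟩

theorem genus_top (hω : ω.IsAlt) (hnd : ω.Nondegenerate) {n : ℕ}
    (hdim : Module.finrank K V = 2 * n) : genus ω (⊤ : Submodule K V) = n := by
  have h := finrank_eq_of_rad_eq_bot hω (rad_top hnd)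
  rw [finrank_top] at h
  omega

theorem linesLe_top_iff (hω : ω.IsAlt) (hnd : ω.Nondegenerate) {n : ℕ}
    (hdim : Module.finrank K V = 2 * n) (σ : Set (Submodule K V)) :
    (linesLe (⊤ : Submodule K V)).IsFace σ ↔ (genusFiltration ω (n + 1)).IsFace σ := by
  refine and_congr_right fun _ => ⟨fun _ => ?_, fun _ => Set.mem_Iic.2 le_top⟩
  have := genus_mono ω (le_top : sSup σ ≤ ⊤)
  rw [genus_top hω hnd hdim] at this
  omega

theorem linesLt_top_iff (hω : ω.IsAlt) (hnd : ω.Nondegenerate) {n : ℕ}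
    (hdim : Module.finrank K V = 2 * n) (σ : Set (Submodule K V)) :
    (linesLt (⊤ : Submodule K V)).IsFace σ ↔ (genusFiltration ω n).IsFace σ := by
  refine and_congr_right fun _ => ⟨fun h => ?_, fun h => ?_⟩
  · have := genus_lt_of_lt hω (rad_top hnd) h
    rwa [genus_top hω hnd hdim] at this
  · refine Set.mem_Iio.2 (lt_top_iff_ne_top.2 fun h' => ?_)
    rw [h', genus_top hω hnd hdim] at h
    exact lt_irrefl _ h

/-- The isomorphism of the terms of the resolution with the groups `E¹`. For `p = 0` it is the
description of `St^ω(V)` in terms of isotropic lines, for `p > 0` it is given by joins. -/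
def comparison (hω : ω.IsAlt) (hnd : ω.Nondegenerate) {n : ℕ}
    (hdim : Module.finrank K V = 2 * n) : ∀ p : ℕ, Term ω p ≃ₗ[ℤ] EOne ω n p
  | 0 => (sympSteinbergIso ω ⊤).symm ≪≫ₗ
      relHomologyCongr (isoLines_top_iff hω) void_iff (by rw [finrank_top, hdim]; omega)
  | p + 1 => LinearEquiv.ofBijective (comparisonSum hω hnd hdim p)
      ⟨comparisonSum_injective hω hnd hdim p, comparisonSum_surjective hω hnd hdim p⟩

theorem comparison_zero (hω : ω.IsAlt) (hnd : ω.Nondegenerate) {n : ℕ}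
    (hdim : Module.finrank K V = 2 * n) {b : Chains (Submodule K V)}
    (hb : b ∈ relCycles (isoLines ω ⊤) (AugComplex.void _)
      (Module.finrank K (⊤ : Submodule K V) / 2)) :
    ∃ h, comparison hω hnd hdim 0 (sympSteinbergIso ω ⊤ (relClass b hb)) = relClass b h := by
  refine ⟨mem_relCycles_congr (isoLines_top_iff hω) void_iff
    (by rw [finrank_top, hdim]; omega) hb, ?_⟩
  have h : ∀ x, comparison hω hnd hdim 0 x = relHomologyCongr (isoLines_top_iff hω) void_iff
    (by rw [finrank_top, hdim]; omega) ((sympSteinbergIso ω ⊤).symm x) := fun _ => rfl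
  refine (h _).trans ?_
  rw [LinearEquiv.symm_apply_apply, relHomologyCongr_relClass]

theorem comparison_succ (hω : ω.IsAlt) (hnd : ω.Nondegenerate) {n : ℕ}
    (hdim : Module.finrank K V = 2 * n) {p : ℕ} (W : SympSubspace ω (p + 1))
    {a b : Chains (Submodule K V)}
    (ha : a ∈ relCycles (linesLe W.1) (linesLt W.1) (Module.finrank K W.1 - 1 + 1))
    (hb : b ∈ relCycles (isoLines ω (ω.orthogonal W.1)) (AugComplex.void _)
      (Module.finrank K (ω.orthogonal W.1) / 2)) :
    comparison hω hnd hdim (p + 1)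
      (SteinbergSum.of ω W (steinbergIso W.1 W.ne_bot (relClass a ha) ⊗ₜ
        sympSteinbergIso ω (ω.orthogonal W.1) (relClass b hb))) =
      relClass (a * b) (mul_mem_eOne hω hnd hdim W ha hb) :=
  (comparisonSum_of hω hnd hdim W _).trans (comparisonSummand_tmul hω hnd hdim W ha hb)

theorem Steinberg.map_steinbergIso (g : Sp ω) {W : Submodule K V} (hW : W ≠ ⊥)
    {a : Chains (Submodule K V)}
    (ha : a ∈ relCycles (linesLe W) (linesLt W) (Module.finrank K W - 1 + 1)) :
    ∃ h, Steinberg.map ω g W (steinbergIso W hW (relClass a ha)) =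
      steinbergIso (g • W) (smul_ne_bot ω g hW) (relClass (chainMap (g • ·) a) h) := by
  refine ⟨chainMap_mem_relCycles (linesLe_smul g W) (linesLt_smul g W)
    (by rw [finrank_smul]) ha, ?_⟩
  exact relClass_congr (smul_neg_beta_boundary g a) _ _

theorem SympSteinberg.mapPerp_sympSteinbergIso (g : Sp ω) {W : Submodule K V}
    {b : Chains (Submodule K V)}
    (hb : b ∈ relCycles (isoLines ω (ω.orthogonal W)) (AugComplex.void _)
      (Module.finrank K (ω.orthogonal W) / 2)) :
    ∃ h, SympSteinberg.mapPerp ω g W (sympSteinbergIso ω _ (relClass b hb)) =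
      sympSteinbergIso ω _ (relClass (chainMap (g • ·) b) h) := by
  refine ⟨chainMap_mem_relCycles (isoLines_smul g (smul_orthogonal ω g W).le) (isSimplicial_void _)
    (by rw [← smul_orthogonal, finrank_smul]) hb, ?_⟩
  exact relClass_congr (beta_smul g b).symm _ _

theorem comparison_equivariant (hω : ω.IsAlt) (hnd : ω.Nondegenerate) {n : ℕ}
    (hdim : Module.finrank K V = 2 * n) (p : ℕ) (g : Sp ω) (x : Term ω p) :
    comparison hω hnd hdim p (termRep ω p g x) =
      eOneRep ω n p g (comparison hω hnd hdim p x) := by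
  cases p with
  | zero =>
    obtain ⟨x, rfl⟩ := (sympSteinbergIso ω ⊤).surjective x
    obtain ⟨b, hb, rfl⟩ := relClass_surjective x
    have hb' : chainMap (g • ·) b ∈ relCycles (isoLines ω ⊤) (AugComplex.void _)
        (Module.finrank K (⊤ : Submodule K V) / 2) :=
      chainMap_mem_relCycles (isoLines_smul g le_top) (isSimplicial_void _) rfl hb
    have h1 : termRep ω 0 g (sympSteinbergIso ω ⊤ (relClass b hb)) =
        sympSteinbergIso ω ⊤ (relClass (chainMap (g • ·) b) hb') :=
      relClass_congr (beta_smul g b).symm _ _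
    obtain ⟨h2, h3⟩ := comparison_zero hω hnd hdim hb
    obtain ⟨h4, h5⟩ := comparison_zero hω hnd hdim hb'
    rw [h1, h3, h5]
    rfl
  | succ p =>
    have h : comparisonSum hω hnd hdim p ∘ₗ SteinbergSum.map ω (p + 1) g =
        eOneRep ω n (p + 1) g ∘ₗ comparisonSum hω hnd hdim p := by
      refine SteinbergSum.hom_ext_lines fun W a ha b hb => ?_
      obtain ⟨ha', h1⟩ := Steinberg.map_steinbergIso g W.ne_bot ha
      obtain ⟨hb', h2⟩ := SympSteinberg.mapPerp_sympSteinbergIso g hb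
      rw [LinearMap.comp_apply, LinearMap.comp_apply, SteinbergSum.map_of, h1, h2,
        comparisonSum_of, comparisonSum_of, comparisonSummand_tmul]
      refine (comparisonSummand_tmul hω hnd hdim (g • W) ha' hb').trans ?_
      exact relClass_congr (chainMap_mul _ _ _).symm _ _
    exact LinearMap.congr_fun h x

/-- The isomorphism of `St(V)` with the term of degree `n`: in terms of lines, `St(V)` is the
homology of all sets of lines relative to those that do not span `V`, and these are the sets of genus
at most `n` and less than `n`. -/
def steinbergEquivTerm (hω : ω.IsAlt) (hnd : ω.Nondegenerate) {n : ℕ} (hn : 1 ≤ n)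
    (hdim : Module.finrank K V = 2 * n) : Steinberg (⊤ : Submodule K V) ≃ₗ[ℤ] Term ω n :=
  (steinbergIso ⊤ (top_ne_bot_of_finrank hn hdim)).symm ≪≫ₗ
    relHomologyCongr (linesLe_top_iff hω hnd hdim) (linesLt_top_iff hω hnd hdim)
      (by rw [finrank_top, hdim]; omega : _ = n + n) ≪≫ₗ (comparison hω hnd hdim n).symm

theorem comparison_steinbergEquivTerm (hω : ω.IsAlt) (hnd : ω.Nondegenerate) {n : ℕ} (hn : 1 ≤ n)
    (hdim : Module.finrank K V = 2 * n) {a : Chains (Submodule K V)}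
    (ha : a ∈ relCycles (linesLe ⊤) (linesLt ⊤)
      (Module.finrank K (⊤ : Submodule K V) - 1 + 1)) :
    ∃ h, comparison hω hnd hdim n (steinbergEquivTerm hω hnd hn hdim
      (steinbergIso ⊤ (top_ne_bot_of_finrank hn hdim) (relClass a ha))) = relClass a h := by
  refine ⟨mem_relCycles_congr (linesLe_top_iff hω hnd hdim) (linesLt_top_iff hω hnd hdim)
    (by rw [finrank_top, hdim]; omega) ha, ?_⟩
  rw [steinbergEquivTerm, LinearEquiv.trans_apply, LinearEquiv.trans_apply,
    LinearEquiv.apply_symm_apply, LinearEquiv.symm_apply_apply, relHomologyCongr_relClass]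

theorem steinbergEquivTerm_equivariant (hω : ω.IsAlt) (hnd : ω.Nondegenerate) {n : ℕ} (hn : 1 ≤ n)
    (hdim : Module.finrank K V = 2 * n) (g : Sp ω) (x : Steinberg (⊤ : Submodule K V)) :
    steinbergEquivTerm hω hnd hn hdim (steinbergRep ω g x) =
      termRep ω n g (steinbergEquivTerm hω hnd hn hdim x) := by
  refine (comparison hω hnd hdim n).injective ?_
  obtain ⟨x, rfl⟩ := (steinbergIso ⊤ (top_ne_bot_of_finrank hn hdim)).surjective x
  obtain ⟨a, ha, rfl⟩ := relClass_surjective x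
  have ha' : chainMap (g • ·) a ∈ relCycles (linesLe ⊤) (linesLt ⊤)
      (Module.finrank K (⊤ : Submodule K V) - 1 + 1) := by
    refine chainMap_mem_relCycles ?_ ?_ rfl ha
    · simpa only [smul_top_eq] using linesLe_smul g (⊤ : Submodule K V)
    · simpa only [smul_top_eq] using linesLt_smul g (⊤ : Submodule K V)
  have h1 : steinbergRep ω g (steinbergIso ⊤ (top_ne_bot_of_finrank hn hdim) (relClass a ha)) =
      steinbergIso ⊤ (top_ne_bot_of_finrank hn hdim) (relClass (chainMap (g • ·) a) ha') := by
    exact relClass_congr (smul_neg_beta_boundary g a) _ _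
  obtain ⟨h2, h3⟩ := comparison_steinbergEquivTerm hω hnd hn hdim ha
  obtain ⟨h4, h5⟩ := comparison_steinbergEquivTerm hω hnd hn hdim ha'
  rw [comparison_equivariant, h1, h5, h3]
  rfl

end ComparisonEquiv

/-! ### Apartment classes in terms of lines -/

section Apartments

variable {K V : Type*} [Field K] [AddCommGroup V] [Module K V] {ω : LinearMap.BilinForm K V}

theorem sSup_span_image {ι : Type*} (w : ι → V) (s : Set ι) :
    sSup ((fun i => Submodule.span K {w i}) '' s) = Submodule.span K (w '' s) := by
  refine le_antisymm (sSup_le ?_) (Submodule.span_le.2 ?_)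
  · rintro _ ⟨i, hi, rfl⟩
    exact Submodule.span_mono (Set.singleton_subset_iff.2 ⟨i, hi, rfl⟩)
  · rintro _ ⟨i, hi, rfl⟩
    have h : Submodule.span K {w i} ≤ sSup ((fun i => Submodule.span K {w i}) '' s) :=
      le_sSup ⟨i, hi, rfl⟩
    exact h (Submodule.mem_span_singleton_self _)

theorem sSup_span_list (v : List V) :
    sSup {L | L ∈ v.map fun x => Submodule.span K {x}} = Submodule.span K {x | x ∈ v} := by
  have h : {L | L ∈ v.map fun x => Submodule.span K {x}} =
      (fun x : V => Submodule.span K {x}) '' {x | x ∈ v} := by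
    ext
    simp
  rw [h, sSup_span_image (fun x : V => x), Set.image_id']

theorem supFlag_span {m n : ℕ} (w : Fin m → V) (i : Fin n) :
    supFlag (fun j => Submodule.span K {w j}) i = Submodule.span K (w '' {j | (j : ℕ) ≤ i}) :=
  sSup_span_image _ _

theorem injective_span_of_linearIndependent {ι : Type*} {w : ι → V} (h : LinearIndependent K w) :
    Function.Injective fun i => Submodule.span K {w i} := by
  intro i j hij
  by_contra hne
  refine h.notMem_span_image (s := {j}) (x := i) (by simpa using hne) ?_
  rw [Set.image_singleton, ← (show Submodule.span K {w i} = Submodule.span K {w j} from hij)]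
  exact Submodule.mem_span_singleton_self _

theorem apartmentChain_eq {v : List V} (h : LinearIndependent K v.get) (heven : Even v.length)
    (hpos : 1 ≤ v.length) :
    apartmentChain v = -beta (boundary (simplex (v.map fun x => Submodule.span K {x}))) := by
  have hv : v.map (fun x => Submodule.span K {x}) =
      List.ofFn fun i => Submodule.span K {v.get i} := by
    conv_lhs => rw [← List.ofFn_get v, List.map_ofFn]
    rfl
  have hodd : Odd (v.length - 1) := Nat.Even.sub_odd hpos heven odd_one
  rw [hv, beta_boundary_ofFn hpos _ (injective_span_of_linearIndependent h), hodd.neg_one_pow,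
    neg_smul, one_smul, neg_neg, apartmentChain]
  simp only [supFlag_span]

theorem IsSympBasisOf.pick_ne_zero {u : List (V × V)} {W : Submodule K V}
    (h : IsSympBasisOf ω u W) (ε : Fin u.length → Bool) (i : Fin u.length) : pick u ε i ≠ 0 := by
  have hne := h.1 (u.get i) (List.get_mem _ _)
  intro h0
  unfold pick at h0
  split_ifs at h0
  · exact hne (by rw [h0, map_zero])
  · exact hne (by rw [h0, map_zero, LinearMap.zero_apply])

theorem IsSympBasisOf.injective_span (hω : ω.IsAlt) {u : List (V × V)} {W : Submodule K V}
    (h : IsSympBasisOf ω u W) (ε : Fin u.length → Bool) :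
    Function.Injective fun i => Submodule.span K {pick u ε i} := by
  intro i j hij
  by_contra hne
  have h1 : pick u ε i ∈ Submodule.span K {pick u ε j} := by
    rw [← (show Submodule.span K {pick u ε i} = Submodule.span K {pick u ε j} from hij)]
    exact Submodule.mem_span_singleton_self _
  obtain ⟨c, hc⟩ := Submodule.mem_span_singleton.1 h1
  have h2 : ω (pick u ε i) (pick u (fun k => !ε k) i) = 0 := by
    rw [← hc, map_smul, LinearMap.smul_apply, h.form_eq_zero hω (Ne.symm hne), smul_zero]
  have h3 := h.1 (u.get i) (List.get_mem _ _)
  unfold pick at h2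
  cases hε : ε i
  · simp only [hε, Bool.false_eq_true, if_false, Bool.not_false, if_true] at h2
    exact h3 h2
  · simp only [hε, if_true, Bool.not_true, Bool.false_eq_true, if_false] at h2
    exact h3 (hω.eq_iff.1 h2)

variable (K) in
/-- The chain `([⟨e₁⟩] - [⟨f₁⟩]) * ⋯ * ([⟨e_m⟩] - [⟨f_m⟩])`, the boundary of a cross-polytope. -/
def crossChain (u : List (V × V)) : Chains (Submodule K V) :=
  (u.map fun a => simplex [Submodule.span K {a.1}] - simplex [Submodule.span K {a.2}]).prod

theorem crossChain_cons (a : V × V) (u : List (V × V)) :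
    crossChain K (a :: u) = (simplex [Submodule.span K {a.1}] - simplex [Submodule.span K {a.2}]) *
      crossChain K u := by
  rw [crossChain, List.map_cons, List.prod_cons, crossChain]

theorem lineChain_eq (v : List V) (u : List (V × V)) :
    lineChain K v u = simplex (v.map fun x => Submodule.span K {x}) * crossChain K u := rfl

theorem boundary_crossChain (u : List (V × V)) : boundary (crossChain K u) = 0 := by
  induction u with
  | nil =>
    rw [crossChain, List.map_nil, List.prod_nil, ← simplex_nil, boundary_simplex]
    simp
  | cons a u ih =>
    rw [crossChain_cons, sub_mul, map_sub, boundary_singleton_mul, boundary_singleton_mul, ih]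
    simp

theorem crossChain_eq_sum (u : List (V × V)) :
    crossChain K u = ∑ ε : Fin u.length → Bool, (∏ i, if ε i then (-1 : ℤ) else 1) •
      simplex (List.ofFn fun i => Submodule.span K {pick u ε i}) := by
  have h : crossChain K u = (List.ofFn fun i => simplex [Submodule.span K {(u.get i).1}] -
      simplex [Submodule.span K {(u.get i).2}]).prod := by
    rw [crossChain]
    conv_lhs => rw [← List.ofFn_get u, List.map_ofFn]
    rfl
  rw [h, prod_sub_simplex]
  refine Finset.sum_congr rfl fun ε _ => ?_
  congr 4
  funext i
  unfold pick
  split_ifs <;> rfl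

theorem sympApartmentChain_eq (hω : ω.IsAlt) {u : List (V × V)} {W : Submodule K V}
    (h : IsSympBasisOf ω u W) : sympApartmentChain u = beta (crossChain K u) := by
  rw [crossChain_eq_sum, map_sum, sympApartmentChain, Finset.sum_comm]
  refine Finset.sum_congr rfl fun ε _ => ?_
  rw [map_smul, beta_ofFn _ (h.injective_span hω ε), Finset.smul_sum]
  refine Finset.sum_congr rfl fun σ _ => ?_
  rw [smul_smul, mul_comm]
  simp only [supFlag_span]

/-- The vertices of a facet of the cross-polytope are pairwise orthogonal. -/
theorem crossChain_mem (hω : ω.IsAlt) {u : List (V × V)} {W : Submodule K V}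
    (h : IsSympBasisOf ω u W) : crossChain K u ∈ (isoLines ω W).chains u.length := by
  rw [crossChain_eq_sum]
  refine Submodule.sum_mem _ fun ε _ => Submodule.smul_mem _ _
    (AugComplex.simplex_mem_chains List.length_ofFn ?_)
  have hset : {s | s ∈ List.ofFn fun i => Submodule.span K {pick u ε i}} =
      (fun i => Submodule.span K {pick u ε i}) '' Set.univ := by
    rw [Set.image_univ]
    ext
    exact List.mem_ofFn' _ _
  refine ⟨fun L hL => ?_, ?_⟩
  · obtain ⟨i, rfl⟩ := (List.mem_ofFn' _ _).1 hL
    exact finrank_span_singleton (h.pick_ne_zero ε i)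
  · rw [hset, sSup_span_image]
    refine ⟨?_, fun x hx y hy => ?_⟩
    · rw [Submodule.span_le, ← h.2.2]
      rintro _ ⟨i, -, rfl⟩
      refine Submodule.subset_span ⟨u.get i, List.get_mem _ _, ?_⟩
      unfold pick
      split_ifs
      · exact Or.inr rfl
      · exact Or.inl rfl
    · induction hx, hy using Submodule.span_induction₂ with
      | mem_mem x y hx hy =>
        obtain ⟨j, -, rfl⟩ := hx
        obtain ⟨k, -, rfl⟩ := hy
        by_cases hjk : j = k
        · rw [hjk]
          exact hω.self_eq_zero _
        · exact h.form_eq_zero hω hjk _ _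
      | zero_left y hy => simp
      | zero_right x hx => simp
      | add_left x y z _ _ _ h1 h2 => simp [h1, h2]
      | add_right x y z _ _ _ h1 h2 => simp [h1, h2]
      | smul_left r x y _ _ h1 => simp [h1]
      | smul_right r x y _ _ h1 => simp [h1]

theorem crossChain_mem_relCycles (hω : ω.IsAlt) {u : List (V × V)} {W : Submodule K V}
    (h : IsSympBasisOf ω u W) :
    crossChain K u ∈ relCycles (isoLines ω W) (AugComplex.void _) (Module.finrank K W / 2) := by
  rw [h.finrank_eq hω, Nat.mul_div_cancel _ two_pos]
  exact mem_relCycles_void.2 ⟨crossChain_mem hω h, boundary_crossChain u⟩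

theorem IsBasisOf.finrank_eq {v : List V} {W : Submodule K V} (h : IsBasisOf v W) :
    Module.finrank K W = v.length := by
  have := finrank_span_eq_card h.1
  rwa [Set.range_list_get, Fintype.card_fin, h.2] at this

theorem IsBasisOf.ne_zero {v : List V} {W : Submodule K V} (h : IsBasisOf v W) {x : V}
    (hx : x ∈ v) : x ≠ 0 := by
  obtain ⟨i, rfl⟩ := List.get_of_mem hx
  exact h.1.ne_zero i

theorem IsBasisOf.finrank_span {v : List V} {W : Submodule K V} (h : IsBasisOf v W)
    {L : Submodule K V} (hL : L ∈ v.map fun x => Submodule.span K {x}) :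
    Module.finrank K L = 1 := by
  obtain ⟨x, hx, rfl⟩ := List.mem_map.1 hL
  exact finrank_span_singleton (h.ne_zero hx)

variable [FiniteDimensional K V]

theorem IsBasisOf.simplex_mem_relCycles {v : List V} {W : Submodule K V} (h : IsBasisOf v W)
    (hW : W ≠ ⊥) : simplex (v.map fun x => Submodule.span K {x}) ∈
      relCycles (linesLe W) (linesLt W) (Module.finrank K W - 1 + 1) := by
  have hpos : Module.finrank K W ≠ 0 := fun h => hW (Submodule.finrank_eq_zero.1 h)
  have hlen : (v.map fun x => Submodule.span K {x}).length = Module.finrank K W - 1 + 1 := by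
    rw [List.length_map, ← h.finrank_eq]
    omega
  have hsup := sSup_span_list (K := K) v
  rw [h.2] at hsup
  refine mem_relCycles.2 ⟨AugComplex.simplex_mem_chains hlen
    ⟨fun L hL => h.finrank_span hL, hsup.le⟩, ?_⟩
  rw [Nat.add_sub_cancel, boundary_simplex]
  refine Submodule.sum_mem _ fun i hi => Submodule.smul_mem _ _ ?_
  have hlen' : ((v.map fun x => Submodule.span K {x}).eraseIdx i).length =
      Module.finrank K W - 1 := by
    rw [List.length_eraseIdx_of_lt (Finset.mem_range.1 hi), hlen, Nat.add_sub_cancel]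
  have hline : ∀ L ∈ (v.map fun x => Submodule.span K {x}).eraseIdx i, Module.finrank K L = 1 :=
    fun L hL => h.finrank_span (List.mem_of_mem_eraseIdx hL)
  refine AugComplex.simplex_mem_chains hlen' ⟨hline, ?_⟩
  have hle : sSup {L | L ∈ (v.map fun x => Submodule.span K {x}).eraseIdx i} ≤ W := by
    rw [← hsup]
    exact sSup_le_sSup fun L hL => List.mem_of_mem_eraseIdx hL
  refine hle.lt_of_ne fun h' => ?_
  have := finrank_sSup_list_le hline
  rw [h', hlen'] at this
  omega

/-- In terms of lines, the apartment class of a basis is the class of the simplex formed by the lines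
of the basis. -/
theorem apartmentClass_eq {v : List V} {W : Submodule K V} (h : IsBasisOf v W) (hW : W ≠ ⊥)
    (heven : Even (Module.finrank K W)) :
    apartmentClass h = steinbergIso W hW (relClass _ (h.simplex_mem_relCycles hW)) := by
  refine relClass_congr ?_ _ _
  have hlen := h.finrank_eq
  rw [hlen] at heven
  refine apartmentChain_eq h.1 heven (Nat.one_le_iff_ne_zero.2 fun h0 => ?_)
  exact hW (Submodule.finrank_eq_zero.1 (hlen.trans h0))

/-- In terms of lines, the symplectic apartment class is the class of the boundary of a
cross-polytope. -/
theorem sympApartmentClass_eq (hω : ω.IsAlt) {u : List (V × V)} {W : Submodule K V}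
    (h : IsSympBasisOf ω u W) :
    sympApartmentClass hω h = sympSteinbergIso ω W (relClass _ (crossChain_mem_relCycles hω h)) :=
  relClass_congr (sympApartmentChain_eq hω h) _ _

theorem comparison_generator (hω : ω.IsAlt) (hnd : ω.Nondegenerate) {n : ℕ}
    (hdim : Module.finrank K V = 2 * n) (p : ℕ) (v : List V) (u : List (V × V))
    (h : IsAdapted ω p v u) :
    ∃ hc : lineChain K v u ∈
        relCycles (genusFiltration ω (p + 1)) (genusFiltration ω p) (n + p),
      comparison hω hnd hdim p (generator hω p v u) = relClass (lineChain K v u) hc := by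
  cases p with
  | zero =>
    have hg : generator hω 0 v u = sympApartmentClass hω h.sympBasis_top := dif_pos h
    have hv : v = [] := by
      obtain ⟨W, hv, -⟩ := h
      refine List.length_eq_zero_iff.1 ?_
      rw [← hv.finrank_eq, W.finrank_eq]
    obtain ⟨hc, h1⟩ := comparison_zero hω hnd hdim (crossChain_mem_relCycles hω h.sympBasis_top)
    have h2 : lineChain K v u = crossChain K u := by
      rw [lineChain_eq, hv, List.map_nil, simplex_nil, one_mul]
    refine ⟨by rw [h2]; exact hc, ?_⟩
    rw [hg, sympApartmentClass_eq]
    exact h1.trans (relClass_congr h2.symm _ _)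
  | succ p =>
    have hg : generator hω (p + 1) v u = SteinbergSum.of ω h.choose
        (apartmentClass h.choose_spec.1 ⊗ₜ sympApartmentClass hω h.choose_spec.2) := dif_pos h
    have heven : Even (Module.finrank K h.choose.1) := by
      rw [h.choose.finrank_eq]
      exact even_two_mul _
    rw [hg, apartmentClass_eq _ h.choose.ne_bot heven, sympApartmentClass_eq]
    exact ⟨_, comparison_succ hω hnd hdim h.choose _ _⟩

end Apartments

/-! ### Exactness -/

section Exactness

variable {K V : Type*} [Field K] [AddCommGroup V] [Module K V] [FiniteDimensional K V]
  {ω : LinearMap.BilinForm K V}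

/-- The complex of lines spanning subspaces of genus at most `p ≤ n` has no homology below degree
`n + p`. -/
theorem genusFiltration_exists_boundary_eq (hω : ω.IsAlt) (hnd : ω.Nondegenerate) {n : ℕ}
    (hdim : Module.finrank K V = 2 * n) {p k : ℕ} (hp : p ≤ n) (hk : k < n + p)
    {c : Chains (Submodule K V)} (hc : c ∈ (genusFiltration ω (p + 1)).chains k)
    (hb : boundary c = 0) :
    ∃ e ∈ (genusFiltration ω (p + 1)).chains (k + 1), boundary e = c := by
  rw [genusFiltration_chains] at hc ⊢
  exact genusIn_exists_boundary_eq hω (rad_top hnd) (by rw [finrank_top, hdim]) hp hk hc hb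

/-- Subspaces of genus less than `p` have dimension less than `n + p`, so the homology of their
complex of lines vanishes in degrees at least `n + p`. -/
theorem genusFiltration_exists_boundary_eq_of_le (hω : ω.IsAlt) (hnd : ω.Nondegenerate) {n : ℕ}
    (hdim : Module.finrank K V = 2 * n) {p k : ℕ} (hk : n + p ≤ k)
    {c : Chains (Submodule K V)} (hc : c ∈ (genusFiltration ω p).chains k) (hb : boundary c = 0) :
    ∃ e ∈ (genusFiltration ω p).chains (k + 1), boundary e = c := by
  rw [genusFiltration_chains] at hc ⊢
  cases p with
  | zero =>
    have : (genusIn ω ⊤ 0).chains k = ⊥ :=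
      AugComplex.chains_eq_bot fun l _ _ h => absurd h.2.2 (Nat.not_lt_zero _)
    rw [this, Submodule.mem_bot] at hc
    exact ⟨0, Submodule.zero_mem _, by rw [hc, map_zero]⟩
  | succ p =>
    refine lineComplex_exists_boundary_eq _ (d := n + p) (fun U hU => ?_) (by omega) hc hb
    have h1 := finrank_le_add_genus hω hnd hdim U
    have h2 : genus ω U < p + 1 := hU.2
    omega

theorem genusFiltration_mono {p q : ℕ} (h : p ≤ q) (σ : Set (Submodule K V))
    (hσ : (genusFiltration ω p).IsFace σ) : (genusFiltration ω q).IsFace σ :=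
  ⟨hσ.1, hσ.2.trans_le h⟩

/-- A class killed by the connecting homomorphism is represented, up to chains of lower genus, by
an absolute cycle. -/
theorem exists_cycle_of_dOne_eq_zero (hω : ω.IsAlt) (hnd : ω.Nondegenerate) {n : ℕ}
    (hdim : Module.finrank K V = 2 * n) {p : ℕ} {c : Chains (Submodule K V)}
    (hc : c ∈ relCycles (genusFiltration ω (p + 2)) (genusFiltration ω (p + 1)) (n + (p + 1)))
    (h : dOne ω n p (relClass c hc) = 0) :
    ∃ z ∈ (genusFiltration ω (p + 1)).chains (n + (p + 1)), boundary (c - z) = 0 := by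
  have hbc : boundary c ∈ relCycles (genusFiltration ω (p + 1)) (genusFiltration ω p) (n + p) :=
    mem_relCycles.2 ⟨hc.2, by
      rw [boundary_boundary]
      exact Submodule.zero_mem _⟩
  have h' : relClass (boundary c) hbc = (0 : EOne ω n p) := h
  obtain ⟨e, he, y, hy, hey⟩ := mem_relBoundaries.1 ((relClass_eq_zero_iff hbc).1 h')
  have hby : boundary y = 0 := by
    have := congrArg boundary hey
    rwa [map_add, boundary_boundary, boundary_boundary, zero_add] at this
  obtain ⟨f, hf, hfy⟩ := genusFiltration_exists_boundary_eq_of_le hω hnd hdim le_rfl hy hby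
  refine ⟨e + f, Submodule.add_mem _ he
    (AugComplex.chains_mono (genusFiltration_mono (Nat.le_succ p)) _ hf), ?_⟩
  rw [map_sub, map_add, hfy, hey, sub_self]

/-- The absolute cycle of `exists_cycle_of_dOne_eq_zero` is a boundary, since all sets of lines of `V`
form a cone. -/
theorem dOne_injective (hω : ω.IsAlt) (hnd : ω.Nondegenerate) {n : ℕ} (hn : 1 ≤ n)
    (hdim : Module.finrank K V = 2 * n) {p : ℕ} (hp : p + 1 = n) :
    Function.Injective (dOne ω n p) := by
  rw [← LinearMap.ker_eq_bot, eq_bot_iff]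
  intro x hx
  obtain ⟨c, hc, rfl⟩ := relClass_surjective x
  obtain ⟨z, hz, hcz⟩ := exists_cycle_of_dOne_eq_zero hω hnd hdim hc hx
  have htop : ∀ k, (genusFiltration ω (p + 2)).chains k =
      (linesLe (⊤ : Submodule K V)).chains k := by
    intro k
    subst hp
    exact le_antisymm (AugComplex.chains_mono (fun σ => (linesLe_top_iff hω hnd hdim σ).2) k)
      (AugComplex.chains_mono (fun σ => (linesLe_top_iff hω hnd hdim σ).1) k)
  have hmem := Submodule.sub_mem _ hc.1
    (AugComplex.chains_mono (genusFiltration_mono (Nat.le_succ (p + 1))) _ hz)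
  rw [htop] at hmem
  obtain ⟨e, he, hec⟩ :=
    (linesLe_isCone (top_ne_bot_of_finrank (K := K) hn hdim)).exists_boundary_eq hmem hcz
  rw [← htop] at he
  refine (relClass_eq_zero_iff hc).2 (mem_relBoundaries.2 ⟨e, he, z, hz, ?_⟩)
  rw [hec, sub_add_cancel]

/-- The absolute cycle of `exists_cycle_of_dOne_eq_zero` bounds a chain of genus at most `p + 2`, whose
class is a preimage. -/
theorem dOne_exact (hω : ω.IsAlt) (hnd : ω.Nondegenerate) {n : ℕ}
    (hdim : Module.finrank K V = 2 * n) {p : ℕ} (hp : p + 2 ≤ n) :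
    Function.Exact (dOne ω n (p + 1)) (dOne ω n p) := by
  intro x
  constructor
  · intro hx
    obtain ⟨c, hc, rfl⟩ := relClass_surjective x
    obtain ⟨z, hz, hcz⟩ := exists_cycle_of_dOne_eq_zero hω hnd hdim hc hx
    have hmem := Submodule.sub_mem _ hc.1
      (AugComplex.chains_mono (genusFiltration_mono (Nat.le_succ (p + 1))) _ hz)
    obtain ⟨e, he, hec⟩ := genusFiltration_exists_boundary_eq hω hnd hdim hp (by omega)
      (AugComplex.chains_mono (genusFiltration_mono (Nat.le_succ (p + 2))) _ hmem) hcz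
    have he' : e ∈ relCycles (genusFiltration ω (p + 1 + 2)) (genusFiltration ω (p + 1 + 1))
        (n + (p + 1 + 1)) := mem_relCycles.2 ⟨he, by rw [hec]; exact hmem⟩
    have hbe : boundary e ∈ relCycles (genusFiltration ω (p + 1 + 1)) (genusFiltration ω (p + 1))
        (n + (p + 1)) := by
      rw [hec]
      exact mem_relCycles.2 ⟨hmem, by rw [hcz]; exact Submodule.zero_mem _⟩
    refine ⟨relClass e he', ?_⟩
    refine (relClass_eq_iff hbe hc).2
      (mem_relBoundaries.2 ⟨0, Submodule.zero_mem _, -z, Submodule.neg_mem _ hz, ?_⟩)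
    rw [hec, map_zero]
    abel
  · rintro ⟨y, rfl⟩
    obtain ⟨c, hc, rfl⟩ := relClass_surjective y
    have h0 : (0 : Chains (Submodule K V)) ∈
        relCycles (genusFiltration ω (p + 1)) (genusFiltration ω p) (n + p) :=
      Submodule.zero_mem _
    exact (relClass_congr (boundary_boundary c) _ h0).trans
      ((relClass_eq_zero_iff h0).2 (Submodule.zero_mem _))

theorem dOne_surjective (hω : ω.IsAlt) (hnd : ω.Nondegenerate) {n : ℕ} (hn : 1 ≤ n)
    (hdim : Module.finrank K V = 2 * n) : Function.Surjective (dOne ω n 0) := by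
  intro x
  obtain ⟨c, hc, rfl⟩ := relClass_surjective x
  have hbc : boundary c = 0 := by
    have h1 : boundary c ∈ (genusFiltration ω 0).chains (n + 0 - 1) := hc.2
    have h2 : (genusFiltration ω 0).chains (n + 0 - 1) = ⊥ :=
      AugComplex.chains_eq_bot fun l _ _ h => absurd h.2 (Nat.not_lt_zero _)
    rwa [h2, Submodule.mem_bot] at h1
  obtain ⟨e, he, hec⟩ := genusFiltration_exists_boundary_eq hω hnd hdim hn (by omega)
    (AugComplex.chains_mono (genusFiltration_mono (Nat.le_succ 1)) _ hc.1) hbc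
  have he' : e ∈ relCycles (genusFiltration ω (0 + 2)) (genusFiltration ω (0 + 1))
      (n + (0 + 1)) := mem_relCycles.2 ⟨he, by rw [hec]; exact hc.1⟩
  exact ⟨relClass e he', relClass_congr hec _ _⟩

/-- The differential of the resolution: the negative of the connecting homomorphism, transported along
the isomorphisms `comparison`. -/
def differential (hω : ω.IsAlt) (hnd : ω.Nondegenerate) {n : ℕ}
    (hdim : Module.finrank K V = 2 * n) (p : ℕ) : Term ω (p + 1) →ₗ[ℤ] Term ω p :=
  (comparison hω hnd hdim p).symm.toLinearMap ∘ₗ (-dOne ω n p) ∘ₗ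
    (comparison hω hnd hdim (p + 1)).toLinearMap

theorem comparison_differential (hω : ω.IsAlt) (hnd : ω.Nondegenerate) {n : ℕ}
    (hdim : Module.finrank K V = 2 * n) (p : ℕ) (x : Term ω (p + 1)) :
    comparison hω hnd hdim p (differential hω hnd hdim p x) =
      -dOne ω n p (comparison hω hnd hdim (p + 1) x) :=
  LinearEquiv.apply_symm_apply _ _

open scoped Pointwise in
theorem dOne_equivariant {n : ℕ} (p : ℕ) (g : Sp ω) (x : EOne ω n (p + 1)) :
    dOne ω n p (eOneRep ω n (p + 1) g x) = eOneRep ω n p g (dOne ω n p x) := by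
  obtain ⟨c, hc, rfl⟩ := relClass_surjective x
  exact relClass_congr (chainMap_boundary _ c).symm _ _

theorem differential_equivariant (hω : ω.IsAlt) (hnd : ω.Nondegenerate) {n : ℕ}
    (hdim : Module.finrank K V = 2 * n) (p : ℕ) (g : Sp ω) (x : Term ω (p + 1)) :
    differential hω hnd hdim p (termRep ω (p + 1) g x) =
      termRep ω p g (differential hω hnd hdim p x) := by
  refine (comparison hω hnd hdim p).injective ?_
  rw [comparison_differential, comparison_equivariant, comparison_equivariant,
    comparison_differential, dOne_equivariant, map_neg]

theorem differential_injective (hω : ω.IsAlt) (hnd : ω.Nondegenerate) {n : ℕ} (hn : 1 ≤ n)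
    (hdim : Module.finrank K V = 2 * n) {p : ℕ} (hp : p + 1 = n) :
    Function.Injective (differential hω hnd hdim p) :=
  (comparison hω hnd hdim p).symm.injective.comp
    ((neg_injective.comp (dOne_injective hω hnd hn hdim hp)).comp
      (comparison hω hnd hdim (p + 1)).injective)

theorem differential_surjective (hω : ω.IsAlt) (hnd : ω.Nondegenerate) {n : ℕ} (hn : 1 ≤ n)
    (hdim : Module.finrank K V = 2 * n) :
    Function.Surjective (differential hω hnd hdim 0) :=
  (comparison hω hnd hdim 0).symm.surjective.comp
    ((neg_surjective.comp (dOne_surjective hω hnd hn hdim)).comp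
      (comparison hω hnd hdim (0 + 1)).surjective)

theorem differential_exact (hω : ω.IsAlt) (hnd : ω.Nondegenerate) {n : ℕ}
    (hdim : Module.finrank K V = 2 * n) {p : ℕ} (hp : p + 2 ≤ n) :
    Function.Exact (differential hω hnd hdim (p + 1)) (differential hω hnd hdim p) := by
  intro x
  have h := dOne_exact hω hnd hdim hp (comparison hω hnd hdim (p + 1) x)
  constructor
  · intro hx
    have h1 := comparison_differential hω hnd hdim p x
    rw [hx, map_zero, eq_comm, neg_eq_zero] at h1
    obtain ⟨y, hy⟩ := h.1 h1
    refine ⟨(comparison hω hnd hdim (p + 1 + 1)).symm (-y), ?_⟩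
    refine (comparison hω hnd hdim (p + 1)).injective ?_
    rw [comparison_differential, LinearEquiv.apply_symm_apply, map_neg, neg_neg, hy]
  · rintro ⟨y, rfl⟩
    refine (comparison hω hnd hdim p).injective ?_
    have h1 := comparison_differential hω hnd hdim (p + 1) y
    rw [comparison_differential, map_zero, neg_eq_zero]
    refine h.2 ⟨-comparison hω hnd hdim (p + 1 + 1) y, ?_⟩
    rw [h1, map_neg]

theorem steinbergEquivTerm_apartmentClass (hω : ω.IsAlt) (hnd : ω.Nondegenerate) {n : ℕ}
    (hn : 1 ≤ n) (hdim : Module.finrank K V = 2 * n) (v : List V)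
    (hv : IsBasisOf v (⊤ : Submodule K V)) :
    steinbergEquivTerm hω hnd hn hdim (apartmentClass hv) = generator hω n v [] := by
  refine (comparison hω hnd hdim n).injective ?_
  have hdim' : Module.finrank K (⊤ : Submodule K V) = 2 * n := by rw [finrank_top, hdim]
  have had : IsAdapted ω n v [] := by
    refine ⟨⟨⊤, (restrict_nondegenerate_iff_rad hω).2 (rad_top hnd), hdim'⟩, hv, by simp, by simp,
      ?_⟩
    rw [LinearMap.BilinForm.orthogonal_top_eq_bot hnd]
    simp
  obtain ⟨h1, h2⟩ := comparison_generator hω hnd hdim n v [] had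
  obtain ⟨h3, h4⟩ := comparison_steinbergEquivTerm hω hnd hn hdim
    (hv.simplex_mem_relCycles (top_ne_bot_of_finrank hn hdim))
  rw [h2, apartmentClass_eq hv (top_ne_bot_of_finrank hn hdim)
    (by rw [hdim']; exact even_two_mul n), h4]
  refine relClass_congr ?_ _ _
  simp [lineChain]

end Exactness

/-! ### The differential on generators -/

section Formula

section Lists

variable {α β : Type*}

theorem eraseIdx_eraseIdx_of_le (l : List α) {i j : ℕ} (h : i ≤ j) :
    (l.eraseIdx i).eraseIdx j = (l.eraseIdx (j + 1)).eraseIdx i := by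
  induction l generalizing i j with
  | nil => simp
  | cons a l ih =>
    cases i with
    | zero => simp
    | succ i =>
      obtain ⟨j, rfl⟩ : ∃ j', j = j' + 1 := ⟨j - 1, by omega⟩
      simp [ih (Nat.le_of_succ_le_succ h)]

theorem map_eraseIdx' (f : α → β) (l : List α) (i : ℕ) :
    (l.map f).eraseIdx i = (l.eraseIdx i).map f := by
  induction l generalizing i with
  | nil => simp
  | cons a l ih => cases i <;> simp [ih]

/-- Double sums over an index `i` and a second index `k` in the list with `i` removed, in terms of
pairs `a < b` of indices. -/
theorem sum_range_erase_eq {M : Type*} [AddCommGroup M] (m : ℕ) (G : ℕ → ℕ → M) :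
    ∑ i ∈ Finset.range m, ∑ k ∈ Finset.range (m - 1), G i k =
      ∑ x : Fin m × Fin m with x.1 < x.2, (G x.2 x.1 + G x.1 (x.2 - 1)) := by
  rw [Finset.sum_add_distrib, ← Finset.sum_product',
    ← Finset.sum_filter_add_sum_filter_not _ (fun x : ℕ × ℕ => x.2 < x.1)]
  congr 1
  · symm
    refine Finset.sum_bij (fun x _ => ((x.2 : ℕ), (x.1 : ℕ))) ?_ ?_ ?_ (fun _ _ => rfl)
    · rintro ⟨a, b⟩ h
      simp only [Finset.mem_filter, Finset.mem_univ, true_and, Fin.lt_def] at h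
      simp only [Finset.mem_filter, Finset.mem_product, Finset.mem_range]
      omega
    · rintro ⟨a, b⟩ _ ⟨a', b'⟩ _ h
      simp only [Prod.mk.injEq, Fin.ext_iff] at h ⊢
      exact h.symm
    · rintro ⟨i, k⟩ h
      simp only [Finset.mem_filter, Finset.mem_product, Finset.mem_range] at h
      exact ⟨(⟨k, by omega⟩, ⟨i, by omega⟩), by simpa using h.2, rfl⟩
  · symm
    refine Finset.sum_bij (fun x _ => ((x.1 : ℕ), (x.2 : ℕ) - 1)) ?_ ?_ ?_ (fun _ _ => rfl)
    · rintro ⟨a, b⟩ h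
      simp only [Finset.mem_filter, Finset.mem_univ, true_and, Fin.lt_def] at h
      simp only [Finset.mem_filter, Finset.mem_product, Finset.mem_range]
      omega
    · rintro ⟨a, b⟩ h ⟨a', b'⟩ h' heq
      simp only [Finset.mem_filter, Finset.mem_univ, true_and, Fin.lt_def] at h h'
      simp only [Prod.mk.injEq, Fin.ext_iff] at heq ⊢
      omega
    · rintro ⟨i, k⟩ h
      simp only [Finset.mem_filter, Finset.mem_product, Finset.mem_range] at h
      refine ⟨(⟨i, by omega⟩, ⟨k + 1, by omega⟩), ?_, rfl⟩
      simp only [Finset.mem_filter, Finset.mem_univ, true_and, Fin.lt_def]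
      omega

theorem removePair_sublist (v : List α) (i j : ℕ) : (removePair v i j).Sublist v :=
  (List.eraseIdx_sublist _ _).trans (List.eraseIdx_sublist _ _)

theorem length_removePair {v : List α} {i j : ℕ} (hij : i < j) (hj : j < v.length) :
    (removePair v i j).length = v.length - 2 := by
  rw [removePair, List.length_eraseIdx_of_lt, List.length_eraseIdx_of_lt hj]
  · omega
  · rw [List.length_eraseIdx_of_lt hj]
    omega

end Lists

variable {K V : Type*} [Field K] [AddCommGroup V] [Module K V] {ω : LinearMap.BilinForm K V}

theorem span_eraseIdx_sup (v : List V) {i : ℕ} (hi : i < v.length) :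
    Submodule.span K {x | x ∈ v.eraseIdx i} ⊔ Submodule.span K {v[i]} =
      Submodule.span K {x | x ∈ v} := by
  rw [← Submodule.span_union]
  congr 1
  ext x
  have := (List.getElem_cons_eraseIdx_perm hi).mem_iff (a := x)
  simp only [List.mem_cons] at this
  simp only [Set.mem_union, Set.mem_ofPred_eq, Set.mem_singleton_iff, ← this]
  exact Or.comm

theorem IsBasisOf.of_sublist {v v' : List V} {W : Submodule K V} (h : IsBasisOf v W)
    (hv : v'.Sublist v) : IsBasisOf v' (Submodule.span K {x | x ∈ v'}) := by
  obtain ⟨f, hf⟩ := List.sublist_iff_exists_fin_orderEmbedding_get_eq.1 hv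
  refine ⟨?_, rfl⟩
  have : v'.get = v.get ∘ f := funext hf
  rw [this]
  exact h.1.comp f f.injective

theorem spanRemovePair_sup_left (v : List V) {i j : ℕ} (hij : i < j) (hj : j < v.length) :
    spanRemovePair K v i j ⊔ Submodule.span K {v[i]} =
      Submodule.span K {x | x ∈ v.eraseIdx j} := by
  have hi : i < (v.eraseIdx j).length := by
    rw [List.length_eraseIdx_of_lt hj]
    omega
  rw [← span_eraseIdx_sup _ hi, List.getElem_eraseIdx_of_lt hi hij]
  rfl

theorem spanRemovePair_sup_right (v : List V) {i j : ℕ} (hij : i < j) (hj : j < v.length) :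
    spanRemovePair K v i j ⊔ Submodule.span K {v[j]} =
      Submodule.span K {x | x ∈ v.eraseIdx i} := by
  obtain ⟨j, rfl⟩ : ∃ j', j = j' + 1 := ⟨j - 1, by omega⟩
  have hi : j < (v.eraseIdx i).length := by
    rw [List.length_eraseIdx_of_lt (by omega)]
    omega
  rw [← span_eraseIdx_sup _ hi, List.getElem_eraseIdx_of_ge hi (by omega),
    eraseIdx_eraseIdx_of_le _ (by omega)]
  rfl

theorem span_le_orthogonal_self (hω : ω.IsAlt) (x : V) :
    Submodule.span K {x} ≤ ω.orthogonal (Submodule.span K {x}) := by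
  intro y hy z hz
  obtain ⟨a, rfl⟩ := Submodule.mem_span_singleton.1 hy
  obtain ⟨b, rfl⟩ := Submodule.mem_span_singleton.1 hz
  simp [hω.self_eq_zero]

theorem sum_smul_relClass {S ι : Type*} {X Y : AugComplex S} {k : ℕ} (s : Finset ι) (a : ι → ℤ)
    (f : ι → Chains S) (y : ι → RelHomology X Y k)
    (hy : ∀ x ∈ s, ∃ h : f x ∈ relCycles X Y k, y x = relClass (f x) h) :
    ∃ h : ∑ x ∈ s, a x • f x ∈ relCycles X Y k,
      ∑ x ∈ s, a x • y x = relClass (∑ x ∈ s, a x • f x) h := by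
  classical
  induction s using Finset.induction_on with
  | empty => exact ⟨Submodule.zero_mem _, rfl⟩
  | insert x s hx ih =>
    obtain ⟨h1, h2⟩ := ih fun z hz => hy z (Finset.mem_insert_of_mem hz)
    obtain ⟨h3, h4⟩ := hy x (Finset.mem_insert_self _ _)
    have h5 : ∑ x ∈ insert x s, a x • f x = a x • f x + ∑ x ∈ s, a x • f x :=
      Finset.sum_insert hx
    refine ⟨by rw [h5]; exact Submodule.add_mem _ (Submodule.smul_mem _ _ h3) h1, ?_⟩
    rw [Finset.sum_insert hx, h2, h4]
    exact relClass_congr h5.symm (Submodule.add_mem _ (Submodule.smul_mem _ _ h3) h1) _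

/-- Coning off each face `[…, v̂ᵢ, …]` from a line `r i` turns the boundary of the chain of an
adapted pair into a sum over pairs of indices. -/
theorem boundary_cone_faces (v : List V) (u : List (V × V)) (r : ℕ → Submodule K V) :
    boundary (∑ i ∈ Finset.range v.length, (-1 : ℤ) ^ i •
        (simplex [r i] * (simplex ((v.eraseIdx i).map fun x => Submodule.span K {x}) *
          crossChain K u))) =
      boundary (lineChain K v u) -
        ∑ x : Fin v.length × Fin v.length with x.1 < x.2, (-1 : ℤ) ^ ((x.1 : ℕ) + x.2) •
          ((simplex [r x.2] - simplex [r x.1]) *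
            (simplex ((removePair v x.1 x.2).map fun x => Submodule.span K {x}) *
              crossChain K u)) := by
  set f : V → Submodule K V := fun x => Submodule.span K {x}
  have hface : ∀ i, boundary (simplex [r i] * (simplex ((v.eraseIdx i).map f) * crossChain K u)) =
      simplex ((v.eraseIdx i).map f) * crossChain K u -
        simplex [r i] * (boundary (simplex ((v.eraseIdx i).map f)) * crossChain K u) := by
    intro i
    rw [boundary_singleton_mul, boundary_simplex_mul, boundary_crossChain, mul_zero, smul_zero,
      add_zero]
  have h1 : boundary (lineChain K v u) = ∑ i ∈ Finset.range v.length, (-1 : ℤ) ^ i •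
      (simplex ((v.eraseIdx i).map f) * crossChain K u) := by
    rw [lineChain_eq, boundary_simplex_mul, boundary_crossChain, mul_zero, smul_zero, add_zero,
      boundary_simplex, Finset.sum_mul, List.length_map]
    simp only [map_eraseIdx', smul_mul_assoc]
    rfl
  rw [map_sum, h1]
  simp only [map_zsmul, hface, smul_sub, Finset.sum_sub_distrib]
  congr 1
  let G : ℕ → ℕ → Chains (Submodule K V) := fun i k => (-1 : ℤ) ^ (i + k) •
    (simplex [r i] * (simplex (((v.eraseIdx i).eraseIdx k).map f) * crossChain K u))
  have h2 : ∀ i ∈ Finset.range v.length, (-1 : ℤ) ^ i •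
      (simplex [r i] * (boundary (simplex ((v.eraseIdx i).map f)) * crossChain K u)) =
        ∑ k ∈ Finset.range (v.length - 1), G i k := by
    intro i hi
    rw [boundary_simplex, List.length_map, List.length_eraseIdx_of_lt (Finset.mem_range.1 hi),
      Finset.sum_mul, Finset.mul_sum, Finset.smul_sum]
    refine Finset.sum_congr rfl fun k _ => ?_
    rw [map_eraseIdx', smul_mul_assoc, mul_smul_comm, smul_smul, ← pow_add]
  rw [Finset.sum_congr rfl h2, sum_range_erase_eq]
  refine Finset.sum_congr rfl fun x hx => ?_
  obtain ⟨a, b⟩ := x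
  have hab : (a : ℕ) < b := (Finset.mem_filter.1 hx).2
  obtain ⟨b', hb'⟩ : ∃ b', (b : ℕ) = b' + 1 := ⟨b - 1, by omega⟩
  simp only [G, sub_mul, smul_sub]
  rw [hb', Nat.add_sub_cancel, eraseIdx_eraseIdx_of_le _ (by omega : (a : ℕ) ≤ b'), removePair,
    add_comm (b' + 1) (a : ℕ), ← add_assoc, pow_succ, mul_neg_one, neg_smul, neg_smul, sub_neg_eq_add]

/-- The first cross-polytope factor commutes with the simplex of `v`, because `v` has an even number
of vectors. -/
theorem lineChain_cons (v : List V) (a : V × V) (u : List (V × V)) (hv : Even v.length) :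
    lineChain K v (a :: u) =
      (simplex [Submodule.span K {a.1}] - simplex [Submodule.span K {a.2}]) *
        (simplex (v.map fun x => Submodule.span K {x}) * crossChain K u) := by
  have h : ∀ x : V, simplex (v.map fun x => Submodule.span K {x}) *
      simplex [Submodule.span K {x}] =
        simplex [Submodule.span K {x}] * simplex (v.map fun x => Submodule.span K {x}) := by
    intro x
    rw [simplex_mul_comm, List.length_map, List.length_singleton, mul_one, hv.neg_one_pow, one_smul]
  rw [lineChain_eq, crossChain_cons, ← mul_assoc, ← mul_assoc, mul_sub, h, h, ← sub_mul]

variable [FiniteDimensional K V]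

theorem isCompl_orthogonal (hω : ω.IsAlt) {U : Submodule K V} (hU : rad ω U = ⊥) :
    IsCompl (ω.orthogonal U) U :=
  (LinearMap.BilinForm.isCompl_orthogonal_of_restrict_nondegenerate hω.isRefl
    ((restrict_nondegenerate_iff_rad hω).2 hU)).symm

theorem perpProj_mem (hω : ω.IsAlt) {U : Submodule K V} (hU : rad ω U = ⊥) (x : V) :
    perpProj ω U x ∈ ω.orthogonal U := by
  rw [perpProj, dif_pos (isCompl_orthogonal hω hU)]
  exact Submodule.projection_apply_mem _ _

theorem sub_perpProj_mem (hω : ω.IsAlt) {U : Submodule K V} (hU : rad ω U = ⊥) (x : V) :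
    x - perpProj ω U x ∈ U := by
  rw [perpProj, dif_pos (isCompl_orthogonal hω hU)]
  nth_rewrite 1 [← Submodule.projection_add_projection_eq_self (isCompl_orthogonal hω hU) x]
  rw [add_sub_cancel_left]
  exact Submodule.projection_apply_mem _ _

theorem sup_span_perpProj (hω : ω.IsAlt) {U : Submodule K V} (hU : rad ω U = ⊥) (x : V) :
    U ⊔ Submodule.span K {perpProj ω U x} = U ⊔ Submodule.span K {x} := by
  have h := sub_perpProj_mem hω hU x
  refine le_antisymm (sup_le le_sup_left ?_) (sup_le le_sup_left ?_) <;>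
    rw [Submodule.span_singleton_le_iff_mem]
  · have : x - (x - perpProj ω U x) ∈ U ⊔ Submodule.span K {x} :=
      Submodule.sub_mem _ (Submodule.mem_sup_right (Submodule.mem_span_singleton_self _))
        (Submodule.mem_sup_left h)
    rwa [sub_sub_cancel] at this
  · have : (x - perpProj ω U x) + perpProj ω U x ∈ U ⊔ Submodule.span K {perpProj ω U x} :=
      Submodule.add_mem_sup h (Submodule.mem_span_singleton_self _)
    rwa [sub_add_cancel] at this

/-- If `U` is symplectic then the radical of `U + ⟨x⟩` is spanned by the component of `x`
orthogonal to `U`. -/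
theorem rad_sup_span (hω : ω.IsAlt) {U : Submodule K V} (hU : rad ω U = ⊥) (x : V) :
    rad ω (U ⊔ Submodule.span K {x}) = Submodule.span K {perpProj ω U x} := by
  rw [← sup_span_perpProj hω hU, rad_sup_eq hω, hU, bot_sup_eq]
  · rw [Submodule.span_singleton_le_iff_mem]
    exact perpProj_mem hω hU x
  · exact span_le_orthogonal_self hω _

/-- Removing from `v` two vectors such that the others span a symplectic subspace `H`, and adding
their components orthogonal to `H` to `u`, gives an adapted pair again. -/
theorem IsAdapted.removePair (hω : ω.IsAlt) {p : ℕ} {v : List V}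
    {u : List (V × V)} (h : IsAdapted ω (p + 1) v u) {i j : ℕ} (hij : i < j) (hj : j < v.length)
    (hH : rad ω (spanRemovePair K v i j) = ⊥) :
    IsAdapted ω p (removePair v i j) ((perpProj ω (spanRemovePair K v i j) v[i],
      perpProj ω (spanRemovePair K v i j) v[j]) :: u) := by
  obtain ⟨W, hv, hu⟩ := h
  have hlen : v.length = 2 * (p + 1) := by rw [← hv.finrank_eq, W.finrank_eq]
  have hb := hv.of_sublist (removePair_sublist v i j)
  have hHdim : Module.finrank K (spanRemovePair K v i j) = 2 * p := by
    have := hb.finrank_eq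
    rw [length_removePair hij hj] at this
    exact this.trans (by omega)
  have hWperp : rad ω W.1 = ⊥ := W.rad_eq_bot hω
  set H := spanRemovePair K v i j with hHdef
  have hsup : H ⊔ Submodule.span K {perpProj ω H v[i]} ⊔ Submodule.span K {perpProj ω H v[j]} =
      W.1 := by
    rw [sup_span_perpProj hω hH, sup_right_comm, sup_span_perpProj hω hH, sup_right_comm,
      spanRemovePair_sup_left v hij hj, span_eraseIdx_sup, hv.2]
  have hi' := perpProj_mem hω hH v[i]
  have hj' := perpProj_mem hω hH v[j]
  set x := perpProj ω H v[i]
  set y := perpProj ω H v[j]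
  have hHW : H ≤ W.1 := by
    rw [← hsup, sup_assoc]
    exact le_sup_left
  have hxW : x ∈ W.1 := by
    rw [← hsup]
    exact Submodule.mem_sup_left (Submodule.mem_sup_right (Submodule.mem_span_singleton_self _))
  have hyW : y ∈ W.1 := by
    rw [← hsup]
    exact Submodule.mem_sup_right (Submodule.mem_span_singleton_self _)
  have hperp : ∀ w ∈ W.1, ∀ z ∈ ω.orthogonal W.1, ω w z = 0 := fun w hw z hz => hz w hw
  have hmem : ∀ b ∈ u, b.1 ∈ ω.orthogonal W.1 ∧ b.2 ∈ ω.orthogonal W.1 := by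
    intro b hb
    rw [← hu.2.2]
    exact ⟨Submodule.subset_span ⟨b, hb, Or.inl rfl⟩, Submodule.subset_span ⟨b, hb, Or.inr rfl⟩⟩
  refine ⟨⟨H, (restrict_nondegenerate_iff_rad hω).2 hH, hHdim⟩, hb, ?_, ?_, ?_⟩
  · rintro a (_ | ⟨_, ha⟩)
    swap
    · exact hu.1 a ha
    change ω x y ≠ 0
    intro h0
    -- otherwise `x` is in the radical of `W`, so it vanishes, and `W` has dimension at most `2p + 1`
    have hx0 : x ∈ rad ω W.1 := by
      refine ⟨hxW, ?_⟩
      have : W.1 ≤ ω.orthogonal (Submodule.span K {x}) := by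
        rw [← hsup]
        refine sup_le (sup_le ?_ (span_le_orthogonal_self hω x)) ?_
        · rw [le_orthogonal_comm hω, Submodule.span_singleton_le_iff_mem]
          exact hi'
        · rw [Submodule.span_singleton_le_iff_mem]
          intro z hz
          obtain ⟨a, rfl⟩ := Submodule.mem_span_singleton.1 hz
          change ω (a • x) y = 0
          rw [map_smul, LinearMap.smul_apply, h0, smul_zero]
      exact (le_orthogonal_comm hω).1 this (Submodule.mem_span_singleton_self x)
    rw [hWperp, Submodule.mem_bot] at hx0
    rw [hx0, Submodule.span_zero_singleton, sup_bot_eq] at hsup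
    have h1 := Submodule.finrank_add_le_finrank_add_finrank H (Submodule.span K {y})
    have h2 : Module.finrank K (Submodule.span K {y}) ≤ 1 := by
      simpa using finrank_span_le_card (R := K) ({y} : Set V)
    rw [hsup, W.finrank_eq] at h1
    omega
  · refine List.pairwise_cons.2 ⟨fun b hb => ?_, hu.2.1⟩
    exact ⟨hperp _ hxW _ (hmem b hb).1, hperp _ hxW _ (hmem b hb).2,
      hperp _ hyW _ (hmem b hb).1, hperp _ hyW _ (hmem b hb).2⟩
  · have hset : {z | ∃ a ∈ (x, y) :: u, z = a.1 ∨ z = a.2} =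
        ({x} ∪ {y}) ∪ {z | ∃ a ∈ u, z = a.1 ∨ z = a.2} := by
      ext z
      simp only [List.mem_cons, exists_eq_or_imp, Set.mem_union, Set.mem_ofPred_eq,
        Set.mem_singleton_iff]
    rw [hset, Submodule.span_union, Submodule.span_union, hu.2.2]
    have hle : Submodule.span K {x} ⊔ Submodule.span K {y} ⊔ ω.orthogonal W.1 ≤
        ω.orthogonal H := by
      refine sup_le (sup_le ?_ ?_) (LinearMap.BilinForm.orthogonal_le hHW)
      · rwa [Submodule.span_singleton_le_iff_mem]
      · rwa [Submodule.span_singleton_le_iff_mem]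
    have hc := isCompl_orthogonal hω hH
    refine eq_of_le_of_inf_le_of_sup_le hle (z := H) ?_ ?_
    · rw [hc.inf_eq_bot]
      exact bot_le
    · have htop := (isCompl_orthogonal hω hWperp).sup_eq_top
      have : Submodule.span K {x} ⊔ Submodule.span K {y} ⊔ ω.orthogonal W.1 ⊔ H = ⊤ := by
        rw [← htop, ← hsup]
        ac_rfl
      rw [this]
      exact le_top

/-- An odd number of independent vectors spans a degenerate subspace. -/
theorem rad_eraseIdx_ne_bot (hω : ω.IsAlt) {v : List V} {W : Submodule K V} (hv : IsBasisOf v W)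
    (heven : Even v.length) {i : ℕ} (hi : i < v.length) :
    rad ω (Submodule.span K {x | x ∈ v.eraseIdx i}) ≠ ⊥ := by
  intro h
  have h1 := finrank_eq_of_rad_eq_bot hω h
  rw [(hv.of_sublist (List.eraseIdx_sublist v i)).finrank_eq, List.length_eraseIdx_of_lt hi] at h1
  obtain ⟨m, hm⟩ := heven
  omega

open scoped Classical in
/-- Up to relative boundaries and sign, the boundary of the chain of an adapted pair `(v, u)` is
the sum of the chains of the adapted pairs obtained by removing two vectors from `v`: each face
`[…, v̂ᵢ, …]` is coned off from a line `r i` in the radical of its span. -/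
theorem neg_boundary_lineChain_sub_mem (hω : ω.IsAlt) (hnd : ω.Nondegenerate) {n : ℕ}
    (hdim : Module.finrank K V = 2 * n) {p : ℕ} {v : List V} {u : List (V × V)}
    (h : IsAdapted ω (p + 1) v u) :
    -boundary (lineChain K v u) -
      ∑ x : Fin v.length × Fin v.length with
        x.1 < x.2 ∧ (ω.restrict (spanRemovePair K v x.1 x.2)).Nondegenerate,
        (-1 : ℤ) ^ ((x.1 : ℕ) + (x.2 : ℕ) + 1) • lineChain K (removePair v x.1 x.2)
          ((perpProj ω (spanRemovePair K v x.1 x.2) (v.get x.1),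
            perpProj ω (spanRemovePair K v x.1 x.2) (v.get x.2)) :: u) ∈
      relBoundaries (genusFiltration ω (p + 1)) (genusFiltration ω p) (n + p) := by
  obtain ⟨W, hv, hu⟩ := h
  have hlen : v.length = 2 * (p + 1) := by rw [← hv.finrank_eq, W.finrank_eq]
  have hulen : v.length + u.length = n + p + 1 := by
    have h1 := W.index_eq hnd hdim
    rw [hu.finrank_eq hω, Nat.mul_div_cancel _ two_pos, hv.finrank_eq] at h1
    omega
  have hWperp : rad ω W.1 = ⊥ := W.rad_eq_bot hω
  have hsub : ∀ {v' : List V}, v'.Sublist v → Submodule.span K {x | x ∈ v'} ≤ W.1 := by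
    intro v' hv'
    rw [← hv.2]
    exact Submodule.span_mono fun x hx => hv'.subset hx
  -- chains in a subspace `U` of `W`, joined with the chain of `u`
  have hmul : ∀ {U : Submodule K V} {q k : ℕ} {c : Chains (Submodule K V)}, U ≤ W.1 →
      genus ω U < q → c ∈ (linesLe U).chains k →
      c * crossChain K u ∈ (genusFiltration ω q).chains (k + u.length) := by
    intro U q k c hU hq hc
    refine AugComplex.mul_mem_chains (fun _ _ => union_mem_genusFiltration hω hq) hc
      (AugComplex.chains_mono (X := isoLines ω (ω.orthogonal W.1)) (Y := isoLines ω _) ?_ _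
        (crossChain_mem hω hu))
    exact fun σ hσ => ⟨hσ.1, hσ.2.1.trans (LinearMap.BilinForm.orthogonal_le hU), hσ.2.2⟩
  -- joins of a line in `U` with lines of a list of vectors of `U`
  have hcone : ∀ {U L : Submodule K V} {v' : List V}, L ≤ U → Module.finrank K L = 1 →
      v'.Sublist v → Submodule.span K {x | x ∈ v'} ≤ U →
      simplex [L] * simplex (v'.map fun x => Submodule.span K {x}) ∈
        (linesLe U).chains (v'.length + 1) := by
    intro U L v' hL hL1 hv' hU
    refine AugComplex.IsCone.mul_mem (lineComplex_isCone _ hL1 fun U' (hU' : U' ≤ U) =>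
      show _ ≤ U from sup_le hL hU') (AugComplex.simplex_mem_chains (List.length_map _) ⟨?_, ?_⟩)
    · exact fun L' hL' => (hv.of_sublist hv').finrank_span hL'
    · rw [sSup_span_list]
      exact hU
  set r : ℕ → Submodule K V := fun i => lineIn (rad ω (Submodule.span K {x | x ∈ v.eraseIdx i}))
  have hrle : ∀ i, r i ≤ Submodule.span K {x | x ∈ v.eraseIdx i} := fun i =>
    (lineIn_le _).trans (rad_le _)
  have hr1 : ∀ {i}, i < v.length → Module.finrank K (r i) = 1 := fun hi =>
    finrank_lineIn (rad_eraseIdx_ne_bot hω hv (hlen ▸ even_two_mul _) hi)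
  have hrW : ∀ i, r i ≤ W.1 := fun i => (hrle i).trans (hsub (List.eraseIdx_sublist _ _))
  have hperp : ∀ i, r i ≤ ω.orthogonal (Submodule.span K {x | x ∈ v.eraseIdx i}) := fun i =>
    (lineIn_le _).trans inf_le_right
  have key := boundary_cone_faces v u r
  rw [← Finset.sum_filter_add_sum_filter_not _
    (fun x : Fin v.length × Fin v.length =>
      (ω.restrict (spanRemovePair K v x.1 x.2)).Nondegenerate), Finset.filter_filter,
    Finset.filter_filter] at key
  -- the pairs of indices contribute to the sum or to chains of lower genus
  have hcomb : ∀ {E B c G G' : Chains (Submodule K V)}, boundary E = c - (G + B) →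
      E ∈ (genusFiltration ω (p + 1)).chains (n + p + 1) →
      B ∈ (genusFiltration ω p).chains (n + p) → G' = -G →
      -c - G' ∈ relBoundaries (genusFiltration ω (p + 1)) (genusFiltration ω p) (n + p) := by
    intro E B c G G' hE hEm hB hG
    refine mem_relBoundaries.2 ⟨-E, Submodule.neg_mem _ hEm, -B, Submodule.neg_mem _ hB, ?_⟩
    rw [map_neg, hE, hG]
    abel
  refine hcomb key ?_ ?_ ?_
  rotate_left 2
  · have hgood : ∀ x ∈ Finset.univ.filter (fun x : Fin v.length × Fin v.length =>
        x.1 < x.2 ∧ (ω.restrict (spanRemovePair K v x.1 x.2)).Nondegenerate),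
        (-1 : ℤ) ^ ((x.1 : ℕ) + (x.2 : ℕ) + 1) • lineChain K (removePair v x.1 x.2)
          ((perpProj ω (spanRemovePair K v x.1 x.2) (v.get x.1),
            perpProj ω (spanRemovePair K v x.1 x.2) (v.get x.2)) :: u) =
        -((-1 : ℤ) ^ ((x.1 : ℕ) + x.2) • ((simplex [r x.2] - simplex [r x.1]) *
            (simplex ((removePair v x.1 x.2).map fun x => Submodule.span K {x}) *
              crossChain K u))) := by
      rintro ⟨a, b⟩ hx
      obtain ⟨hab, hnd'⟩ : (a : ℕ) < b ∧ _ := (Finset.mem_filter.1 hx).2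
      have hH := (restrict_nondegenerate_iff_rad hω).1 hnd'
      -- both radicals are lines, spanned by the vectors of the new hyperbolic pair
      have heq : ∀ {i : ℕ} {x : V}, i < v.length →
          rad ω (Submodule.span K {x | x ∈ v.eraseIdx i}) = Submodule.span K {x} →
          r i = Submodule.span K {x} := by
        intro i x hi hx
        have hle : r i ≤ Submodule.span K {x} := (lineIn_le _).trans hx.le
        refine Submodule.eq_of_le_of_finrank_le hle ?_
        rw [hr1 hi]
        simpa using finrank_span_le_card (R := K) ({x} : Set V)
      have hra := heq a.2 (by
        rw [← spanRemovePair_sup_right v hab b.2]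
        exact rad_sup_span hω hH _)
      have hrb := heq b.2 (by
        rw [← spanRemovePair_sup_left v hab b.2]
        exact rad_sup_span hω hH _)
      rw [lineChain_cons _ _ _ (by
        rw [length_removePair hab b.2, hlen]
        exact ⟨p, by omega⟩)]
      simp only [hra, hrb, pow_succ, mul_neg_one, neg_smul]
      rfl
    rw [Finset.sum_congr rfl hgood, Finset.sum_neg_distrib]
  · refine Submodule.sum_mem _ fun i hi => Submodule.smul_mem _ _ ?_
    have hi' := Finset.mem_range.1 hi
    rw [← mul_assoc]
    have hlt : Submodule.span K {x | x ∈ v.eraseIdx i} < W.1 := by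
      refine (hsub (List.eraseIdx_sublist v i)).lt_of_ne fun heq => ?_
      refine rad_eraseIdx_ne_bot hω hv (hlen ▸ even_two_mul _) hi' ?_
      rw [heq, hWperp]
    have hg := genus_lt_of_lt hω hWperp hlt
    rw [W.genus_eq hω] at hg
    have := hmul hlt.le hg (hcone (hrle i) (hr1 hi') (List.eraseIdx_sublist v i) le_rfl)
    rwa [List.length_eraseIdx_of_lt hi', (by omega : v.length - 1 + 1 + u.length = n + p + 1)]
      at this
  · refine Submodule.sum_mem _ fun x hx => Submodule.smul_mem _ _ ?_
    obtain ⟨a, b⟩ := x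
    obtain ⟨hab, hnd'⟩ : (a : ℕ) < b ∧ _ := (Finset.mem_filter.1 hx).2
    -- here the remaining vectors span a degenerate subspace, of genus less than `p`
    have hHdim : Module.finrank K (spanRemovePair K v a b) = 2 * p := by
      have h1 := (hv.of_sublist (removePair_sublist v a b)).finrank_eq
      rw [length_removePair hab b.2] at h1
      exact h1.trans (by omega)
    have hgenus : genus ω (spanRemovePair K v a b) < p := by
      have h1 := finrank_eq_rad_add_genus hω (spanRemovePair K v a b)
      have h2 : Module.finrank K (rad ω (spanRemovePair K v a b)) ≠ 0 := fun h0 =>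
        hnd' ((restrict_nondegenerate_iff_rad hω).2 (Submodule.finrank_eq_zero.1 h0))
      omega
    have hmem : ∀ {i : ℕ}, i < v.length →
        spanRemovePair K v a b ≤ Submodule.span K {x | x ∈ v.eraseIdx i} →
        simplex [r i] * (simplex ((removePair v a b).map fun x => Submodule.span K {x}) *
          crossChain K u) ∈ (genusFiltration ω p).chains (n + p) := by
      intro i hi hle
      have hg : genus ω (spanRemovePair K v a b ⊔ r i) < p := by
        rw [genus_sup_eq hω ((hperp i).trans (LinearMap.BilinForm.orthogonal_le hle))
          ((hperp i).trans (LinearMap.BilinForm.orthogonal_le (hrle i)))]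
        exact hgenus
      have := hmul (sup_le (hsub (removePair_sublist v a b)) (hrW i)) hg
        (hcone le_sup_right (hr1 hi) (removePair_sublist v a b) le_sup_left)
      rwa [length_removePair hab b.2, mul_assoc,
        (by omega : v.length - 2 + 1 + u.length = n + p)] at this
    rw [sub_mul]
    refine Submodule.sub_mem _ (hmem b.2 ?_) (hmem a.2 ?_)
    · rw [← spanRemovePair_sup_left v hab b.2]
      exact le_sup_left
    · rw [← spanRemovePair_sup_right v hab b.2]
      exact le_sup_left

open scoped Classical in
theorem differential_generator (hω : ω.IsAlt) (hnd : ω.Nondegenerate) {n : ℕ}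
    (hdim : Module.finrank K V = 2 * n) (p : ℕ) (v : List V) (u : List (V × V))
    (h : IsAdapted ω (p + 1) v u) :
    differential hω hnd hdim p (generator hω (p + 1) v u) =
      ∑ x : Fin v.length × Fin v.length with
        x.1 < x.2 ∧ (ω.restrict (spanRemovePair K v x.1 x.2)).Nondegenerate,
        (-1 : ℤ) ^ ((x.1 : ℕ) + (x.2 : ℕ) + 1) •
          generator hω p (removePair v x.1 x.2)
            ((perpProj ω (spanRemovePair K v x.1 x.2) (v.get x.1),
              perpProj ω (spanRemovePair K v x.1 x.2) (v.get x.2)) :: u) := by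
  refine (comparison hω hnd hdim p).injective ?_
  obtain ⟨hc, h1⟩ := comparison_generator hω hnd hdim (p + 1) v u h
  rw [comparison_differential, h1, map_sum]
  simp only [map_zsmul]
  obtain ⟨hs, h2⟩ := sum_smul_relClass
    (X := genusFiltration ω (p + 1)) (Y := genusFiltration ω p) (k := n + p)
    (Finset.univ.filter fun x : Fin v.length × Fin v.length =>
      x.1 < x.2 ∧ (ω.restrict (spanRemovePair K v x.1 x.2)).Nondegenerate)
    (fun x => (-1 : ℤ) ^ ((x.1 : ℕ) + (x.2 : ℕ) + 1))
    (fun x => lineChain K (removePair v x.1 x.2)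
      ((perpProj ω (spanRemovePair K v x.1 x.2) (v.get x.1),
        perpProj ω (spanRemovePair K v x.1 x.2) (v.get x.2)) :: u))
    (fun x => comparison hω hnd hdim p (generator hω p (removePair v x.1 x.2)
      ((perpProj ω (spanRemovePair K v x.1 x.2) (v.get x.1),
        perpProj ω (spanRemovePair K v x.1 x.2) (v.get x.2)) :: u))) (fun x hx => by
      obtain ⟨hab, hnd'⟩ := (Finset.mem_filter.1 hx).2
      exact comparison_generator hω hnd hdim p _ _
        (h.removePair hω hab x.2.2 ((restrict_nondegenerate_iff_rad hω).1 hnd')))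
  have hb : -boundary (lineChain K v u) ∈
      relCycles (genusFiltration ω (p + 1)) (genusFiltration ω p) (n + p) := by
    refine Submodule.neg_mem _ (mem_relCycles.2 ⟨hc.2, ?_⟩)
    rw [boundary_boundary]
    exact Submodule.zero_mem _
  have h3 := (relClass_eq_iff hb hs).2 (neg_boundary_lineChain_sub_mem hω hnd hdim h)
  exact h3.trans h2.symm

end Formula

end SymplecticResolution

end

open SymplecticResolution in
open scoped Classical in
theorem mainTheorem2 {K V : Type*} [Field K] [AddCommGroup V] [Module K V] [FiniteDimensional K V]
    (ω : LinearMap.BilinForm K V) (hω : ω.IsAlt) (hnd : ω.Nondegenerate)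
    (n : ℕ) (hn : 1 ≤ n) (hdim : Module.finrank K V = 2 * n) :
    ∃ (d : ∀ p : ℕ, Term ω (p + 1) →ₗ[ℤ] Term ω p)
      (η : Steinberg (⊤ : Submodule K V) ≃ₗ[ℤ] Term ω n)
      (φ : ∀ p : ℕ, Term ω p ≃ₗ[ℤ] EOne ω n p),
      -- `η` identifies `St(V)` with the term of degree `n`, `Sp(V)`-equivariantly
      (∀ (g : Sp ω) x, η (steinbergRep ω g x) = termRep ω n g (η x)) ∧
      (∀ (v : List V) (hv : IsBasisOf v (⊤ : Submodule K V)),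
        η (apartmentClass hv) = generator hω n v []) ∧
      -- the differentials are `Sp(V)`-equivariant
      (∀ (p : ℕ) (g : Sp ω) x, d p (termRep ω (p + 1) g x) = termRep ω p g (d p x)) ∧
      -- exactness of `0 → St(V) ≅ Term n → Term (n - 1) → ⋯ → Term 1 → Term 0 = St^ω(V) → 0`
      (∀ p : ℕ, p + 1 = n → Function.Injective (d p)) ∧
      (∀ p : ℕ, p + 2 ≤ n → Function.Exact (d (p + 1)) (d p)) ∧
      Function.Surjective (d 0) ∧
      -- the formula for the differential on products of apartment classes
      (∀ (p : ℕ) (v : List V) (u : List (V × V)), IsAdapted ω (p + 1) v u →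
        d p (generator hω (p + 1) v u) =
          ∑ x : Fin v.length × Fin v.length with
            x.1 < x.2 ∧ (ω.restrict (spanRemovePair K v x.1 x.2)).Nondegenerate,
            (-1 : ℤ) ^ ((x.1 : ℕ) + (x.2 : ℕ) + 1) •
              generator hω p (removePair v x.1 x.2)
                ((perpProj ω (spanRemovePair K v x.1 x.2) (v.get x.1),
                  perpProj ω (spanRemovePair K v x.1 x.2) (v.get x.2)) :: u)) ∧
      -- the resolution is, up to sign, the row `E¹_{•,n-1}` of the genus filtration spectral sequence
      (∀ (p : ℕ) (g : Sp ω) x, φ p (termRep ω p g x) = eOneRep ω n p g (φ p x)) ∧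
      (∀ (p : ℕ) (v : List V) (u : List (V × V)), IsAdapted ω p v u →
        ∃ hc : lineChain K v u ∈
            relCycles (genusFiltration ω (p + 1)) (genusFiltration ω p) (n + p),
          φ p (generator hω p v u) = relClass (lineChain K v u) hc) ∧
      (∀ (p : ℕ) x, φ p (d p x) = - dOne ω n p (φ (p + 1) x)) := by
  exact ⟨differential hω hnd hdim, steinbergEquivTerm hω hnd hn hdim, comparison hω hnd hdim,
    steinbergEquivTerm_equivariant hω hnd hn hdim,
    steinbergEquivTerm_apartmentClass hω hnd hn hdim,
    differential_equivariant hω hnd hdim,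
    fun _ hp => differential_injective hω hnd hn hdim hp,
    fun _ hp => differential_exact hω hnd hdim hp,
    differential_surjective hω hnd hn hdim,
    differential_generator hω hnd hdim,
    comparison_equivariant hω hnd hdim,
    comparison_generator hω hnd hdim,
    comparison_differential hω hnd hdim⟩
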